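/- Let $(M^n,g)$ be a compact connected Riemannian spin manifold with spinor bundle $\Sigma M$, Clifford multiplication normalized by $X\cdot X\cdot\psi=-|X|^2\psi$, and spinorial Levi-Civita connection $\nabla$. For a spinor field $\psi\in\Gamma(\Sigma M)$ the energy-momentum tensor is the symmetric $2$-tensor $$T^\psi(X,Y)=\tfrac12\,\Re\Big(X\cdot\nabla_Y\psi+Y\cdot\nabla_X\psi,\ \frac{\psi}{|\psi|^2}\Big),$$ defined where $\psi\neq0$ and identified through $g$ with a field of symmetric endomorphisms of $TM$. The spinor field $\psi$ is called $T$-Killing if $\nabla_X\psi=-T^\psi(X)\cdot\psi$ for all $X\in TM$ and $\mathrm{tr}(T^\psi)$ is constant. Let $\mathcal K\subset TM$ be a smooth distribution of constant rank that is parallel for the Levi-Civita connection of $g$, and let $\psi$ be a $T$-Killing spinor, not identically zero, such that $H:=2T^\psi$ is, wherever $T^\psi$ is defined, the orthogonal projection of $TM$ onto $\mathcal K^\perp$. Put $h=2T^\psi$, i.e. $h(X,Y)=g(HX,Y)$. Then there is $\varepsilon>0$ such that $g_t=g+(t^2-1)h$ is a Riemannian metric on $M$ for every $t\in I=\,]1-\varepsilon,1+\varepsilon[$,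 and for every such $\varepsilon$ the generalized cone $$\mathcal M=\big(M\times I,\ g+(t^2-1)h+dt^2\big)$$ is Ricci-flat. -/

import Mathlib

open Set
open scoped Manifold ContDiff Topology

noncomputable section

namespace SpinGeom

/-! ## Metrics, Levi-Civita connection and Ricci curvature in charts -/

section Riemannian

variable {E : Type*} [NormedAddCommGroup E] [NormedSpace ℝ E]
  {H : Type*} [TopologicalSpace H] (I : ModelWithCorners ℝ E H)
  {N : Type*} [TopologicalSpace N] [ChartedSpace H N]

/-- A field of bilinear forms (a covariant `2`-tensor field) on the manifold `N`. -/
abbrev TwoTensor (N : Type*) [TopologicalSpace N] [ChartedSpace H N] : Type _ :=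
  ∀ x : N, TangentSpace I x →L[ℝ] TangentSpace I x →L[ℝ] ℝ

variable {I}

/-- The expression of a `2`-tensor in the chart `φ = extChartAt I x₀`, i.e. the pullback
`(φ⁻¹)^* G`, a function from the model space `E` to bilinear forms on `E`. -/
def chartTensor (G : TwoTensor I N) (x₀ : N) (y : E) : E →L[ℝ] E →L[ℝ] ℝ :=
  let A : E →L[ℝ] TangentSpace I ((extChartAt I x₀).symm y) :=
    mfderiv 𝓘(ℝ, E) I (extChartAt I x₀).symm y
  (ContinuousLinearMap.precomp ℝ A) ∘L (G ((extChartAt I x₀).symm y)) ∘L A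

/-- The Christoffel symbols `Γ(u,v)` at the point `y` of the chart around `x₀`: the vector with
`G(Γ(u,v), w) = ½ (∂_u G(v,w) + ∂_v G(u,w) - ∂_w G(u,v))` for all `w`. -/
def christoffel (G : TwoTensor I N) (x₀ : N) (y : E) (u v : E) : E :=
  let D : E →L[ℝ] E →L[ℝ] E →L[ℝ] ℝ := fderiv ℝ (chartTensor G x₀) y
  (chartTensor G x₀ y).inverse ((1 / 2 : ℝ) • (D u v + D v u - (D.flip u).flip v))

/-- The Levi-Civita covariant derivative `u ↦ (∇_u Y)(x)` of the vector field `Y` with respect to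
the metric `G`, computed in the preferred chart at `x` (which identifies `T_x N` with `E`):
`∇_u Y = ∂_u Y + Γ(u, Y)`. -/
def leviCivita (G : TwoTensor I N) (Y : ∀ x : N, TangentSpace I x) (x : N)
    (u : TangentSpace I x) : TangentSpace I x :=
  let Y' : E → E := VectorField.mpullback 𝓘(ℝ, E) I (extChartAt I x).symm Y
  let y : E := extChartAt I x x
  let u' : E := u
  (fderiv ℝ Y' y u' + christoffel G x y u' (Y' y) : E)

theorem leviCivita_add (G : TwoTensor I N) (Y : ∀ x : N, TangentSpace I x) (x : N)
    (u v : TangentSpace I x) : leviCivita G Y x (u + v) = leviCivita G Y x u + leviCivita G Y x v := by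
  have h : ∀ (y : E) (u v w : E), christoffel G x y (u + v) w =
      christoffel G x y u w + christoffel G x y v w := fun y u v w ↦ by
    simp only [christoffel, ← map_add, ← smul_add]
    congr 2
    ext z
    simp
    ring
  unfold leviCivita
  exact (congrArg₂ (· + ·) (map_add _ _ _) (h _ _ _ _)).trans (add_add_add_comm _ _ _ _)

theorem leviCivita_smul (G : TwoTensor I N) (Y : ∀ x : N, TangentSpace I x) (x : N) (c : ℝ)
    (u : TangentSpace I x) : leviCivita G Y x (c • u) = c • leviCivita G Y x u := by
  have h : ∀ (y : E) (u w : E), christoffel G x y (c • u) w = c • christoffel G x y u w :=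
    fun y u w ↦ by
    simp only [christoffel, ← map_smul]
    congr 1
    ext z
    simp
    ring
  unfold leviCivita
  exact (congrArg₂ (· + ·) (map_smul _ _ _) (h _ _ _)).trans (smul_add _ _ _).symm

/-- The curvature `R(u,v)w = ∇_u ∇_v w - ∇_v ∇_u w` (for coordinate fields) of the Levi-Civita
connection of `G` at `x`, computed in the preferred chart at `x`, which identifies `T_x N` with
`E`. -/
def curvature (G : TwoTensor I N) (x : N) (u v w : E) : E :=
  let y : E := extChartAt I x x
  let Γ : E → E → E → E := christoffel G x
  fderiv ℝ (fun z ↦ Γ z v w) y u - fderiv ℝ (fun z ↦ Γ z u w) y v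
    + Γ y u (Γ y v w) - Γ y v (Γ y u w)

/-- The Ricci tensor `Ric(v,w) = tr (u ↦ R(u,v)w)` of `G` at `x`, on `T_x N = E`. -/
def ricci [FiniteDimensional ℝ E] (G : TwoTensor I N) (x : N) (v w : E) : ℝ :=
  ∑ i, (Module.finBasis ℝ E).coord i (curvature G x (Module.finBasis ℝ E i) v w)

/-- The metric `G` is Ricci-flat on the open set `s`. -/
def RicciFlatOn [FiniteDimensional ℝ E] (G : TwoTensor I N) (s : Set N) : Prop :=
  ∀ x ∈ s, ∀ v w : E, ricci G x v w = 0

/-- The metric `G_{(x,t)} = π_N^* (g + (t² - 1) h) + π_ℝ^* dt²` on `N × ℝ`. -/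
def coneMetric (g h : TwoTensor I N) : TwoTensor (I.prod 𝓘(ℝ, ℝ)) (N × ℝ) := fun p ↦
  let A : TangentSpace (I.prod 𝓘(ℝ, ℝ)) p →L[ℝ] TangentSpace I p.1 :=
    mfderiv (I.prod 𝓘(ℝ, ℝ)) I Prod.fst p
  let B : TangentSpace (I.prod 𝓘(ℝ, ℝ)) p →L[ℝ] ℝ :=
    mfderiv (I.prod 𝓘(ℝ, ℝ)) 𝓘(ℝ, ℝ) Prod.snd p
  (ContinuousLinearMap.precomp ℝ A) ∘L (g p.1 + (p.2 ^ 2 - 1) • h p.1) ∘L A + B.smulRight B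

/-- The open interval `I = ]1 - ε, 1 + ε[`. -/
def coneInterval (ε : ℝ) : Set ℝ := Ioo (1 - ε) (1 + ε)

/-- `g_t = g + (t² - 1) h` is positive definite on all of `N` for all `t ∈ ]1 - ε, 1 + ε[`. -/
def IsConeRadius (g h : TwoTensor I N) (ε : ℝ) : Prop :=
  0 < ε ∧ ∀ t ∈ coneInterval ε, ∀ x : N, ∀ v : TangentSpace I x, v ≠ 0 →
    0 < (g x + (t ^ 2 - 1) • h x) v v

/-- The underlying open subset `N × ]1 - ε, 1 + ε[` of `N × ℝ` of the generalized cone. -/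
def coneDomain (N : Type*) (ε : ℝ) : Set (N × ℝ) := {p | p.2 ∈ coneInterval ε}

variable [IsManifold I ∞ N]

/-- `K` is a smooth distribution of rank `k`: near every point it has a smooth frame. -/
def IsSmoothDistribution (K : ∀ x : N, Submodule ℝ (TangentSpace I x)) (k : ℕ) : Prop :=
  ∀ x₀ : N, ∃ U : Set N, IsOpen U ∧ x₀ ∈ U ∧ ∃ Y : Fin k → ∀ x : N, TangentSpace I x,
    (∀ i, ContMDiffOn I I.tangent ∞ (fun x ↦ (Y i x : TangentBundle I N)) U) ∧
    ∀ x ∈ U, LinearIndependent ℝ (fun i ↦ Y i x) ∧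
      Submodule.span ℝ (range fun i ↦ Y i x) = K x

/-- `K` is parallel for the Levi-Civita connection of `G`: covariant derivatives of local smooth
sections of `K` are again in `K`. -/
def IsParallelDistribution (G : TwoTensor I N) (K : ∀ x : N, Submodule ℝ (TangentSpace I x)) :
    Prop :=
  ∀ (U : Set N) (Y : ∀ x : N, TangentSpace I x), IsOpen U →
    ContMDiffOn I I.tangent ∞ (fun x ↦ (Y x : TangentBundle I N)) U →
    (∀ x ∈ U, Y x ∈ K x) → ∀ x ∈ U, ∀ u : TangentSpace I x, leviCivita G Y x u ∈ K x

/-- The `G`-orthogonal complement of `W` in `T_x N`. -/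
def orthCompl (G : TwoTensor I N) (x : N) (W : Submodule ℝ (TangentSpace I x)) :
    Submodule ℝ (TangentSpace I x) where
  carrier := {v | ∀ w ∈ W, G x v w = 0}
  add_mem' := fun ha hb w hw ↦ by simp [ha w hw, hb w hw]
  zero_mem' := fun w _ ↦ by simp
  smul_mem' := fun c v hv w hw ↦ by simp [hv w hw]

/-- `P` is the `G`-orthogonal projection of `T_x N` onto `W`. -/
def IsOrthProjOnto (G : TwoTensor I N) (x : N) (W : Submodule ℝ (TangentSpace I x))
    (P : TangentSpace I x →L[ℝ] TangentSpace I x) : Prop :=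
  ∀ v, P v ∈ W ∧ ∀ w ∈ W, G x (v - P v) w = 0

/-- The endomorphism `B` of `T_x N` with `G(B u, v) = b(u, v)`, where `b` is a bilinear form. -/
def toEndo (G : TwoTensor I N) (x : N)
    (b : TangentSpace I x →L[ℝ] TangentSpace I x →L[ℝ] ℝ) :
    TangentSpace I x →L[ℝ] TangentSpace I x :=
  (G x).inverse ∘L b

end Riemannian

/-! ## The Clifford algebra and spinor representations -/

/-- Euclidean space `ℝⁿ`. -/
abbrev Eu (n : ℕ) : Type := EuclideanSpace ℝ (Fin n)

/-- The quadratic form `v ↦ -|v|²` on `ℝⁿ`. -/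
def negSq (n : ℕ) : QuadraticForm ℝ (Eu n) := -LinearMap.BilinMap.toQuadraticMap (innerₗ (Eu n))

/-- The real Clifford algebra `Cl_n`, with `v · v = -|v|²`. Its group `spinGroup (negSq n)` is
the compact group `Spin(n)`, acting on `ℝⁿ` by `v ↦ s v s⁻¹ = s v (star s)`. -/
abbrev Cl (n : ℕ) : Type := CliffordAlgebra (negSq n)

variable {n : ℕ} {S : Type*} [NormedAddCommGroup S] [InnerProductSpace ℂ S]

/-- `ρ` is a complex spinor representation on the Hermitian space `S`: an irreducible complex
representation of `Cl_n` for which vectors of `ℝⁿ` act by skew-Hermitian endomorphisms. -/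
structure IsSpinorRep (ρ : Cl n →ₐ[ℝ] Module.End ℂ S) : Prop where
  nontrivial : Nontrivial S
  irreducible : ∀ W : Submodule ℂ S, (∀ a : Cl n, ∀ s ∈ W, ρ a s ∈ W) → W = ⊥ ∨ W = ⊤
  skew : ∀ (v : Eu n) (s t : S),
    inner ℂ (ρ (CliffordAlgebra.ι (negSq n) v) s) t =
      -inner ℂ s (ρ (CliffordAlgebra.ι (negSq n) v) t)

/-- Clifford multiplication `v · s` on the spinor module, real bilinear. -/
def cliffMul (ρ : Cl n →ₐ[ℝ] Module.End ℂ S) (v : Eu n) (s : S) : S :=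
  ρ (CliffordAlgebra.ι (negSq n) v) s

/-! ## Spin structures, spinor fields and the spinorial Levi-Civita connection -/

variable {M : Type*} [TopologicalSpace M] [ChartedSpace (Eu n) M] [IsManifold (𝓡 n) ∞ M]

variable (n M) in
/-- Smooth Riemannian metrics on the `n`-manifold `M`. -/
abbrev RiemMetric : Type _ :=
  Bundle.ContMDiffRiemannianMetric (𝓡 n) ∞ (Eu n) (fun x : M ↦ TangentSpace (𝓡 n) x)

/-- The components `(g(X, e_i))_i ∈ ℝⁿ` of a tangent vector `X` in the orthonormal basis `e`. -/
def frameCoords (g : RiemMetric n M) {x : M} (e : Fin n → TangentSpace (𝓡 n) x)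
    (X : TangentSpace (𝓡 n) x) : Eu n :=
  WithLp.toLp 2 fun i ↦ g.inner x X (e i)

/-- A spin structure on the Riemannian manifold `(M, g)`, given by a cocycle: an open cover `U_a`
with smooth orthonormal frames over its members, and a `Spin(n)`-valued smooth cocycle `τ_ab`
lifting the transition functions of these frames along `Spin(n) → SO(n)`. (As the transition
functions take values in `SO(n)`, the frames also orient `M`.) Like the transition functions of a
vector bundle, `τ_ab` is meaningful on `U_a ∩ U_b` only. -/
structure SpinStructure (ι : Type*) (g : RiemMetric n M) where
  U : ι → Set M
  isOpen_U : ∀ a, IsOpen (U a)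
  /-- For every point a member of the cover that contains it. -/
  indexAt : M → ι
  mem_U : ∀ x, x ∈ U (indexAt x)
  frame : ι → Fin n → ∀ x : M, TangentSpace (𝓡 n) x
  smooth_frame : ∀ a i, ContMDiffOn (𝓡 n) (𝓡 n).tangent ∞
    (fun x ↦ (frame a i x : TangentBundle (𝓡 n) M)) (U a)
  orthonormal_frame : ∀ a, ∀ x ∈ U a, ∀ i j,
    g.inner x (frame a i x) (frame a j x) = if i = j then 1 else 0
  τ : ι → ι → M → Cl n
  τ_mem : ∀ a b, ∀ x ∈ U a ∩ U b, τ a b x ∈ spinGroup (negSq n)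
  /-- `τ_ab` is smooth as a map to the finite dimensional real vector space `Cl_n`. -/
  smooth_τ : ∀ a b, ∀ l : Cl n →ₗ[ℝ] ℝ,
    ContMDiffOn (𝓡 n) 𝓘(ℝ, ℝ) ∞ (fun x ↦ l (τ a b x)) (U a ∩ U b)
  cocycle : ∀ a b c, ∀ x ∈ U a ∩ U b ∩ U c, τ a b x * τ b c x = τ a c x
  /-- `τ_ab` lifts the transition function from the frame `b` to the frame `a`. -/
  lift : ∀ a b, ∀ x ∈ U a ∩ U b, ∀ X : TangentSpace (𝓡 n) x,
    CliffordAlgebra.ι (negSq n) (frameCoords g (fun i ↦ frame a i x) X) =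
      τ a b x * CliffordAlgebra.ι (negSq n) (frameCoords g (fun i ↦ frame b i x) X) *
        star (τ a b x)

variable {ι : Type*} {g : RiemMetric n M}

/-- A smooth section of the spinor bundle `ΣM` associated with the spin structure and the spinor
representation `ρ`: a family of smooth functions `ψ_a : U_a → S` with `ψ_a = ρ(τ_ab) ψ_b`. -/
structure SpinorField (σ : SpinStructure ι g) (ρ : Cl n →ₐ[ℝ] Module.End ℂ S) where
  toFun : ι → M → S
  smooth : ∀ a, ContMDiffOn (𝓡 n) 𝓘(ℝ, S) ∞ (toFun a) (σ.U a)
  compat : ∀ a b, ∀ x ∈ σ.U a ∩ σ.U b, toFun a x = ρ (σ.τ a b x) (toFun b x)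

namespace SpinorField

variable {σ : SpinStructure ι g} {ρ : Cl n →ₐ[ℝ] Module.End ℂ S} (ψ : SpinorField σ ρ)

/-- Clifford multiplication `X · s` of a spinor at `x`, represented by `s ∈ S` in the frame `a`,
by a tangent vector `X`. -/
def clifford (σ : SpinStructure ι g) (ρ : Cl n →ₐ[ℝ] Module.End ℂ S) (a : ι) (x : M)
    (X : TangentSpace (𝓡 n) x) (s : S) : S :=
  cliffMul ρ (frameCoords g (fun i ↦ σ.frame a i x) X) s

/-- The spinorial Levi-Civita connection in the frame `a`:
`(∇_X ψ)_a = dψ_a(X) + ¼ ∑_{i,j} g(∇_X e_i, e_j) e_i · e_j · ψ_a`. -/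
def nabla (a : ι) (x : M) (X : TangentSpace (𝓡 n) x) : S :=
  let d : S := mfderiv (𝓡 n) 𝓘(ℝ, S) (ψ.toFun a) x X
  d +
    (1 / 4 : ℝ) • ∑ i, ∑ j,
      g.inner x (leviCivita g.inner (σ.frame a i) x X) (σ.frame a j x) •
        clifford σ ρ a x (σ.frame a i x) (clifford σ ρ a x (σ.frame a j x) (ψ.toFun a x))

/-- The spinor field vanishes at `x`. -/
def VanishesAt (x : M) : Prop := ψ.toFun (σ.indexAt x) x = 0

theorem frameCoords_add {x : M} (e : Fin n → TangentSpace (𝓡 n) x) (X Y : TangentSpace (𝓡 n) x) :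
    frameCoords g e (X + Y) = frameCoords g e X + frameCoords g e Y := by
  ext i
  simp [frameCoords]

theorem frameCoords_smul {x : M} (e : Fin n → TangentSpace (𝓡 n) x) (c : ℝ)
    (X : TangentSpace (𝓡 n) x) : frameCoords g e (c • X) = c • frameCoords g e X := by
  ext i
  simp [frameCoords]

theorem clifford_add_left (a : ι) (x : M) (X Y : TangentSpace (𝓡 n) x) (s : S) :
    clifford σ ρ a x (X + Y) s = clifford σ ρ a x X s + clifford σ ρ a x Y s := by
  simp [clifford, cliffMul, frameCoords_add]

theorem clifford_smul_left (a : ι) (x : M) (c : ℝ) (X : TangentSpace (𝓡 n) x) (s : S) :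
    clifford σ ρ a x (c • X) s = c • clifford σ ρ a x X s := by
  simp [clifford, cliffMul, frameCoords_smul]

theorem clifford_add_right (a : ι) (x : M) (X : TangentSpace (𝓡 n) x) (s t : S) :
    clifford σ ρ a x X (s + t) = clifford σ ρ a x X s + clifford σ ρ a x X t := by
  simp [clifford, cliffMul]

theorem clifford_smul_right (a : ι) (x : M) (X : TangentSpace (𝓡 n) x) (c : ℝ) (s : S) :
    clifford σ ρ a x X (c • s) = c • clifford σ ρ a x X s := by
  simp [clifford, cliffMul, ← Complex.coe_smul]

theorem nabla_add (a : ι) (x : M) (X Y : TangentSpace (𝓡 n) x) :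
    ψ.nabla a x (X + Y) = ψ.nabla a x X + ψ.nabla a x Y := by
  simp only [nabla, leviCivita_add, map_add, add_apply, add_smul,
    Finset.sum_add_distrib, smul_add]
  exact add_add_add_comm _ _ _ _

theorem nabla_smul (a : ι) (x : M) (c : ℝ) (X : TangentSpace (𝓡 n) x) :
    ψ.nabla a x (c • X) = c • ψ.nabla a x X := by
  simp only [nabla, leviCivita_smul, map_smul, smul_apply, smul_eq_mul, mul_smul,
    ← Finset.smul_sum]
  rw [smul_comm (1 / 4 : ℝ) c]
  exact (smul_add _ _ _).symm

/-- The energy-momentum tensor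
`T^ψ(X,Y) = ½ Re (X · ∇_Y ψ + Y · ∇_X ψ, ψ / |ψ|²)`, meaningful at points where `ψ` does not
vanish. It is computed in a frame around `x`; the result does not depend on the frame. -/
def emForm (x : M) (X Y : TangentSpace (𝓡 n) x) : ℝ :=
  let a := σ.indexAt x
  (1 / 2) * (inner ℂ (ψ.toFun a x)
    (clifford σ ρ a x X (ψ.nabla a x Y) + clifford σ ρ a x Y (ψ.nabla a x X))).re
      / ‖ψ.toFun a x‖ ^ 2

theorem emForm_comm (x : M) (X Y : TangentSpace (𝓡 n) x) : ψ.emForm x X Y = ψ.emForm x Y X := by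
  simp only [emForm]
  rw [add_comm]

theorem emForm_add (x : M) (X Y Z : TangentSpace (𝓡 n) x) :
    ψ.emForm x (X + Y) Z = ψ.emForm x X Z + ψ.emForm x Y Z := by
  simp only [emForm, nabla_add, clifford_add_left, clifford_add_right, inner_add_right,
    Complex.add_re]
  ring

theorem emForm_smul (x : M) (c : ℝ) (X Y : TangentSpace (𝓡 n) x) :
    ψ.emForm x (c • X) Y = c * ψ.emForm x X Y := by
  simp only [emForm, nabla_smul, clifford_smul_left, clifford_smul_right, inner_add_right,
    inner_smul_right_eq_smul, Complex.add_re, Complex.smul_re, smul_eq_mul]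
  ring

instance (x : M) : FiniteDimensional ℝ (TangentSpace (𝓡 n) x) :=
  inferInstanceAs (FiniteDimensional ℝ (Eu n))

instance (x : M) : T2Space (TangentSpace (𝓡 n) x) :=
  inferInstanceAs (T2Space (Eu n))

/-- The energy-momentum tensor `T^ψ` as a `2`-tensor field. -/
def emTensor : TwoTensor (𝓡 n) M := fun x ↦
  LinearMap.toContinuousLinearMap
    { toFun := fun X ↦ LinearMap.toContinuousLinearMap
        { toFun := fun Y ↦ ψ.emForm x X Y
          map_add' := fun Y Z ↦ by
            rw [emForm_comm, emForm_add, emForm_comm ψ x Y, emForm_comm ψ x Z]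
          map_smul' := fun c Y ↦ by
            rw [emForm_comm, emForm_smul, emForm_comm ψ x Y]; rfl }
      map_add' := fun X Y ↦ by
        ext Z
        exact ψ.emForm_add x X Y Z
      map_smul' := fun c X ↦ by
        ext Z
        exact ψ.emForm_smul x c X Z }

/-- The energy-momentum tensor as a field of endomorphisms, `g(T^ψ(X), Y) = T^ψ(X, Y)`. -/
def emEndo (x : M) : TangentSpace (𝓡 n) x →L[ℝ] TangentSpace (𝓡 n) x :=
  toEndo g.inner x (ψ.emTensor x)

/-- `ψ` is a `T`-Killing spinor: `∇_X ψ = -T^ψ(X) · ψ` for all tangent vectors `X` and `tr T^ψ` is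
constant. Both are conditions on the set where `ψ ≠ 0`, on which `T^ψ` is defined. -/
def IsTKilling : Prop :=
  (∀ a, ∀ x ∈ σ.U a, ¬ ψ.VanishesAt x → ∀ X : TangentSpace (𝓡 n) x,
    ψ.nabla a x X = -clifford σ ρ a x (ψ.emEndo x X) (ψ.toFun a x)) ∧
  ∃ c : ℝ, ∀ x, ¬ ψ.VanishesAt x → LinearMap.trace ℝ _ (ψ.emEndo x).toLinearMap = c

end SpinorField

end SpinGeom

end

noncomputable section

set_option maxSynthPendingDepth 3

namespace SpinGeom

/-! Put H = 2T^ψ and h = g(H·,·). The kernel of H is 𝒦, which is parallel, so ∇H = 0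
(`fderiv_of_parallel_ker`). The Killing equation reads ∇_X ψ = -½ HX·ψ. Clifford multiplication by
vectors is skew, so |ψ| is locally constant, and since M is connected ψ vanishes nowhere
(`not_vanishesAt`).

Differentiating the equation once more with ∇H = 0 gives, in an orthonormal frame, (∑ g(R(u,v)e_i,
e_j) e_i·e_j + [Hu, Hv])·ψ = 0 (`curvature_integrability`). Now set u = e_a, multiply by e_a and sum
over a. By the first Bianchi identity the curvature term becomes 2 Ric(v), and because H is a
projection the commutator becomes -2(tr H - 1)Hv. A nonzero vector acts injectively on spinors,
hence Ric = (tr H - 1)h (`ricci_of_generalizedKilling`).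

On the cone, g_t is g on 𝒦 and t²g on 𝒦^⊥. As ∇H = 0, its Christoffel symbols are those of g plus
the terms of an ordinary metric cone along the image of H, and its curvature is R(u,v)w - h(v,w)Hu +
h(u,w)Hv, which is zero as soon as one entry is ∂_t (`curvature_coneChristoffel`). Its trace is Ric
- (tr H - 1)h = 0.

All computations take place on open subsets of a normed space. The connections of the statement are
defined at each point in the preferred chart of that point; `leviCivita_chart` and `nabla_chart`
move them into one fixed chart, where they can be differentiated. -/

/-! ## Clifford relations -/

section CliffordRelations

variable {A : Type*} [Ring A] [Algebra ℝ A] {κ : Type*} [Fintype κ] [DecidableEq κ]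

/-- The elements `γ i` satisfy the Clifford relations of an orthonormal basis. -/
def IsCliffordFamily (γ : κ → A) : Prop :=
  ∀ i j, γ i * γ j + γ j * γ i = if i = j then (-2 : ℝ) • (1 : A) else 0

/-- The element `∑ α_ij γ_i γ_j`. -/
def quadElem (γ : κ → A) (α : κ → κ → ℝ) : A := ∑ i, ∑ j, α i j • (γ i * γ j)

/-- The element `∑ v_i γ_i`. -/
def linElem (γ : κ → A) (v : κ → ℝ) : A := ∑ i, v i • γ i

variable {γ : κ → A}

omit [DecidableEq κ] in
theorem quadElem_add (α β : κ → κ → ℝ) :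
    quadElem γ (fun i j ↦ α i j + β i j) = quadElem γ α + quadElem γ β := by
  simp only [quadElem, add_smul, Finset.sum_add_distrib]

omit [DecidableEq κ] in
theorem quadElem_sub (α β : κ → κ → ℝ) :
    quadElem γ (fun i j ↦ α i j - β i j) = quadElem γ α - quadElem γ β := by
  simp only [quadElem, sub_smul, Finset.sum_sub_distrib]

omit [DecidableEq κ] in
theorem linElem_add (v w : κ → ℝ) : linElem γ (fun i ↦ v i + w i) = linElem γ v + linElem γ w := by
  simp only [linElem, add_smul, Finset.sum_add_distrib]

omit [DecidableEq κ] in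
theorem linElem_sub (v w : κ → ℝ) : linElem γ (fun i ↦ v i - w i) = linElem γ v - linElem γ w := by
  simp only [linElem, sub_smul, Finset.sum_sub_distrib]

omit [DecidableEq κ] in
theorem linElem_smul (c : ℝ) (v : κ → ℝ) : linElem γ (fun i ↦ c * v i) = c • linElem γ v := by
  simp only [linElem, mul_smul, Finset.smul_sum]

namespace IsCliffordFamily

variable (hγ : IsCliffordFamily γ)
include hγ

-- Moving `γ k` to the front past `γ j` and `γ i` costs one contraction for each. The commutators
-- with quadratic elements and the Bianchi contraction below rest on this.
omit [Fintype κ] in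
theorem mul_mul_rotate (i j k : κ) :
    γ i * γ j * γ k = γ k * γ i * γ j + (if i = k then (-2 : ℝ) else 0) • -γ j
      + (if j = k then (-2 : ℝ) else 0) • γ i := by
  have h1 := congrArg (γ i * ·) (hγ j k)
  have h2 := congrArg (· * γ j) (hγ i k)
  simp only [mul_add, add_mul,
    ← mul_assoc] at h1 h2
  split_ifs at h1 h2 ⊢ <;> simp_all <;> grind

/-- The commutator with `¼ quadElem γ α` sends `γ k` to ∑ α_kj γ_j: this is the identification of
𝔰𝔭𝔦𝔫(n) with 𝔰𝔬(n), and the reason for the factor ¼ in the spinorial connection. -/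
theorem quadElem_commutator_gen {α : κ → κ → ℝ} (hα : ∀ i j, α i j = -α j i) (k : κ) :
    quadElem γ α * γ k - γ k * quadElem γ α = (4 : ℝ) • linElem γ (α k) := by
  have h : ∀ i j, α i j • (γ i * γ j) * γ k - γ k * (α i j • (γ i * γ j)) =
      (if i = k then (2 : ℝ) * α i j else 0) • γ j + (if j = k then (-2 : ℝ) * α i j else 0) • γ i := by
    intro i j
    rw [smul_mul_assoc, hγ.mul_mul_rotate, mul_smul_comm, ← mul_assoc]
    split_ifs <;> module
  simp only [quadElem, Finset.sum_mul, Finset.mul_sum, ← Finset.sum_sub_distrib, h]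
  simp only [Finset.sum_add_distrib, ite_smul, zero_smul]
  rw [Finset.sum_comm]
  simp only [Finset.sum_ite_eq', Finset.mem_univ, if_true, linElem, Finset.smul_sum, ← Finset.sum_add_distrib]
  refine Finset.sum_congr rfl fun i _ ↦ ?_
  rw [hα i k]
  module

theorem quadElem_commutator_lin {α : κ → κ → ℝ} (hα : ∀ i j, α i j = -α j i) (v : κ → ℝ) :
    quadElem γ α * linElem γ v - linElem γ v * quadElem γ α =
      -((4 : ℝ) • linElem γ fun i ↦ ∑ j, α i j * v j) := by
  have h1 : quadElem γ α * linElem γ v - linElem γ v * quadElem γ α =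
      ∑ k, v k • (4 : ℝ) • linElem γ (α k) := by
    simp only [← hγ.quadElem_commutator_gen hα]
    simp only [linElem, Finset.sum_mul, Finset.mul_sum, mul_smul_comm, smul_mul_assoc, smul_sub,
      Finset.sum_sub_distrib]
  rw [h1]
  simp only [linElem, Finset.smul_sum, Finset.sum_smul, ← Finset.sum_neg_distrib]
  rw [Finset.sum_comm]
  refine Finset.sum_congr rfl fun i _ ↦ Finset.sum_congr rfl fun j _ ↦ ?_
  rw [hα j i]
  module

/-- The commutator with `quadElem γ α` is a derivation, so its values on generators determine it on
products `γ i * γ j`. For connection forms the right-hand side is the quadratic term of Cartan's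
structure equation. -/
theorem quadElem_commutator_quad {α β : κ → κ → ℝ} (hα : ∀ i j, α i j = -α j i) :
    quadElem γ α * quadElem γ β - quadElem γ β * quadElem γ α =
      (4 : ℝ) • quadElem γ fun i j ↦ ∑ k, (β i k * α k j - α i k * β k j) := by
  have h1 : ∀ i j, quadElem γ α * (γ i * γ j) - γ i * γ j * quadElem γ α =
      (4 : ℝ) • (linElem γ (α i) * γ j + γ i * linElem γ (α j)) := by
    intro i j
    rw [smul_add, ← smul_mul_assoc, ← mul_smul_comm, ← hγ.quadElem_commutator_gen hα,
      ← hγ.quadElem_commutator_gen hα]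
    noncomm_ring
  have h2 : quadElem γ α * quadElem γ β - quadElem γ β * quadElem γ α =
      ∑ i, ∑ j, β i j • (4 : ℝ) • (linElem γ (α i) * γ j + γ i * linElem γ (α j)) := by
    simp only [← h1]
    conv_lhs => rw [quadElem.eq_def γ β]
    simp only [Finset.sum_mul, Finset.mul_sum, mul_smul_comm, smul_mul_assoc, smul_sub,
      Finset.sum_sub_distrib]
  have h3 : ∑ i, ∑ j, β i j • (linElem γ (α i) * γ j) =
      ∑ i, ∑ j, ∑ k, (β k j * α k i) • (γ i * γ j) := by
    simp only [linElem, Finset.sum_mul, Finset.smul_sum, smul_mul_assoc, smul_smul]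
    rw [Finset.sum_comm, Finset.sum_comm_cycle]
  have h4 : ∑ i, ∑ j, β i j • (γ i * linElem γ (α j)) =
      ∑ i, ∑ j, ∑ k, (β i k * α k j) • (γ i * γ j) := by
    simp only [linElem, Finset.mul_sum, Finset.smul_sum, mul_smul_comm, smul_smul]
    refine Finset.sum_congr rfl fun i _ ↦ ?_
    rw [Finset.sum_comm]
  have h5 : quadElem γ α * quadElem γ β - quadElem γ β * quadElem γ α = (4 : ℝ) •
      (∑ i, ∑ j, β i j • (linElem γ (α i) * γ j) + ∑ i, ∑ j, β i j • (γ i * linElem γ (α j))) := by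
    rw [h2]
    simp only [← Finset.sum_add_distrib, Finset.smul_sum]
    refine Finset.sum_congr rfl fun i _ ↦ Finset.sum_congr rfl fun j _ ↦ ?_
    module
  rw [h5, h3, h4]
  simp only [quadElem, ← Finset.sum_add_distrib, Finset.sum_smul]
  congr 1
  refine Finset.sum_congr rfl fun i _ ↦ Finset.sum_congr rfl fun j _ ↦ Finset.sum_congr rfl
    fun k _ ↦ ?_
  rw [hα i k]
  module

theorem lin_mul_lin (v w : κ → ℝ) :
    linElem γ v * linElem γ w + linElem γ w * linElem γ v = (-2 * ∑ i, v i * w i) • (1 : A) := by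
  have h : linElem γ v * linElem γ w + linElem γ w * linElem γ v =
      ∑ i, ∑ j, (v i * w j) • (γ i * γ j + γ j * γ i) := by
    have h1 : linElem γ v * linElem γ w = ∑ i, ∑ j, (v i * w j) • (γ i * γ j) := by
      simp only [linElem, Finset.sum_mul, Finset.mul_sum, smul_mul_smul_comm]
      exact Finset.sum_comm
    have h2 : linElem γ w * linElem γ v = ∑ i, ∑ j, (v i * w j) • (γ j * γ i) := by
      simp only [linElem, Finset.sum_mul, Finset.mul_sum, smul_mul_smul_comm, mul_comm (w _)]
    rw [h1, h2]
    simp only [← Finset.sum_add_distrib, smul_add]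
  rw [h]
  simp only [hγ _ _, smul_ite, smul_zero, smul_smul, Finset.sum_ite_eq,
    Finset.mem_univ, if_true, ← Finset.sum_smul, Finset.mul_sum]
  simp only [mul_comm]

theorem sum_gen_mul_lin {H : κ → κ → ℝ} (hH : ∀ i j, H i j = H j i) :
    ∑ a, γ a * linElem γ (H a) = (-∑ i, H i i) • (1 : A) := by
  have h1 : ∑ a, γ a * linElem γ (H a) = ∑ i, ∑ j, H i j • (γ i * γ j) := by
    simp only [linElem, Finset.mul_sum, mul_smul_comm]
  have h2 : ∑ a, γ a * linElem γ (H a) = ∑ i, ∑ j, H i j • (γ j * γ i) := by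
    rw [h1, Finset.sum_comm]
    refine Finset.sum_congr rfl fun i _ ↦ Finset.sum_congr rfl fun j _ ↦ ?_
    rw [hH]
  have h3 : (2 : ℝ) • ∑ a, γ a * linElem γ (H a) = (2 : ℝ) • (-∑ i, H i i) • (1 : A) := by
    rw [two_smul]
    conv_lhs => rw [h2]
    nth_rw 1 [← h2]
    rw [h1]
    simp only [← Finset.sum_add_distrib, ← smul_add, hγ _ _, smul_smul, smul_ite, smul_zero,
      Finset.sum_ite_eq, Finset.mem_univ, if_true, ← Finset.sum_smul, Finset.mul_sum,
      mul_neg, ← Finset.sum_neg_distrib, mul_comm, neg_mul]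
  exact smul_right_injective A (two_ne_zero (α := ℝ)) h3

/-- Clifford contraction of the commutators `[H e_a, w]` over an orthonormal basis. -/
theorem sum_gen_mul_commutator {H : κ → κ → ℝ} (hH : ∀ i j, H i j = H j i) (w : κ → ℝ)
    (hw : ∀ i, ∑ a, H a i * w a = w i) :
    ∑ a, γ a * (linElem γ (H a) * linElem γ w - linElem γ w * linElem γ (H a)) =
      (-2 * (∑ i, H i i - 1)) • linElem γ w := by
  have h1 : ∑ a, γ a * (linElem γ (H a) * linElem γ w) = (-∑ i, H i i) • linElem γ w := by
    simp only [← mul_assoc]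
    rw [← Finset.sum_mul, hγ.sum_gen_mul_lin hH, smul_mul_assoc, one_mul]
  have hg : ∀ a, γ a = linElem γ (Pi.single a 1) := fun a ↦ by
    simp [linElem, Pi.single_apply]
  -- Anticommuting `γ a` past `w` leaves the contraction -2 w_a. Summed against H e_a it produces H
  -- w = w, which is the origin of the -1 in tr H - 1.
  have h2 : ∀ a, γ a * (linElem γ w * linElem γ (H a)) =
      -(linElem γ w * (γ a * linElem γ (H a))) + (-2 * w a) • linElem γ (H a) := by
    intro a
    have := hγ.lin_mul_lin (Pi.single a 1) w
    rw [← hg] at this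
    simp only [Pi.single_apply, ite_mul, one_mul, zero_mul, Finset.sum_ite_eq', Finset.mem_univ,
      if_true] at this
    rw [← mul_assoc, eq_sub_of_add_eq this, sub_mul, smul_mul_assoc, one_mul, mul_assoc]
    abel
  have h3 : ∑ a, (-2 * w a) • linElem γ (H a) = (-2 : ℝ) • linElem γ w := by
    simp only [linElem, Finset.smul_sum, smul_smul]
    rw [Finset.sum_comm]
    refine Finset.sum_congr rfl fun i _ ↦ ?_
    rw [← Finset.sum_smul, ← hw i, Finset.mul_sum]
    congr 1
    exact Finset.sum_congr rfl fun a _ ↦ by ring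
  simp only [mul_sub, Finset.sum_sub_distrib]
  rw [h1]
  simp only [h2, Finset.sum_add_distrib, Finset.sum_neg_distrib, ← Finset.mul_sum]
  rw [hγ.sum_gen_mul_lin hH, h3, mul_smul_comm, mul_one]
  module

/-- Clifford contraction of a tensor which satisfies the first Bianchi identity. -/
theorem sum_gen_mul_quad {R : κ → κ → κ → ℝ} (hskew : ∀ i j a, R i j a = -R j i a)
    (hcyc : ∀ i j a, R i j a + R j a i + R a i j = 0) :
    ∑ a, γ a * quadElem γ (fun i j ↦ R i j a) = (2 : ℝ) • linElem γ fun i ↦ ∑ a, R i a a := by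
  have h0 : ∑ a, γ a * quadElem γ (fun i j ↦ R i j a) =
      ∑ a, ∑ i, ∑ j, R i j a • (γ a * γ i * γ j) := by
    simp only [quadElem, Finset.mul_sum, mul_smul_comm, mul_assoc]
  have e1 : ∑ a, ∑ i, ∑ j, R i j a • (γ a * γ i * γ j) =
      ∑ a, ∑ i, ∑ j, R j a i • (γ i * γ j * γ a) := by
    rw [Finset.sum_comm_cycle]
  have e2 : ∑ a, ∑ i, ∑ j, R i j a • (γ a * γ i * γ j) =
      ∑ a, ∑ i, ∑ j, R a i j • (γ j * γ a * γ i) := by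
    rw [Finset.sum_comm_cycle]
    exact Finset.sum_comm_cycle
  have hR : ∀ i a, R i i a = 0 := fun i a ↦ by linarith [hskew i i a]
  -- Three copies of the sum, two of them relabelled cyclically. Once the products are rotated into
  -- the same order, the coefficients add up to zero by the Bianchi identity and only contractions
  -- remain.
  have h3 : (3 : ℝ) • ∑ a, ∑ i, ∑ j, R i j a • (γ a * γ i * γ j) =
      ∑ a, ∑ i, ∑ j, ((if j = a then (-2 * R j a i) • γ i else 0) +
        (if i = a then (2 * R j a i) • γ j else 0) + ((if i = j then (2 * R a i j) • γ a else 0) +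
        (if a = j then (-2 * R a i j) • γ i else 0))) := by
    have : (3 : ℝ) • ∑ a, ∑ i, ∑ j, R i j a • (γ a * γ i * γ j) =
      ∑ a, ∑ i, ∑ j, R i j a • (γ a * γ i * γ j) + ∑ a, ∑ i, ∑ j, R i j a • (γ a * γ i * γ j) +
      ∑ a, ∑ i, ∑ j, R i j a • (γ a * γ i * γ j) := by module
    rw [this]
    nth_rw 2 [e1]
    nth_rw 2 [e2]
    simp only [← Finset.sum_add_distrib]
    refine Finset.sum_congr rfl fun a _ ↦ Finset.sum_congr rfl fun i _ ↦ Finset.sum_congr rfl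
      fun j _ ↦ ?_
    have k1 := hγ.mul_mul_rotate i j a
    have k2 := hγ.mul_mul_rotate a i j
    have k3 : γ j * γ a * γ i = γ a * γ i * γ j - (if a = j then (-2 : ℝ) else 0) • -γ i
      - (if i = j then (-2 : ℝ) else 0) • γ a := by rw [k2]; abel
    rw [k1, k3]
    have k4 : R i j a = -R j a i - R a i j := by linarith [hcyc i j a]
    rw [k4]
    split_ifs <;> module
  have h4 : (3 : ℝ) • ∑ a, ∑ i, ∑ j, R i j a • (γ a * γ i * γ j) =
      (6 : ℝ) • linElem γ fun i ↦ ∑ a, R i a a := by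
    rw [h3]
    have hb : ∑ a, ∑ i, (-2 * R a i a) • γ i = ∑ i, ∑ a, (2 * R i a a) • γ i := by
      rw [Finset.sum_comm]
      refine Finset.sum_congr rfl fun i _ ↦ Finset.sum_congr rfl fun a _ ↦ ?_
      rw [hskew a i a]
      module
    simp only [Finset.sum_add_distrib, Finset.sum_ite_eq, Finset.sum_ite_eq', Finset.mem_univ,
      if_true, hR, mul_zero, zero_smul, Finset.sum_const_zero, zero_add, Finset.sum_ite_irrel]
    rw [hb, Finset.sum_comm (f := fun a j ↦ (2 * R j a a) • γ j)]
    simp only [linElem, Finset.sum_smul, Finset.smul_sum, ← Finset.sum_add_distrib]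
    refine Finset.sum_congr rfl fun i _ ↦ Finset.sum_congr rfl fun a _ ↦ ?_
    module
  rw [h0]
  have h5 := congrArg ((3⁻¹ : ℝ) • ·) h4
  simp only [smul_smul] at h5
  norm_num at h5
  exact h5

end IsCliffordFamily

end CliffordRelations

/-- A curvature-like array has the pair symmetry. -/
theorem curvatureLike_pair_symm {κ : Type*} {R : κ → κ → κ → κ → ℝ}
    (h12 : ∀ a b c d, R a b c d = -R b a c d) (h34 : ∀ a b c d, R a b c d = -R a b d c)
    (hcyc : ∀ a b c d, R a b c d + R b c a d + R c a b d = 0) (a b c d : κ) :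
    R a b c d = R c d a b := by
  -- The classical octahedron argument: the cyclic identities for the four choices of the last
  -- index, combined through the two skew symmetries.
  linarith [hcyc a b c d, hcyc b c d a, hcyc c d a b, hcyc d a b c, h12 a b c d, h12 b c a d,
    h12 c a b d, h12 c d a b, h12 d a b c, h12 b d c a, h34 a b c d, h34 b c a d, h34 c a b d,
    h34 c d a b, h34 d a b c, h34 b d c a, h12 b c d a, h12 c d b a, h12 d b c a, h34 c d b a,
    h34 d b c a, h34 a c d b, h12 a c d b, h12 d a c b, h34 d a c b, h12 a b d c, h12 b d a c,
    h12 c a d b]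

/-! ## Riemannian calculus on an open subset of a normed space -/

section LocalCalculus

variable {E : Type*} [NormedAddCommGroup E] [NormedSpace ℝ E]

/-- `Γ` are the Christoffel symbols of the Levi-Civita connection of the Riemannian metric `g` on
the open set `V`. -/
structure IsLeviCivitaOn (g : E → E →L[ℝ] E →L[ℝ] ℝ) (Γ : E → E →L[ℝ] E →L[ℝ] E) (V : Set E) :
    Prop where
  isOpen : IsOpen V
  metric_symm : ∀ z ∈ V, ∀ u v, g z u v = g z v u
  metric_pos : ∀ z ∈ V, ∀ u, u ≠ 0 → 0 < g z u u
  differentiableAt_metric : ∀ z ∈ V, DifferentiableAt ℝ g z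
  differentiableAt : ∀ z ∈ V, DifferentiableAt ℝ Γ z
  symm : ∀ z ∈ V, ∀ u v, Γ z u v = Γ z v u
  compat : ∀ z ∈ V, ∀ u v w, fderiv ℝ g z u v w = g z (Γ z u v) w + g z v (Γ z u w)

/-- The covariant derivative `∇_u Y` at `z`. -/
def covDeriv (Γ : E → E →L[ℝ] E →L[ℝ] E) (Y : E → E) (z u : E) : E :=
  fderiv ℝ Y z u + Γ z u (Y z)

/-- The curvature `R(u,v)w` of the connection with Christoffel symbols `Γ` at `y`. -/
def curvatureOf (Γ : E → E →L[ℝ] E →L[ℝ] E) (y u v w : E) : E :=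
  fderiv ℝ Γ y u v w - fderiv ℝ Γ y v u w + Γ y u (Γ y v w) - Γ y v (Γ y u w)

theorem curvatureOf_skew (Γ : E → E →L[ℝ] E →L[ℝ] E) (y u v w : E) :
    curvatureOf Γ y u v w = -curvatureOf Γ y v u w := by
  simp only [curvatureOf]
  abel

/-- The Ricci identity. -/
theorem covDeriv_covDeriv_sub {Γ : E → E →L[ℝ] E →L[ℝ] E} {Y : E → E} {y : E}
    (hΓ : DifferentiableAt ℝ Γ y) (hY : ContDiffAt ℝ 2 Y y) (u v : E) :
    covDeriv Γ (fun z ↦ covDeriv Γ Y z v) y u - covDeriv Γ (fun z ↦ covDeriv Γ Y z u) y v =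
      curvatureOf Γ y u v (Y y) := by
  have hY1 : DifferentiableAt ℝ Y y := hY.differentiableAt (by norm_num)
  have hY2 : DifferentiableAt ℝ (fderiv ℝ Y) y :=
    (hY.fderiv_right (m := 1) (by norm_num)).differentiableAt (by norm_num)
  have hd : ∀ u v : E, fderiv ℝ (fun z ↦ covDeriv Γ Y z v) y u =
      fderiv ℝ (fderiv ℝ Y) y u v + (fderiv ℝ Γ y u v (Y y) + Γ y v (fderiv ℝ Y y u)) := by
    intro u v
    have h1 : HasFDerivAt (fun z ↦ covDeriv Γ Y z v) _ y :=
      (hY2.hasFDerivAt.clm_apply (hasFDerivAt_const v y)).add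
        ((hΓ.hasFDerivAt.clm_apply (hasFDerivAt_const v y)).clm_apply hY1.hasFDerivAt)
    rw [h1.fderiv]
    simp
    abel
  have hs : fderiv ℝ (fderiv ℝ Y) y u v = fderiv ℝ (fderiv ℝ Y) y v u :=
    (hY.isSymmSndFDerivAt (by simp)) u v
  simp only [covDeriv.eq_def Γ fun z ↦ covDeriv Γ Y z _, hd]
  simp only [covDeriv, curvatureOf, map_add, hs]
  abel

theorem differentiableAt_covDeriv {Γ : E → E →L[ℝ] E →L[ℝ] E} {Y : E → E} {y : E}
    (hΓ : DifferentiableAt ℝ Γ y) (hY : ContDiffAt ℝ 2 Y y) (v : E) :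
    DifferentiableAt ℝ (fun z ↦ covDeriv Γ Y z v) y := by
  have hY1 : DifferentiableAt ℝ Y y := hY.differentiableAt (by norm_num)
  have hY2 : DifferentiableAt ℝ (fderiv ℝ Y) y :=
    (hY.fderiv_right (m := 1) (by norm_num)).differentiableAt (by norm_num)
  exact (hY2.clm_apply (differentiableAt_const v)).add
    ((hΓ.clm_apply (differentiableAt_const v)).clm_apply hY1)

namespace IsLeviCivitaOn

variable {g : E → E →L[ℝ] E →L[ℝ] ℝ} {Γ : E → E →L[ℝ] E →L[ℝ] E} {V : Set E}
  (hg : IsLeviCivitaOn g Γ V)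
include hg

theorem differentiableAt_inner {Y Z : E → E} {z : E} (hz : z ∈ V) (hY : DifferentiableAt ℝ Y z)
    (hZ : DifferentiableAt ℝ Z z) : DifferentiableAt ℝ (fun z ↦ g z (Y z) (Z z)) z :=
  ((hg.differentiableAt_metric z hz).clm_apply hY).clm_apply hZ

theorem fderiv_inner {Y Z : E → E} {z : E} (hz : z ∈ V) (hY : DifferentiableAt ℝ Y z)
    (hZ : DifferentiableAt ℝ Z z) (u : E) :
    fderiv ℝ (fun z ↦ g z (Y z) (Z z)) z u =
      g z (covDeriv Γ Y z u) (Z z) + g z (Y z) (covDeriv Γ Z z u) := by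
  have h1 := (((hg.differentiableAt_metric z hz).hasFDerivAt.clm_apply hY.hasFDerivAt).clm_apply
    hZ.hasFDerivAt).fderiv
  rw [h1]
  simp [hg.compat z hz, covDeriv]
  ring

theorem fderiv_symm {y : E} (hy : y ∈ V) (u v w : E) : fderiv ℝ Γ y u v w = fderiv ℝ Γ y u w v := by
  have h : ∀ v w, fderiv ℝ (fun z ↦ Γ z v w) y u = fderiv ℝ Γ y u v w := fun v w ↦ by
    have h1 := (((hg.differentiableAt y hy).hasFDerivAt.clm_apply (hasFDerivAt_const v y)).clm_apply
      (hasFDerivAt_const w y)).fderiv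
    rw [h1]
    simp
  rw [← h, ← h]
  congr 1
  apply Filter.EventuallyEq.fderiv_eq
  filter_upwards [hg.isOpen.mem_nhds hy] with z hz using hg.symm z hz v w

/-- The symmetry of `Γ` and of its derivative makes the twelve terms cancel in pairs. -/
theorem bianchi {y : E} (hy : y ∈ V) (u v w : E) :
    curvatureOf Γ y u v w + curvatureOf Γ y v w u + curvatureOf Γ y w u v = 0 := by
  simp only [curvatureOf]
  rw [hg.fderiv_symm hy u w v, hg.fderiv_symm hy v u w, hg.fderiv_symm hy w v u,
    hg.symm y hy w u, hg.symm y hy w v, hg.symm y hy v u]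
  abel

end IsLeviCivitaOn

/-- `e` is an orthonormal frame of class `C²` for `g` on `V`. -/
structure IsOrthonormalFrameOn {κ : Type*} [Fintype κ] [DecidableEq κ]
    (g : E → E →L[ℝ] E →L[ℝ] ℝ) (e : κ → E → E) (V : Set E) : Prop where
  contDiffAt : ∀ i, ∀ z ∈ V, ContDiffAt ℝ 2 (e i) z
  orthonormal : ∀ z ∈ V, ∀ i j, g z (e i z) (e j z) = if i = j then 1 else 0
  card_eq : Fintype.card κ = Module.finrank ℝ E

/-- The connection forms `ω_ij(u) = g(∇_u e_i, e_j)`. -/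
def connForm {κ : Type*} (g : E → E →L[ℝ] E →L[ℝ] ℝ) (Γ : E → E →L[ℝ] E →L[ℝ] E) (e : κ → E → E)
    (z u : E) (i j : κ) : ℝ :=
  g z (covDeriv Γ (e i) z u) (e j z)

/-! ### Orthonormal frames, connection forms and Cartan's structure equation. -/

section Frame

variable {κ : Type*} [Fintype κ] [DecidableEq κ]

section Pointwise

variable {b : E →L[ℝ] E →L[ℝ] ℝ} {f : κ → E} (hb : ∀ i j, b (f i) (f j) = if i = j then 1 else 0)
  (hc : Fintype.card κ = Module.finrank ℝ E)
include hb

theorem linearIndependent_of_orthonormal : LinearIndependent ℝ f := by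
  rw [Fintype.linearIndependent_iff]
  intro c hc i
  have := congrArg (fun v ↦ b v (f i)) hc
  simpa [hb] using this

include hc

theorem sum_inner_smul [FiniteDimensional ℝ E] (x : E) : ∑ i, b x (f i) • f i = x := by
  have hs := (linearIndependent_of_orthonormal hb).span_eq_top_of_card_eq_finrank' hc
  have hx : x ∈ Submodule.span ℝ (range f) := hs ▸ Submodule.mem_top
  obtain ⟨c, rfl⟩ := (Submodule.mem_span_range_iff_exists_fun ℝ).1 hx
  simp [hb]

theorem trace_eq_sum_inner [FiniteDimensional ℝ E] (T : E →ₗ[ℝ] E) :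
    LinearMap.trace ℝ E T = ∑ i, b (T (f i)) (f i) := by
  have hs := (linearIndependent_of_orthonormal hb).span_eq_top_of_card_eq_finrank' hc
  let B := Module.Basis.mk (linearIndependent_of_orthonormal hb) hs.ge
  rw [LinearMap.trace_eq_matrix_trace ℝ B, Matrix.trace]
  refine Finset.sum_congr rfl fun i _ ↦ ?_
  have hB : ∀ i, B i = f i := fun i ↦ by simp [B]
  rw [Matrix.diag_apply, LinearMap.toMatrix_apply, hB]
  conv_rhs => rw [← B.sum_repr (T (f i))]
  simp [hB, hb]

end Pointwise

variable [FiniteDimensional ℝ E] {g : E → E →L[ℝ] E →L[ℝ] ℝ} {Γ : E → E →L[ℝ] E →L[ℝ] E}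
  {V : Set E} {e : κ → E → E} (hg : IsLeviCivitaOn g Γ V) (he : IsOrthonormalFrameOn g e V)

include he in
theorem IsOrthonormalFrameOn.inner_eq_sum {z : E} (hz : z ∈ V) (x y : E) :
    g z x y = ∑ i, g z x (e i z) * g z (e i z) y := by
  conv_lhs => rw [← sum_inner_smul (he.orthonormal z hz) he.card_eq x]
  simp

include hg he

omit [FiniteDimensional ℝ E] in
theorem connForm_skew {z : E} (hz : z ∈ V) (u : E) (i j : κ) :
    connForm g Γ e z u i j = -connForm g Γ e z u j i := by
  have h1 := hg.fderiv_inner hz ((he.contDiffAt i z hz).differentiableAt (by norm_num))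
    ((he.contDiffAt j z hz).differentiableAt (by norm_num)) u
  have h2 : fderiv ℝ (fun z ↦ g z (e i z) (e j z)) z = 0 := by
    have : (fun z ↦ g z (e i z) (e j z)) =ᶠ[𝓝 z] fun _ ↦ if i = j then 1 else 0 := by
      filter_upwards [hg.isOpen.mem_nhds hz] with x hx using he.orthonormal x hx i j
    rw [this.fderiv_eq]
    simp
  rw [h2, hg.metric_symm z hz (e i z)] at h1
  simp only [zero_apply] at h1
  simp only [connForm]
  linarith

omit [FiniteDimensional ℝ E] in
theorem differentiableAt_connForm {y : E} (hy : y ∈ V) (u : E) (i j : κ) :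
    DifferentiableAt ℝ (fun z ↦ connForm g Γ e z u i j) y :=
  hg.differentiableAt_inner hy
    (differentiableAt_covDeriv (hg.differentiableAt y hy) (he.contDiffAt i y hy) u)
    ((he.contDiffAt j y hy).differentiableAt (by norm_num))

/-- Cartan's second structure equation. -/
theorem curvatureOf_eq_connForm {y : E} (hy : y ∈ V) (u v : E) (i j : κ) :
    g y (curvatureOf Γ y u v (e i y)) (e j y) =
      fderiv ℝ (fun z ↦ connForm g Γ e z v i j) y u - fderiv ℝ (fun z ↦ connForm g Γ e z u i j) y v
      + ∑ k, (connForm g Γ e y v i k * connForm g Γ e y u k j -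
        connForm g Γ e y u i k * connForm g Γ e y v k j) := by
  -- The product rule gives g(∇_u ∇_v e_i, e_j) + g(∇_v e_i, ∇_u e_j). Expanded in the frame, the
  -- second term is -∑ ω_ik(v) ω_kj(u) by skewness of ω. The Ricci identity then identifies the
  -- difference of the first terms.
  have hd : ∀ u v, fderiv ℝ (fun z ↦ connForm g Γ e z v i j) y u =
      g y (covDeriv Γ (fun z ↦ covDeriv Γ (e i) z v) y u) (e j y) -
        ∑ k, connForm g Γ e y v i k * connForm g Γ e y u k j := by
    intro u v
    simp only [connForm]
    rw [hg.fderiv_inner hy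
      (differentiableAt_covDeriv (hg.differentiableAt y hy) (he.contDiffAt i y hy) v)
      ((he.contDiffAt j y hy).differentiableAt (by norm_num)), sub_eq_add_neg]
    congr 1
    rw [he.inner_eq_sum hy, ← Finset.sum_neg_distrib]
    refine Finset.sum_congr rfl fun k _ ↦ ?_
    have := connForm_skew hg he hy u k j
    simp only [connForm] at this
    rw [this, hg.metric_symm y hy (e k y)]
    ring
  rw [hd, hd, ← covDeriv_covDeriv_sub (hg.differentiableAt y hy) (he.contDiffAt i y hy) u v,
    map_sub, sub_apply, Finset.sum_sub_distrib]
  ring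

/-- Read off from the structure equation, whose right-hand side is skew in i, j because ω is. -/
theorem curvatureOf_skew_right {y : E} (hy : y ∈ V) (u v : E) (i j : κ) :
    g y (curvatureOf Γ y u v (e i y)) (e j y) = -g y (curvatureOf Γ y u v (e j y)) (e i y) := by
  have hd : ∀ u v, fderiv ℝ (fun z ↦ connForm g Γ e z v i j) y u =
      -fderiv ℝ (fun z ↦ connForm g Γ e z v j i) y u := by
    intro u v
    have : (fun z ↦ connForm g Γ e z v i j) =ᶠ[𝓝 y] fun z ↦ -connForm g Γ e z v j i := by
      filter_upwards [hg.isOpen.mem_nhds hy] with z hz using connForm_skew hg he hz v i j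
    rw [this.fderiv_eq, fderiv_fun_neg]
    simp
  rw [curvatureOf_eq_connForm hg he hy, curvatureOf_eq_connForm hg he hy, hd, hd]
  have : ∀ k, connForm g Γ e y v i k * connForm g Γ e y u k j -
        connForm g Γ e y u i k * connForm g Γ e y v k j =
      -(connForm g Γ e y v j k * connForm g Γ e y u k i -
        connForm g Γ e y u j k * connForm g Γ e y v k i) := fun k ↦ by
    rw [connForm_skew hg he hy v i k, connForm_skew hg he hy u k j, connForm_skew hg he hy u i k,
      connForm_skew hg he hy v k j]
    ring
  simp only [this, Finset.sum_neg_distrib]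
  ring

end Frame

end LocalCalculus

/-! ## The Ricci curvature of a metric with a generalized Killing spinor -/

section Linearity

variable {E : Type*} [NormedAddCommGroup E] [NormedSpace ℝ E] (Γ : E → E →L[ℝ] E →L[ℝ] E) (y : E)
  {κ : Type*} [Fintype κ]

theorem curvatureOf_sum_left (u w : E) (c : κ → ℝ) (f : κ → E) :
    curvatureOf Γ y u (∑ i, c i • f i) w = ∑ i, c i • curvatureOf Γ y u (f i) w := by
  simp only [curvatureOf, map_sum, map_smul, sum_apply, smul_apply, smul_sub, smul_add,
    Finset.sum_sub_distrib, Finset.sum_add_distrib]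

theorem curvatureOf_sum_right (u v : E) (c : κ → ℝ) (f : κ → E) :
    curvatureOf Γ y u v (∑ i, c i • f i) = ∑ i, c i • curvatureOf Γ y u v (f i) := by
  simp only [curvatureOf, map_sum, map_smul, smul_sub, smul_add,
    Finset.sum_sub_distrib, Finset.sum_add_distrib]

end Linearity

/-- A vector squares to minus its squared length, so a nonzero vector acts injectively. -/
theorem IsCliffordFamily.eq_zero_of_lin_apply_eq_zero {S : Type*} [NormedAddCommGroup S]
    [NormedSpace ℝ S] {κ : Type*} [Fintype κ] [DecidableEq κ] {γ : κ → S →L[ℝ] S}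
    (hγ : IsCliffordFamily γ) {x : κ → ℝ} {s : S} (hs : s ≠ 0) (hx : linElem γ x s = 0) (i : κ) :
    x i = 0 := by
  have h1 := congrArg (fun T : S →L[ℝ] S ↦ T s) (hγ.lin_mul_lin x x)
  simp only [add_apply, mul_apply_eq_comp, hx, map_zero, add_zero, smul_apply,
    one_apply_eq_self] at h1
  have h2 : ∑ i, x i * x i = 0 := by
    rcases smul_eq_zero.1 h1.symm with h | h
    · linarith
    · exact absurd h hs
  exact mul_self_eq_zero.1 ((Finset.sum_eq_zero_iff_of_nonneg fun i _ ↦ mul_self_nonneg (x i)).1 h2 i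
    (Finset.mem_univ i))

/-! ### Integrability of ∇_u ψ = -½ H u · ψ and its Clifford contraction. -/

section GeneralizedKilling

variable {E : Type*} [NormedAddCommGroup E] [NormedSpace ℝ E] [FiniteDimensional ℝ E]
  {S : Type*} [NormedAddCommGroup S] [NormedSpace ℝ S] {κ : Type*} [Fintype κ] [DecidableEq κ]

/-- The coefficients `g(X, e_i)` of `X` in the frame `e`. -/
def frameCoeff (g : E → E →L[ℝ] E →L[ℝ] ℝ) (e : κ → E → E) (z X : E) (i : κ) : ℝ := g z X (e i z)

/-- The endomorphism `P_u = ¼ ∑ ω_ij(u) γ_i γ_j + ½ c(H u)`, so that `∂_u ψ = -P_u ψ` is the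
equation `∇_u ψ = -½ H u · ψ`. -/
def killingForm (γ : κ → S →L[ℝ] S) (g : E → E →L[ℝ] E →L[ℝ] ℝ) (Γ : E → E →L[ℝ] E →L[ℝ] E)
    (e : κ → E → E) (H : E → E →L[ℝ] E) (u z : E) : S →L[ℝ] S :=
  (1 / 4 : ℝ) • quadElem γ (connForm g Γ e z u) + (1 / 2 : ℝ) • linElem γ (frameCoeff g e z (H z u))

variable {g : E → E →L[ℝ] E →L[ℝ] ℝ} {Γ : E → E →L[ℝ] E →L[ℝ] E} {V : Set E} {e : κ → E → E}
  (hg : IsLeviCivitaOn g Γ V) (he : IsOrthonormalFrameOn g e V)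
  {γ : κ → S →L[ℝ] S} (hγ : IsCliffordFamily γ) {H : E → E →L[ℝ] E} {y : E} (hy : y ∈ V)
  (hH : DifferentiableAt ℝ H y)
  (hH_parallel : ∀ u v, fderiv ℝ H y u v = H y (Γ y u v) - Γ y u (H y v))

include hg he hy hH hH_parallel

/-- For constant `v`, ∇H = 0 gives ∇_u(H v) = H(Γ(u,v)); the sum comes from differentiating the
frame vector `e i`. -/
theorem fderiv_frameCoeff (u v : E) (i : κ) :
    fderiv ℝ (fun z ↦ frameCoeff g e z (H z v) i) y u = frameCoeff g e y (H y (Γ y u v)) i +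
      ∑ j, connForm g Γ e y u i j * frameCoeff g e y (H y v) j := by
  have hHv : HasFDerivAt (fun z ↦ H z v) _ y := hH.hasFDerivAt.clm_apply (hasFDerivAt_const v y)
  simp only [frameCoeff]
  rw [hg.fderiv_inner hy hHv.differentiableAt ((he.contDiffAt i y hy).differentiableAt (by norm_num))]
  congr 1
  · congr 2
    rw [covDeriv, hHv.fderiv]
    simp [hH_parallel]
  · rw [hg.metric_symm y hy, he.inner_eq_sum hy]
    simp only [connForm, hg.metric_symm y hy (H y v)]

include hγ

/-- The derivative of the frame is written as a commutator so that it cancels against the mixed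
terms of [P_u, P_v] in `curvature_integrability`. The term with `Γ y u v` cancels there by symmetry
in u and v. -/
theorem hasFDerivAt_killingForm (v : E) : ∃ P' : E →L[ℝ] S →L[ℝ] S,
    HasFDerivAt (killingForm γ g Γ e H v) P' y ∧ ∀ u, P' u =
      (1 / 4 : ℝ) • quadElem γ (fun i j ↦ fderiv ℝ (fun z ↦ connForm g Γ e z v i j) y u) +
      (1 / 2 : ℝ) • (linElem γ (frameCoeff g e y (H y (Γ y u v))) - (1 / 4 : ℝ) •
        (quadElem γ (connForm g Γ e y u) * linElem γ (frameCoeff g e y (H y v)) -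
          linElem γ (frameCoeff g e y (H y v)) * quadElem γ (connForm g Γ e y u))) := by
  have h1 : HasFDerivAt (fun z ↦ quadElem γ (connForm g Γ e z v)) _ y :=
    HasFDerivAt.fun_sum (u := Finset.univ) fun i _ ↦ HasFDerivAt.fun_sum (u := Finset.univ) fun j _ ↦
      (differentiableAt_connForm hg he hy v i j).hasFDerivAt.smul_const (γ i * γ j)
  have h2 : HasFDerivAt (fun z ↦ linElem γ (frameCoeff g e z (H z v))) _ y :=
    HasFDerivAt.fun_sum (u := Finset.univ) fun i _ ↦
      (hg.differentiableAt_inner hy (hH.clm_apply (differentiableAt_const v))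
        ((he.contDiffAt i y hy).differentiableAt (by norm_num))).hasFDerivAt.smul_const (γ i)
  refine ⟨_, (h1.const_smul (1 / 4 : ℝ)).add (h2.const_smul (1 / 2 : ℝ)), fun u ↦ ?_⟩
  rw [hγ.quadElem_commutator_lin (connForm_skew hg he hy u)]
  have h3 : linElem γ (frameCoeff g e y (H y (Γ y u v))) - (1 / 4 : ℝ) • -((4 : ℝ) • linElem γ fun i ↦
      ∑ j, connForm g Γ e y u i j * frameCoeff g e y (H y v) j) =
      linElem γ fun i ↦ fderiv ℝ (fun z ↦ frameCoeff g e z (H z v) i) y u := by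
    simp only [fderiv_frameCoeff hg he hy hH hH_parallel, linElem_add]
    module
  rw [h3]
  simp only [add_apply, smul_apply, sum_apply, ContinuousLinearMap.smulRight_apply]
  rfl

variable {ψ : E → S} (hψ : ContDiffAt ℝ 2 ψ y)
  (hψ_killing : ∀ z ∈ V, ∀ u, fderiv ℝ ψ z u = -killingForm γ g Γ e H u z (ψ z))
include hψ hψ_killing

/-- The integrability condition of the equation `∇_u ψ = -½ H u · ψ`. -/
theorem curvature_integrability (u v : E) :
    (quadElem γ (fun i j ↦ g y (curvatureOf Γ y u v (e i y)) (e j y)) +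
      (linElem γ (frameCoeff g e y (H y u)) * linElem γ (frameCoeff g e y (H y v)) -
      linElem γ (frameCoeff g e y (H y v)) * linElem γ (frameCoeff g e y (H y u)))) (ψ y) = 0 := by
  obtain ⟨Pu', hPu, hPu'⟩ := hasFDerivAt_killingForm hg he hγ hy hH hH_parallel u
  obtain ⟨Pv', hPv, hPv'⟩ := hasFDerivAt_killingForm hg he hγ hy hH hH_parallel v
  have hψ1 : DifferentiableAt ℝ ψ y := hψ.differentiableAt (by norm_num)
  have hψ2 : DifferentiableAt ℝ (fderiv ℝ ψ) y :=
    (hψ.fderiv_right (m := 1) (by norm_num)).differentiableAt (by norm_num)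
  -- From ∂_v ψ = -P_v ψ one gets ∂_u ∂_v ψ = -(∂_u P_v)ψ + P_v P_u ψ. Symmetry of the second
  -- derivative then says (∂_u P_v - ∂_v P_u + [P_u, P_v])ψ = 0.
  have key : ∀ (u v : E) (P' : E →L[ℝ] S →L[ℝ] S), HasFDerivAt (killingForm γ g Γ e H v) P' y →
      fderiv ℝ (fderiv ℝ ψ) y u v = (-P' u + killingForm γ g Γ e H v y *
        killingForm γ g Γ e H u y) (ψ y) := by
    intro u v P' hP'
    have h1 := (hψ2.hasFDerivAt.clm_apply (hasFDerivAt_const v y)).fderiv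
    have h2 := (hP'.clm_apply hψ1.hasFDerivAt).neg.fderiv
    have h3 : (fun z ↦ fderiv ℝ ψ z v) =ᶠ[𝓝 y] -fun z ↦ killingForm γ g Γ e H v z (ψ z) := by
      filter_upwards [hg.isOpen.mem_nhds hy] with z hz using hψ_killing z hz v
    rw [h3.fderiv_eq, h2] at h1
    have h4 := congrArg (fun L ↦ L u) h1
    simp only [neg_apply, add_apply, ContinuousLinearMap.comp_apply,
      ContinuousLinearMap.flip_apply, zero_apply, map_zero, zero_add, hψ_killing y hy u,
      map_neg] at h4
    rw [← h4]
    simp [mul_apply_eq_comp]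
  have hs : fderiv ℝ (fderiv ℝ ψ) y u v = fderiv ℝ (fderiv ℝ ψ) y v u :=
    (hψ.isSymmSndFDerivAt (by simp)) u v
  rw [key u v Pv' hPv, key v u Pu' hPu, ← sub_eq_zero, ← sub_apply] at hs
  have hQ : quadElem γ (fun i j ↦ g y (curvatureOf Γ y u v (e i y)) (e j y)) =
      quadElem γ (fun i j ↦ fderiv ℝ (fun z ↦ connForm g Γ e z v i j) y u) -
      quadElem γ (fun i j ↦ fderiv ℝ (fun z ↦ connForm g Γ e z u i j) y v) + (1 / 4 : ℝ) •
        (quadElem γ (connForm g Γ e y u) * quadElem γ (connForm g Γ e y v) -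
        quadElem γ (connForm g Γ e y v) * quadElem γ (connForm g Γ e y u)) := by
    rw [hγ.quadElem_commutator_quad (connForm_skew hg he hy u), smul_smul]
    simp only [curvatureOf_eq_connForm hg he hy, quadElem_add, quadElem_sub]
    norm_num
  rw [hQ]
  have hsym : Γ y v u = Γ y u v := hg.symm y hy v u
  rw [hPu', hPv', hsym] at hs
  simp only [killingForm] at hs
  -- The curvature of P is ¼ of the asserted element, and `hs` carries it with the opposite sign.
  rw [← neg_eq_zero, ← neg_apply, ← smul_eq_zero_iff_right (M := S) (r := (1 / 4 : ℝ)) (by norm_num), ← smul_apply]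
  rw [← hs]
  congr 1
  generalize quadElem γ (connForm g Γ e y u) = a
  generalize quadElem γ (connForm g Γ e y v) = b
  generalize linElem γ (frameCoeff g e y (H y u)) = c
  generalize linElem γ (frameCoeff g e y (H y v)) = d
  simp only [mul_add, add_mul, smul_mul_assoc, mul_smul_comm, smul_sub, smul_smul]
  module

/-- Clifford contraction of the integrability condition leaves a single vector acting on ψ(y), and
that vector must vanish since ψ(y) ≠ 0. -/
theorem ricci_of_generalizedKilling (hψ_ne : ψ y ≠ 0) (hH_idem : ∀ v, H y (H y v) = H y v)
    (hH_symm : ∀ v w, g y (H y v) w = g y v (H y w)) (v w : E) :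
    ∑ a, g y (curvatureOf Γ y (e a y) v w) (e a y) =
      (LinearMap.trace ℝ E (H y).toLinearMap - 1) * g y (H y v) w := by
  set f : κ → E := fun i ↦ e i y with hf
  have hon : ∀ i j, g y (f i) (f j) = if i = j then 1 else 0 := he.orthonormal y hy
  have hsum : ∀ x, ∑ i, g y x (f i) • f i = x := sum_inner_smul hon he.card_eq
  let R : κ → κ → κ → κ → ℝ := fun a b i j ↦ g y (curvatureOf Γ y (f a) (f b) (f i)) (f j)
  have hR12 : ∀ a b c d, R a b c d = -R b a c d := fun a b c d ↦ by
    simp only [R]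
    rw [curvatureOf_skew, map_neg, neg_apply]
  have hR34 : ∀ a b c d, R a b c d = -R a b d c := fun a b c d ↦
    curvatureOf_skew_right hg he hy (f a) (f b) c d
  have hRc : ∀ a b c d, R a b c d + R b c a d + R c a b d = 0 := fun a b c d ↦ by
    simp only [R, ← add_apply, ← map_add, hg.bianchi hy]
    simp
  have hRp := curvatureLike_pair_symm hR12 hR34 hRc
  let Hm : κ → κ → ℝ := fun a i ↦ g y (H y (f a)) (f i)
  have hHm : ∀ i j, Hm i j = Hm j i := fun i j ↦ by
    simp only [Hm]
    rw [hH_symm, hg.metric_symm y hy]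
  have hHtr : LinearMap.trace ℝ E (H y).toLinearMap = ∑ i, Hm i i :=
    trace_eq_sum_inner hon he.card_eq _
  -- the identity for members of the frame
  have main : ∀ b i, ∑ a, R a b i a = (∑ i, Hm i i - 1) * Hm b i := by
    intro b
    have hint : ∑ a, γ a * (quadElem γ (R a b) + (linElem γ (Hm a) * linElem γ (Hm b) -
        linElem γ (Hm b) * linElem γ (Hm a))) = (2 : ℝ) • linElem γ fun i ↦
          (∑ a, R a b i a) - (∑ i, Hm i i - 1) * Hm b i := by
      -- Pair symmetry moves the contracted index `a` to the third slot, where the first Bianchi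
      -- identity involves it together with `i` and `j`.
      have hQ : ∀ a, quadElem γ (R a b) = quadElem γ fun i j ↦ R i j a b := fun a ↦ by
        congr 1
        funext i j
        exact hRp a b i j
      -- H fixes w = H e_b, because it is idempotent.
      have hw : ∀ i, ∑ a, Hm a i * Hm b a = Hm b i := fun i ↦ by
        simp only [Hm]
        conv_rhs => rw [← hH_idem (f b), ← hsum (H y (f b))]
        simp [mul_comm]
      simp only [mul_add, Finset.sum_add_distrib, hQ]
      rw [hγ.sum_gen_mul_commutator hHm _ hw, hγ.sum_gen_mul_quad (R := fun i j a ↦ R i j a b)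
        (fun i j a ↦ hR12 i j a b) (fun i j a ↦ hRc i j a b), linElem_sub, linElem_smul]
      simp only [hRp _ b _ _]
      module
    have hzero : (linElem γ fun i ↦ (∑ a, R a b i a) - (∑ i, Hm i i - 1) * Hm b i) (ψ y) = 0 := by
      have h1 := congrArg (fun T : S →L[ℝ] S ↦ T (ψ y)) hint
      simp only [sum_apply, mul_apply_eq_comp, smul_apply] at h1
      have h2 : ∀ a, (quadElem γ (R a b) + (linElem γ (Hm a) * linElem γ (Hm b) -
          linElem γ (Hm b) * linElem γ (Hm a))) (ψ y) = 0 := fun a ↦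
        curvature_integrability hg he hγ hy hH hH_parallel hψ hψ_killing (f a) (f b)
      simp only [h2, map_zero, Finset.sum_const_zero] at h1
      exact (smul_eq_zero_iff_right two_ne_zero).1 h1.symm
    intro i
    exact sub_eq_zero.1 (hγ.eq_zero_of_lin_apply_eq_zero hψ_ne hzero i)
  have h1 : ∀ a, curvatureOf Γ y (f a) v w =
      ∑ b, ∑ i, (g y v (f b) * g y w (f i)) • curvatureOf Γ y (f a) (f b) (f i) := by
    intro a
    conv_lhs => rw [← hsum v, ← hsum w]
    rw [curvatureOf_sum_left]
    simp only [curvatureOf_sum_right, Finset.smul_sum, smul_smul]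
  have h2 : g y (H y v) w = ∑ b, ∑ i, (g y v (f b) * g y w (f i)) * Hm b i := by
    conv_lhs => rw [← hsum v, ← hsum w]
    simp only [map_sum, map_smul, sum_apply, smul_apply, smul_eq_mul, Finset.mul_sum, Hm]
    rw [Finset.sum_comm]
    exact Finset.sum_congr rfl fun b _ ↦ Finset.sum_congr rfl fun i _ ↦ by ring
  rw [h2, hHtr, Finset.mul_sum]
  change ∑ a, g y (curvatureOf Γ y (f a) v w) (f a) = _
  simp only [h1, map_sum, map_smul, sum_apply, smul_apply, smul_eq_mul]
  rw [Finset.sum_comm]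
  refine Finset.sum_congr rfl fun b _ ↦ ?_
  rw [Finset.sum_comm, Finset.mul_sum]
  refine Finset.sum_congr rfl fun i _ ↦ ?_
  rw [← Finset.mul_sum]
  have := main b i
  simp only [R] at this
  rw [this]
  ring

end GeneralizedKilling

/-! ## Skew-symmetric Clifford families -/

section SkewFamily

variable {S : Type*} [NormedAddCommGroup S] [InnerProductSpace ℝ S] {κ : Type*} [Fintype κ]
  {γ : κ → S →L[ℝ] S} (hγ : ∀ i s t, inner ℝ (γ i s) t = -inner ℝ s (γ i t))
include hγ

theorem inner_linElem_self (v : κ → ℝ) (s : S) : inner ℝ s (linElem γ v s) = 0 := by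
  have h : ∀ i, inner ℝ s (γ i s) = 0 := fun i ↦ by
    have := hγ i s s
    rw [real_inner_comm] at this
    linarith
  simp [linElem, sum_apply, inner_sum, inner_smul_right, h]

/-- ⟨s, γ_i γ_j s⟩ = -⟨γ_i s, γ_j s⟩ is symmetric in i, j and pairs to zero with a skew `α`. With
`inner_linElem_self` this makes the length of a generalized Killing spinor constant. -/
theorem inner_quadElem_self {α : κ → κ → ℝ} (hα : ∀ i j, α i j = -α j i) (s : S) :
    inner ℝ s (quadElem γ α s) = 0 := by
  have h : inner ℝ s (quadElem γ α s) = ∑ i, ∑ j, α i j * -inner ℝ (γ i s) (γ j s) := by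
    simp only [quadElem, sum_apply, smul_apply, inner_sum, inner_smul_right, mul_apply_eq_comp]
    exact Finset.sum_congr rfl fun i _ ↦ Finset.sum_congr rfl fun j _ ↦ by
      rw [hγ i s]
      ring
  have h' : inner ℝ s (quadElem γ α s) = -inner ℝ s (quadElem γ α s) := by
    conv_lhs => rw [h, Finset.sum_comm]
    rw [h, ← Finset.sum_neg_distrib]
    refine Finset.sum_congr rfl fun i _ ↦ ?_
    rw [← Finset.sum_neg_distrib]
    refine Finset.sum_congr rfl fun j _ ↦ ?_
    rw [hα j i, real_inner_comm]
    ring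
  linarith

end SkewFamily

section LocalCalculus

variable {E : Type*} [NormedAddCommGroup E] [NormedSpace ℝ E]

/-! ## Parallel projections -/

section Projections

variable {g : E → E →L[ℝ] E →L[ℝ] ℝ} {Γ : E → E →L[ℝ] E →L[ℝ] E} {V : Set E}
  (hg : IsLeviCivitaOn g Γ V) {H : E → E →L[ℝ] E} {y : E} (hy : y ∈ V)
  {κ : Type*} {Y : κ → E → E} (hY : ∀ i, DifferentiableAt ℝ (Y i) y)
include hg hy hY

/-- A field of orthogonal projections is parallel if its kernel is a parallel distribution. -/
theorem fderiv_of_parallel_ker (hH : DifferentiableAt ℝ H y)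
    (hH_idem : ∀ z ∈ V, ∀ v, H z (H z v) = H z v)
    (hH_symm : ∀ z ∈ V, ∀ v w, g z (H z v) w = g z v (H z w))
    (hHY : ∀ z ∈ V, ∀ i, H z (Y i z) = 0)
    (hY_parallel : ∀ i u, H y (covDeriv Γ (Y i) y u) = 0)
    (hker : ∀ v, H y v = 0 → v ∈ Submodule.span ℝ (range fun i ↦ Y i y)) (u v : E) :
    fderiv ℝ H y u v = H y (Γ y u v) - Γ y u (H y v) := by
  have hnhds := hg.isOpen.mem_nhds hy
  have hHv : ∀ v, HasFDerivAt (fun z ↦ H z v) _ y := fun v ↦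
    hH.hasFDerivAt.clm_apply (hasFDerivAt_const v y)
  -- `B` is ∇_u H. It kills the kernel of H, so B = BH; differentiating H² = H gives BH + HB = B,
  -- hence HB = 0. Since B is also g-symmetric, g(Bv, Bv) = g(v, BHBv) = 0.
  let B : E →L[ℝ] E := fderiv ℝ H y u + Γ y u ∘L H y - H y ∘L Γ y u
  have hB : ∀ v, B v = fderiv ℝ H y u v + Γ y u (H y v) - H y (Γ y u v) := fun v ↦ rfl
  have hBY : ∀ i, B (Y i y) = 0 := by
    intro i
    have h1 := (hH.hasFDerivAt.clm_apply (hY i).hasFDerivAt).fderiv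
    have h2 : (fun z ↦ H z (Y i z)) =ᶠ[𝓝 y] fun _ ↦ 0 := by
      filter_upwards [hnhds] with z hz using hHY z hz i
    rw [h2.fderiv_eq] at h1
    have h3 := congrArg (fun L ↦ L u) h1
    simp only [fderiv_fun_const, Pi.zero_apply, zero_apply, add_apply,
      ContinuousLinearMap.comp_apply, ContinuousLinearMap.flip_apply] at h3
    have h4 := hY_parallel i u
    rw [covDeriv, map_add] at h4
    rw [hB, hHY y hy, map_zero, add_zero, eq_neg_of_add_eq_zero_right h4,
      ← eq_neg_of_add_eq_zero_right h3.symm]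
    exact sub_self _
  have hBH : ∀ v, B v = B (H y v) := by
    intro v
    have h1 : v - H y v ∈ Submodule.span ℝ (range fun i ↦ Y i y) :=
      hker _ (by rw [map_sub, hH_idem y hy, sub_self])
    have h2 : Submodule.span ℝ (range fun i ↦ Y i y) ≤ LinearMap.ker B.toLinearMap := by
      rw [Submodule.span_le]
      rintro _ ⟨i, rfl⟩
      exact hBY i
    have h3 : B (v - H y v) = 0 := h2 h1
    rwa [map_sub, sub_eq_zero] at h3
  have hBHB : ∀ v, B (H y v) + H y (B v) = B v := by
    intro v
    have h1 := (hH.hasFDerivAt.clm_apply (hHv v)).fderiv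
    have h2 : (fun z ↦ H z (H z v)) =ᶠ[𝓝 y] fun z ↦ H z v := by
      filter_upwards [hnhds] with z hz using hH_idem z hz v
    rw [h2.fderiv_eq, (hHv v).fderiv] at h1
    have h3 := congrArg (fun L ↦ L u) h1
    simp only [add_apply, ContinuousLinearMap.comp_apply, ContinuousLinearMap.flip_apply,
      zero_apply, map_zero, zero_add] at h3
    simp only [hB, map_add, map_sub, hH_idem y hy]
    linear_combination (norm := module) (-1 : ℝ) • h3
  have hBsymm : ∀ v w, g y (B v) w = g y v (B w) := by
    intro v w
    have h1 := hg.fderiv_inner hy (hHv v).differentiableAt (differentiableAt_const w) u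
    have h2 := hg.fderiv_inner hy (differentiableAt_const v) (hHv w).differentiableAt u
    have h3 : (fun z ↦ g z (H z v) w) =ᶠ[𝓝 y] fun z ↦ g z v (H z w) := by
      filter_upwards [hnhds] with z hz using hH_symm z hz v w
    rw [h3.fderiv_eq, h2] at h1
    simp only [covDeriv, (hHv v).fderiv, (hHv w).fderiv, fderiv_fun_const, Pi.zero_apply, zero_apply,
      zero_add, add_apply, ContinuousLinearMap.comp_apply, ContinuousLinearMap.flip_apply,
      map_zero] at h1
    simp only [hB, map_add, map_sub, add_apply, sub_apply, hH_symm y hy (Γ y u v),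
      ← hH_symm y hy v] at h1 ⊢
    linarith
  have hHB : ∀ v, H y (B v) = 0 := fun v ↦ by
    have := hBHB v
    rwa [← hBH, add_eq_left] at this
  have hB0 : B v = 0 := by
    by_contra hne
    have h1 := hg.metric_pos y hy _ hne
    rw [hBsymm, hBH (B v), hHB, map_zero, map_zero] at h1
    exact lt_irrefl _ h1
  rw [hB] at hB0
  rw [← sub_eq_zero, ← hB0]
  abel

end Projections

theorem isInvertible_of_injective {F : Type*} [NormedAddCommGroup F] [NormedSpace ℝ F]
    [FiniteDimensional ℝ F] {b : F →L[ℝ] F →L[ℝ] ℝ} (hb : Function.Injective b) :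
    b.IsInvertible := by
  have hr : Module.finrank ℝ F = Module.finrank ℝ (F →L[ℝ] ℝ) := by
    rw [← LinearEquiv.finrank_eq (LinearMap.toContinuousLinearMap (𝕜 := ℝ) (E := F) (F' := ℝ))]
    exact Subspace.dual_finrank_eq.symm
  exact ⟨(LinearEquiv.ofInjectiveOfFinrankEq b.toLinearMap hb hr).toContinuousLinearEquiv, by
    ext; rfl⟩

theorem isInvertible_of_pos [FiniteDimensional ℝ E] {b : E →L[ℝ] E →L[ℝ] ℝ}
    (hb : ∀ u, u ≠ 0 → 0 < b u u) : b.IsInvertible := by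
  refine isInvertible_of_injective ((injective_iff_map_eq_zero b).2 fun u hu ↦ ?_)
  by_contra hne
  have := hb u hne
  rw [hu] at this
  exact lt_irrefl _ this

theorem differentiableAt_precomp {F G : Type*} [NormedAddCommGroup F] [NormedSpace ℝ F]
    [NormedAddCommGroup G] [NormedSpace ℝ G] {B : E → F →L[ℝ] G} {y : E}
    (hB : DifferentiableAt ℝ B y) :
    DifferentiableAt ℝ (fun z ↦
      (ContinuousLinearMap.precomp ℝ (B z) : (G →L[ℝ] ℝ) →L[ℝ] F →L[ℝ] ℝ)) y := by
  have h : DifferentiableAt ℝ (fun A : F →L[ℝ] G ↦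
      (ContinuousLinearMap.precomp ℝ A : (G →L[ℝ] ℝ) →L[ℝ] F →L[ℝ] ℝ)) (B y) :=
    (ContinuousLinearMap.compL ℝ F G ℝ).flip.differentiableAt
  exact h.comp y hB

/-- The orthogonal projection along a distribution with a differentiable frame is differentiable. -/
theorem differentiableAt_of_ker_frame {g : E → E →L[ℝ] E →L[ℝ] ℝ} {V : Set E}
    {H : E → E →L[ℝ] E} {y : E} (hV : V ∈ 𝓝 y) (hg : DifferentiableAt ℝ g y)
    (hg_pos : ∀ z ∈ V, ∀ u, u ≠ 0 → 0 < g z u u)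
    {κ : Type*} [Fintype κ] {Y : κ → E → E} (hY : ∀ i, DifferentiableAt ℝ (Y i) y)
    (hY_indep : ∀ z ∈ V, LinearIndependent ℝ fun i ↦ Y i z)
    (hsub : ∀ z ∈ V, ∀ v, v - H z v ∈ Submodule.span ℝ (range fun i ↦ Y i z))
    (horth : ∀ z ∈ V, ∀ v i, g z (H z v) (Y i z) = 0) : DifferentiableAt ℝ H y := by
  -- `B z` maps coefficients to combinations of the frame, `P z` is its transpose and `A z` the Gram
  -- form. The projection is then H = 1 - B A⁻¹ P g, as `hform` states, and every factor is
  -- differentiable.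
  let B : E → (κ → ℝ) →L[ℝ] E := fun z ↦
    ∑ i, (ContinuousLinearMap.proj (R := ℝ) (φ := fun _ : κ ↦ ℝ) i).smulRight (Y i z)
  have hBapp : ∀ z c, B z c = ∑ i, c i • Y i z := fun z c ↦ by simp [B, sum_apply]
  have hB : DifferentiableAt ℝ B y := by
    refine DifferentiableAt.fun_sum fun i _ ↦ ?_
    exact ((ContinuousLinearMap.smulRightL ℝ (κ → ℝ) E
      (ContinuousLinearMap.proj (R := ℝ) (φ := fun _ : κ ↦ ℝ) i)).differentiableAt).comp y (hY i)
  let P : E → (E →L[ℝ] ℝ) →L[ℝ] (κ → ℝ) →L[ℝ] ℝ := fun z ↦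
    ContinuousLinearMap.precomp ℝ (B z)
  have hP : DifferentiableAt ℝ P y :=
    differentiableAt_precomp hB
  let A : E → (κ → ℝ) →L[ℝ] (κ → ℝ) →L[ℝ] ℝ := fun z ↦ P z ∘L g z ∘L B z
  have hA : DifferentiableAt ℝ A y := hP.clm_comp (hg.clm_comp hB)
  have hAapp : ∀ z c d, A z c d = g z (B z c) (B z d) := fun z c d ↦ rfl
  have hAinv : ∀ z ∈ V, (A z).IsInvertible := by
    intro z hz
    refine isInvertible_of_injective ((injective_iff_map_eq_zero (A z)).2 fun c hc ↦ ?_)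
    have h1 : B z c = 0 := by
      by_contra hne
      have := hg_pos z hz _ hne
      rw [← hAapp, hc] at this
      exact lt_irrefl _ this
    rw [hBapp] at h1
    exact funext (Fintype.linearIndependent_iff.1 (hY_indep z hz) c h1)
  have hyV := mem_of_mem_nhds hV
  have hAi : DifferentiableAt ℝ (fun z ↦ (A z).inverse) y :=
    (((hAinv y hyV).contDiffAt_map_inverse (n := 1)).differentiableAt (by norm_num)).comp y hA
  have hform : H =ᶠ[𝓝 y] fun z ↦ ContinuousLinearMap.id ℝ E - B z ∘L (A z).inverse ∘L P z ∘L g z := by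
    filter_upwards [hV] with z hz
    ext v
    obtain ⟨c, hc⟩ := (Submodule.mem_span_range_iff_exists_fun ℝ).1 (hsub z hz v)
    rw [← hBapp] at hc
    have h1 : (A z).inverse (P z (g z v)) = c := by
      rw [(hAinv z hz).inverse_apply_eq]
      ext d
      rw [hAapp, hc, map_sub, sub_apply]
      have : g z (H z v) (B z d) = 0 := by
        rw [hBapp, map_sum]
        exact Finset.sum_eq_zero fun i _ ↦ by rw [map_smul, horth z hz, smul_zero]
      rw [this, sub_zero]
      rfl
    simp only [sub_apply, ContinuousLinearMap.id_apply, ContinuousLinearMap.comp_apply]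
    rw [h1, hc]
    abel
  exact DifferentiableAt.congr_of_eventuallyEq
    ((differentiableAt_const _).sub (hB.clm_comp (hAi.clm_comp (hP.clm_comp hg)))) hform

/-! ## Existence of the Levi-Civita connection -/

section Existence

/-- The Christoffel symbols of `g`, as a bilinear map. -/
def christoffelMap (g : E → E →L[ℝ] E →L[ℝ] ℝ) (z : E) : E →L[ℝ] E →L[ℝ] E :=
  let D : E →L[ℝ] E →L[ℝ] E →L[ℝ] ℝ := fderiv ℝ g z
  (ContinuousLinearMap.compL ℝ E (E →L[ℝ] ℝ) E (g z).inverse) ∘L ((1 / 2 : ℝ) • (D + D.flip -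
    (ContinuousLinearMap.flipₗᵢ ℝ E E ℝ).toContinuousLinearEquiv.toContinuousLinearMap ∘L D.flip))

theorem christoffelMap_apply (g : E → E →L[ℝ] E →L[ℝ] ℝ) (z u v : E) :
    christoffelMap g z u v = (g z).inverse ((1 / 2 : ℝ) • (fderiv ℝ g z u v + fderiv ℝ g z v u -
      ((fderiv ℝ g z).flip u).flip v)) := rfl

theorem inner_christoffelMap {g : E → E →L[ℝ] E →L[ℝ] ℝ} {z : E} (hz : (g z).IsInvertible)
    (u v w : E) : g z (christoffelMap g z u v) w =
      (1 / 2) * (fderiv ℝ g z u v w + fderiv ℝ g z v u w - fderiv ℝ g z w u v) := by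
  rw [christoffelMap_apply, hz.self_apply_inverse]
  simp

theorem fderiv_metric_symm {g : E → E →L[ℝ] E →L[ℝ] ℝ} {z : E} (hg : DifferentiableAt ℝ g z)
    (hsymm : ∀ᶠ x in 𝓝 z, ∀ u v, g x u v = g x v u) (u v w : E) :
    fderiv ℝ g z u v w = fderiv ℝ g z u w v := by
  have h : ∀ v w, fderiv ℝ (fun z ↦ g z v w) z u = fderiv ℝ g z u v w := fun v w ↦ by
    have h1 := ((hg.hasFDerivAt.clm_apply (hasFDerivAt_const v z)).clm_apply
      (hasFDerivAt_const w z)).fderiv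
    rw [h1]
    simp
  rw [← h, ← h]
  congr 1
  apply Filter.EventuallyEq.fderiv_eq
  filter_upwards [hsymm] with x hx using hx v w

/-- Symmetry and metric compatibility are linear consequences of the Koszul formula. Two derivatives
of the metric are needed for `Γ` to be differentiable. -/
theorem isLeviCivitaOn_christoffelMap [FiniteDimensional ℝ E] {g : E → E →L[ℝ] E →L[ℝ] ℝ}
    {V : Set E} (hV : IsOpen V) (hg : ContDiffOn ℝ 2 g V)
    (hsymm : ∀ z ∈ V, ∀ u v, g z u v = g z v u)
    (hpos : ∀ z ∈ V, ∀ u, u ≠ 0 → 0 < g z u u) : IsLeviCivitaOn g (christoffelMap g) V := by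
  have hgz : ∀ z ∈ V, ContDiffAt ℝ 2 g z := fun z hz ↦ hg.contDiffAt (hV.mem_nhds hz)
  have hinv : ∀ z ∈ V, (g z).IsInvertible := fun z hz ↦ isInvertible_of_pos (hpos z hz)
  have hd : ∀ z ∈ V, DifferentiableAt ℝ g z := fun z hz ↦ (hgz z hz).differentiableAt (by norm_num)
  have hsd : ∀ z ∈ V, ∀ u v w, fderiv ℝ g z u v w = fderiv ℝ g z u w v := fun z hz ↦
    fderiv_metric_symm (hd z hz) (by filter_upwards [hV.mem_nhds hz] with x hx using hsymm x hx)
  refine ⟨hV, hsymm, hpos, hd, fun z hz ↦ ?_, fun z hz u v ↦ ?_, fun z hz u v w ↦ ?_⟩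
  · have h1 : DifferentiableAt ℝ (fderiv ℝ g) z :=
      ((hgz z hz).fderiv_right (m := 1) (by norm_num)).differentiableAt (by norm_num)
    have h2 : DifferentiableAt ℝ (fun z ↦ (g z).inverse) z :=
      (((hinv z hz).contDiffAt_map_inverse (n := 1)).differentiableAt (by norm_num)).comp z (hd z hz)
    have h3 : DifferentiableAt ℝ (fun z ↦ (fderiv ℝ g z).flip) z :=
      ((ContinuousLinearMap.flipₗᵢ ℝ E E (E →L[ℝ] ℝ)).toContinuousLinearEquiv.differentiableAt).comp
        z h1
    refine DifferentiableAt.clm_comp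
      (((ContinuousLinearMap.compL ℝ E (E →L[ℝ] ℝ) E).differentiableAt).comp z h2) ?_
    exact DifferentiableAt.const_smul ((h1.add h3).sub ((differentiableAt_const _).clm_comp h3)) (1 / 2 : ℝ)
  · rw [christoffelMap_apply, christoffelMap_apply]
    congr 2
    ext w
    simp [hsd z hz w u v, add_comm]
  · rw [inner_christoffelMap (hinv z hz), hsymm z hz v, inner_christoffelMap (hinv z hz),
      hsd z hz v u w, hsd z hz w u v, hsd z hz u w v]
    ring

end Existence

end LocalCalculus

/-! ## The generalized cone over an open subset of a normed space -/

section LocalCone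

variable {E : Type*} [NormedAddCommGroup E] [NormedSpace ℝ E]

/-- The metric `g + (t² - 1) g(H ·, ·) + dt²` on `E × ℝ`. -/
def coneForm (g : E → E →L[ℝ] E →L[ℝ] ℝ) (H : E → E →L[ℝ] E) (p : E × ℝ) :
    (E × ℝ) →L[ℝ] (E × ℝ) →L[ℝ] ℝ :=
  (ContinuousLinearMap.precomp ℝ (ContinuousLinearMap.fst ℝ E ℝ)) ∘L
    (g p.1 + (p.2 ^ 2 - 1) • (g p.1 ∘L H p.1)) ∘L ContinuousLinearMap.fst ℝ E ℝ +
    (ContinuousLinearMap.snd ℝ E ℝ).smulRight (ContinuousLinearMap.snd ℝ E ℝ)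

theorem coneForm_apply (g : E → E →L[ℝ] E →L[ℝ] ℝ) (H : E → E →L[ℝ] E) (p a b : E × ℝ) :
    coneForm g H p a b = g p.1 a.1 b.1 + (p.2 ^ 2 - 1) * g p.1 (H p.1 a.1) b.1 + a.2 * b.2 := by
  simp [coneForm]

/-- The Christoffel symbols of the generalized cone, where `τ` stands for `1 / t`. -/
def coneChristoffel (g : E → E →L[ℝ] E →L[ℝ] ℝ) (Γ : E → E →L[ℝ] E →L[ℝ] E) (H : E → E →L[ℝ] E)
    (τ : ℝ → ℝ) (p a b : E × ℝ) : E × ℝ :=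
  (Γ p.1 a.1 b.1 + τ p.2 • (a.2 • H p.1 b.1 + b.2 • H p.1 a.1), -p.2 * g p.1 (H p.1 a.1) b.1)

variable {g : E → E →L[ℝ] E →L[ℝ] ℝ} {Γ : E → E →L[ℝ] E →L[ℝ] E} {V : Set E}
  (hg : IsLeviCivitaOn g Γ V) {H : E → E →L[ℝ] E} {τ : ℝ → ℝ} {p : E × ℝ} (hp : p.1 ∈ V)
  (hH : DifferentiableAt ℝ H p.1)
  (hH_parallel : ∀ u v, fderiv ℝ H p.1 u v = H p.1 (Γ p.1 u v) - Γ p.1 u (H p.1 v))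
  (hH_idem : ∀ v, H p.1 (H p.1 v) = H p.1 v)
  (hH_symm : ∀ v w, g p.1 (H p.1 v) w = g p.1 v (H p.1 w))
  (hτ : (p.2 * τ p.2) • H p.1 = H p.1)

-- The coordinate form of ∇h = 0.
include hg hp hH hH_parallel in
theorem fderiv_inner_proj (u v w : E) :
    fderiv ℝ (fun z ↦ g z (H z v) w) p.1 u =
      g p.1 (H p.1 (Γ p.1 u v)) w + g p.1 (H p.1 v) (Γ p.1 u w) := by
  have hHv := (hH.hasFDerivAt.clm_apply (hasFDerivAt_const v p.1))
  rw [hg.fderiv_inner hp hHv.differentiableAt (differentiableAt_const w)]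
  simp [covDeriv, hHv.fderiv, hH_parallel]

include hg hp hH hH_parallel in
theorem fderiv_coneForm (a b c : E × ℝ) :
    DifferentiableAt ℝ (coneForm g H) p ∧ fderiv ℝ (coneForm g H) p a b c =
      g p.1 (Γ p.1 a.1 b.1) c.1 + g p.1 b.1 (Γ p.1 a.1 c.1) +
        (p.2 ^ 2 - 1) * (g p.1 (H p.1 (Γ p.1 a.1 b.1)) c.1 + g p.1 (H p.1 b.1) (Γ p.1 a.1 c.1)) +
        2 * p.2 * a.2 * g p.1 (H p.1 b.1) c.1 := by
  have hg1 : DifferentiableAt ℝ (fun q : E × ℝ ↦ g q.1) p :=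
    (hg.differentiableAt_metric p.1 hp).comp p differentiableAt_fst
  have hH1 : DifferentiableAt ℝ (fun q : E × ℝ ↦ H q.1) p := hH.comp p differentiableAt_fst
  have hd : DifferentiableAt ℝ (coneForm g H) p := by
    refine DifferentiableAt.add ((differentiableAt_const _).clm_comp (DifferentiableAt.clm_comp
      (hg1.add (DifferentiableAt.fun_smul ?_ (hg1.clm_comp hH1))) (differentiableAt_const _)))
      (differentiableAt_const _)
    fun_prop
  refine ⟨hd, ?_⟩
  have h1 := ((hd.hasFDerivAt.clm_apply (hasFDerivAt_const b p)).clm_apply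
    (hasFDerivAt_const c p)).fderiv
  have h2 : HasFDerivAt (fun q : E × ℝ ↦ g q.1 b.1 c.1) _ p :=
    (hg.differentiableAt_inner hp (differentiableAt_const b.1)
      (differentiableAt_const c.1)).hasFDerivAt.comp p hasFDerivAt_fst
  have h3 : HasFDerivAt (fun q : E × ℝ ↦ g q.1 (H q.1 b.1) c.1) _ p :=
    (hg.differentiableAt_inner hp (hH.clm_apply (differentiableAt_const b.1))
      (differentiableAt_const c.1)).hasFDerivAt.comp p hasFDerivAt_fst
  have hsnd : HasFDerivAt (fun q : E × ℝ ↦ q.2) (ContinuousLinearMap.snd ℝ E ℝ) p := hasFDerivAt_snd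
  have h4 : HasFDerivAt (fun q : E × ℝ ↦ q.2 ^ 2 - 1) _ p :=
    ((hasDerivAt_pow 2 p.2).sub_const 1).comp_hasFDerivAt p hsnd
  have h5 := ((h2.add (h4.mul h3)).add (hasFDerivAt_const (b.2 * c.2) p)).fderiv
  have h6 : (fun q ↦ coneForm g H q b c) = ((fun q : E × ℝ ↦ g q.1 b.1 c.1) +
      ((fun q : E × ℝ ↦ q.2 ^ 2 - 1) * fun q : E × ℝ ↦ g q.1 (H q.1 b.1) c.1)) +
      fun _ ↦ b.2 * c.2 := by
    funext q
    simp [coneForm_apply]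
  rw [h6, h5] at h1
  have h7 := congrArg (fun L ↦ L a) h1
  have h8 := hg.fderiv_inner hp (differentiableAt_const b.1) (differentiableAt_const c.1) a.1
  simp only [covDeriv, fderiv_fun_const, Pi.zero_apply, zero_apply, zero_add] at h8
  simp only [add_apply, ContinuousLinearMap.comp_apply, ContinuousLinearMap.flip_apply, zero_apply,
    map_zero, zero_add, add_zero, smul_apply, smul_eq_mul, ContinuousLinearMap.coe_fst',
    ContinuousLinearMap.coe_snd', fderiv_inner_proj hg hp hH hH_parallel, h8] at h7
  rw [← h7]
  simp
  ring

include hτ in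
theorem smul_proj (v : E) : (p.2 * τ p.2) • H p.1 v = H p.1 v := by
  conv_rhs => rw [← hτ]
  rfl

-- Checked by pairing with a test vector in the Koszul formula. The function 1/t enters only through
-- tτH = H, so the formula also covers t = 0 when H = 0.
include hg hp hH hH_parallel hH_idem hH_symm hτ in
theorem christoffelMap_coneForm [FiniteDimensional ℝ E]
    (hpos : ∀ a, a ≠ 0 → 0 < coneForm g H p a a) (a b : E × ℝ) :
    christoffelMap (coneForm g H) p a b = coneChristoffel g Γ H τ p a b := by
  rw [christoffelMap_apply, (isInvertible_of_pos hpos).inverse_apply_eq]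
  refine ContinuousLinearMap.ext fun c ↦ ?_
  have hD := fun a b c ↦ (fderiv_coneForm hg hp hH hH_parallel a b c).2
  rw [coneForm_apply]
  simp only [smul_apply, sub_apply, add_apply, ContinuousLinearMap.flip_apply, hD, smul_eq_mul,
    coneChristoffel]
  have hs := hg.symm p.1 hp
  have hm := hg.metric_symm p.1 hp
  have e1 : ∀ v w, g p.1 v (H p.1 w) = g p.1 (H p.1 v) w := fun v w ↦ (hH_symm v w).symm
  have e2 : ∀ v w, p.2 * (p.2 * τ p.2 * g p.1 (H p.1 v) w) = p.2 * g p.1 (H p.1 v) w :=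
    fun v w ↦ by
    conv_rhs => rw [← smul_proj hτ v]
    simp
  have e2' : ∀ v w, p.2 * τ p.2 * g p.1 (H p.1 v) w = g p.1 (H p.1 v) w := fun v w ↦ by
    conv_rhs => rw [← smul_proj hτ v]
    simp
  simp only [map_add, map_smul, add_apply, smul_apply, smul_eq_mul, hH_idem]
  rw [hs b.1 a.1, hs c.1 a.1, hs c.1 b.1, hm b.1 (Γ p.1 a.1 c.1), hm a.1 (Γ p.1 b.1 c.1),
    ← e1 b.1, ← e1 a.1 (Γ p.1 b.1 c.1), hm b.1 (H p.1 _), hm a.1 (H p.1 (Γ _ _ _)),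
    ← e1 a.1 b.1, hm a.1 (H p.1 b.1)]
  have k1 := e2' b.1 c.1
  have k2 := e2' a.1 c.1
  linear_combination (- p.2 * a.2) * k1 - (p.2 * b.2) * k2

include hg hp hH hH_parallel in
theorem fderiv_coneChristoffel {τ' : ℝ} (hτ' : HasDerivAt τ τ' p.2) (a b c : E × ℝ) :
    fderiv ℝ (fun q ↦ coneChristoffel g Γ H τ q b c) p a =
      (fderiv ℝ Γ p.1 a.1 b.1 c.1 + (τ' * a.2) • (b.2 • H p.1 c.1 + c.2 • H p.1 b.1) +
        τ p.2 • (b.2 • (H p.1 (Γ p.1 a.1 c.1) - Γ p.1 a.1 (H p.1 c.1)) +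
          c.2 • (H p.1 (Γ p.1 a.1 b.1) - Γ p.1 a.1 (H p.1 b.1))),
        -(a.2 * g p.1 (H p.1 b.1) c.1) - p.2 * (g p.1 (H p.1 (Γ p.1 a.1 b.1)) c.1 +
          g p.1 (H p.1 b.1) (Γ p.1 a.1 c.1))) := by
  have hfst : HasFDerivAt (fun q : E × ℝ ↦ q.1) (ContinuousLinearMap.fst ℝ E ℝ) p := hasFDerivAt_fst
  have hsnd : HasFDerivAt (fun q : E × ℝ ↦ q.2) (ContinuousLinearMap.snd ℝ E ℝ) p := hasFDerivAt_snd
  have h1 := ((((hg.differentiableAt p.1 hp).hasFDerivAt.comp p hfst).clm_apply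
    (hasFDerivAt_const b.1 p)).clm_apply (hasFDerivAt_const c.1 p))
  have h2 := fun v : E ↦ ((hH.hasFDerivAt.comp p hfst).clm_apply (hasFDerivAt_const v p))
  have h3 := hτ'.comp_hasFDerivAt p hsnd
  have h4 : HasFDerivAt (fun q : E × ℝ ↦ g q.1 (H q.1 b.1) c.1) _ p :=
    (hg.differentiableAt_inner hp (hH.clm_apply (differentiableAt_const b.1))
      (differentiableAt_const c.1)).hasFDerivAt.comp p hfst
  have h5 := (h1.add (h3.smul (((h2 c.1).const_smul b.2).add ((h2 b.1).const_smul c.2)))).prodMk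
    (hsnd.neg.mul h4)
  have h6 : fderiv ℝ (fun q ↦ coneChristoffel g Γ H τ q b c) p = _ := h5.fderiv
  rw [h6]
  simp only [ContinuousLinearMap.prod_apply, add_apply, ContinuousLinearMap.comp_apply,
    ContinuousLinearMap.flip_apply, zero_apply, map_zero, zero_add, smul_apply,
    ContinuousLinearMap.coe_fst', ContinuousLinearMap.coe_snd',
    fderiv_inner_proj hg hp hH hH_parallel, hH_parallel, smul_eq_mul, neg_apply,
    ContinuousLinearMap.smulRight_apply, Function.comp_apply, Pi.add_apply, Pi.smul_apply,
    Pi.neg_apply]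
  refine Prod.ext ?_ ?_
  · simp only
    module
  · simp only
    ring

include hg hp hH hH_parallel hH_idem hH_symm hτ in
/-- The curvature of the generalized cone: `R(u,v)w - h(v,w) H u + h(u,w) H v`. -/
theorem curvature_coneChristoffel {τ' : ℝ} (hτ' : HasDerivAt τ τ' p.2)
    (hτ'' : (τ' + τ p.2 ^ 2) • H p.1 = 0) (a b c : E × ℝ) :
    fderiv ℝ (fun q ↦ coneChristoffel g Γ H τ q b c) p a -
      fderiv ℝ (fun q ↦ coneChristoffel g Γ H τ q a c) p b +
      coneChristoffel g Γ H τ p a (coneChristoffel g Γ H τ p b c) -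
      coneChristoffel g Γ H τ p b (coneChristoffel g Γ H τ p a c) =
    (curvatureOf Γ p.1 a.1 b.1 c.1 - g p.1 (H p.1 b.1) c.1 • H p.1 a.1 +
      g p.1 (H p.1 a.1) c.1 • H p.1 b.1, 0) := by
  have hs := hg.symm p.1 hp
  have hm := hg.metric_symm p.1 hp
  have e2' : ∀ v w, p.2 * τ p.2 * g p.1 (H p.1 v) w = g p.1 (H p.1 v) w := fun v w ↦ by
    conv_rhs => rw [← smul_proj hτ v]
    simp
  have e3 : ∀ v, (τ' + τ p.2 ^ 2) • H p.1 v = 0 := fun v ↦ by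
    have := congrArg (fun L : E →L[ℝ] E ↦ L v) hτ''
    simpa using this
  have e4 : ∀ v w, g p.1 (H p.1 v) (H p.1 w) = g p.1 (H p.1 v) w := fun v w ↦ by
    rw [← hH_symm, hH_idem]
  have e5 := smul_proj hτ
  rw [fderiv_coneChristoffel hg hp hH hH_parallel hτ', fderiv_coneChristoffel hg hp hH hH_parallel hτ']
  refine Prod.ext ?_ ?_
  · simp only [coneChristoffel, curvatureOf, Prod.fst_sub, Prod.fst_add, map_add, map_smul, hH_idem]
    rw [hs b.1 a.1]
    -- The terms with τ' + τ² are the curvatures R(∂_t, ·)∂_t; they vanish because (1/t)' = -1/t².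
    -- In the other corrections, tτH is replaced by H.
    linear_combination (norm := module) (a.2 * c.2) • e3 b.1 - (b.2 * c.2) • e3 a.1 -
      g p.1 (H p.1 b.1) c.1 • e5 a.1 + g p.1 (H p.1 a.1) c.1 • e5 b.1
  · simp only [coneChristoffel, Prod.snd_sub, Prod.snd_add, map_add, map_smul, smul_eq_mul, e4]
    have k1 := e2' a.1 b.1
    have k2 := e2' a.1 c.1
    have k3 := e2' b.1 c.1
    have k4 : g p.1 (H p.1 b.1) a.1 = g p.1 (H p.1 a.1) b.1 := by rw [hH_symm, hm]
    rw [hs b.1 a.1, k4]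
    linear_combination (-b.2) * k2 + a.2 * k3

include hg hp hH hH_parallel hH_idem hH_symm hτ in
/-- The trace which gives the Ricci curvature of the generalized cone vanishes if the Ricci
curvature of `g` is `(tr H - 1) h`. -/
theorem trace_curvature_coneChristoffel [FiniteDimensional ℝ E] {τ' : ℝ} (hτ' : HasDerivAt τ τ' p.2)
    (hτ'' : (τ' + τ p.2 ^ 2) • H p.1 = 0) {κ : Type*} [Fintype κ] [DecidableEq κ] {f : κ → E}
    (hf : ∀ i j, g p.1 (f i) (f j) = if i = j then 1 else 0)
    (hκ : Fintype.card κ = Module.finrank ℝ E) (b c : E × ℝ)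
    (hRic : ∑ i, g p.1 (curvatureOf Γ p.1 (f i) b.1 c.1) (f i) =
      (LinearMap.trace ℝ E (H p.1).toLinearMap - 1) * g p.1 (H p.1 b.1) c.1)
    {ν : Type*} [Fintype ν] [DecidableEq ν] (B : Module.Basis ν ℝ (E × ℝ)) :
    ∑ i, B.coord i (fderiv ℝ (fun q ↦ coneChristoffel g Γ H τ q b c) p (B i) -
      fderiv ℝ (fun q ↦ coneChristoffel g Γ H τ q (B i) c) p b +
      coneChristoffel g Γ H τ p (B i) (coneChristoffel g Γ H τ p b c) -
      coneChristoffel g Γ H τ p b (coneChristoffel g Γ H τ p (B i) c)) = 0 := by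
  -- `T` is the tangential part of u ↦ R(u, b)c. The radial direction contributes nothing, so the
  -- endomorphism to be traced is T ⊕ 0.
  let T : E →ₗ[ℝ] E :=
    { toFun := fun u ↦ curvatureOf Γ p.1 u b.1 c.1 - g p.1 (H p.1 b.1) c.1 • H p.1 u +
        g p.1 (H p.1 u) c.1 • H p.1 b.1
      map_add' := fun u v ↦ by
        simp only [curvatureOf, map_add, add_apply]
        module
      map_smul' := fun r u ↦ by
        simp only [curvatureOf, map_smul, smul_apply, smul_eq_mul, RingHom.id_apply]
        module }
  have hT : ∀ u, T u = curvatureOf Γ p.1 u b.1 c.1 - g p.1 (H p.1 b.1) c.1 • H p.1 u +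
        g p.1 (H p.1 u) c.1 • H p.1 b.1 := fun u ↦ rfl
  have h1 : ∀ a, fderiv ℝ (fun q ↦ coneChristoffel g Γ H τ q b c) p a -
      fderiv ℝ (fun q ↦ coneChristoffel g Γ H τ q a c) p b +
      coneChristoffel g Γ H τ p a (coneChristoffel g Γ H τ p b c) -
      coneChristoffel g Γ H τ p b (coneChristoffel g Γ H τ p a c) =
      (T.prodMap (0 : ℝ →ₗ[ℝ] ℝ)) a := fun a ↦ by
    rw [curvature_coneChristoffel hg hp hH hH_parallel hH_idem hH_symm hτ hτ' hτ'']
    rfl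
  simp only [h1]
  have h2 : ∑ i, B.coord i ((T.prodMap (0 : ℝ →ₗ[ℝ] ℝ)) (B i)) =
      LinearMap.trace ℝ (E × ℝ) (T.prodMap (0 : ℝ →ₗ[ℝ] ℝ)) := by
    rw [LinearMap.trace_eq_matrix_trace ℝ B, Matrix.trace]
    refine Finset.sum_congr rfl fun i _ ↦ ?_
    rw [Matrix.diag_apply, LinearMap.toMatrix_apply]
    rfl
  rw [h2, LinearMap.trace_prodMap', map_zero, add_zero, trace_eq_sum_inner hf hκ]
  simp only [hT, map_add, map_sub, map_smul, add_apply, sub_apply, smul_apply, smul_eq_mul,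
    Finset.sum_add_distrib, Finset.sum_sub_distrib, hRic, ← Finset.mul_sum]
  rw [trace_eq_sum_inner hf hκ]
  -- The last curvature term traces to h(b, c) and the middle one to -(tr H) h(b, c). Together they
  -- cancel the Ricci curvature (tr H - 1)h of `g`.
  have h3 : ∑ i, g p.1 (H p.1 (f i)) c.1 * g p.1 (H p.1 b.1) (f i) = g p.1 (H p.1 b.1) c.1 := by
    conv_rhs => rw [← hH_idem b.1, ← sum_inner_smul hf hκ (H p.1 b.1)]
    simp [mul_comm]
  rw [h3]
  simp only [ContinuousLinearMap.coe_coe]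
  ring

end LocalCone

/-! ## Changes of coordinates -/

section ChangeOfCoordinates

variable {E : Type*} [NormedAddCommGroup E] [NormedSpace ℝ E]

section Local

variable {f : E → E} {y : E} (hf : ContDiffAt ℝ 2 f y) (hf' : Function.Surjective (fderiv ℝ f y))
  {g₀ g₁ : E → E →L[ℝ] E →L[ℝ] ℝ} (hg₀ : DifferentiableAt ℝ g₀ y)
  (hg₁ : DifferentiableAt ℝ g₁ (f y)) (hi₀ : (g₀ y).IsInvertible) (hi₁ : (g₁ (f y)).IsInvertible)
  (hsymm : ∀ u v, g₁ (f y) u v = g₁ (f y) v u)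
  (hpull : ∀ᶠ z in 𝓝 y, ∀ v w, g₀ z v w = g₁ (f z) (fderiv ℝ f z v) (fderiv ℝ f z w))
include hf hf' hg₀ hg₁ hi₀ hi₁ hsymm hpull

/-- The transformation law of the Christoffel symbols. -/
theorem christoffelMap_change (u v : E) :
    fderiv ℝ (fderiv ℝ f) y u v + christoffelMap g₁ (f y) (fderiv ℝ f y u) (fderiv ℝ f y v) =
      fderiv ℝ f y (christoffelMap g₀ y u v) := by
  have hf1 : DifferentiableAt ℝ f y := hf.differentiableAt (by norm_num)
  have hf2 : DifferentiableAt ℝ (fderiv ℝ f) y :=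
    (hf.fderiv_right (m := 1) (by norm_num)).differentiableAt (by norm_num)
  have hs : ∀ u v, fderiv ℝ (fderiv ℝ f) y u v = fderiv ℝ (fderiv ℝ f) y v u :=
    fun u v ↦ (hf.isSymmSndFDerivAt (by simp)) u v
  -- Derivative of the pullback identity. In the Koszul combination the second derivatives of `f`
  -- survive only as the inhomogeneous term f''(u, v).
  have hD : ∀ u v w, fderiv ℝ g₀ y u v w =
      fderiv ℝ g₁ (f y) (fderiv ℝ f y u) (fderiv ℝ f y v) (fderiv ℝ f y w) +
      g₁ (f y) (fderiv ℝ (fderiv ℝ f) y u v) (fderiv ℝ f y w) +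
      g₁ (f y) (fderiv ℝ f y v) (fderiv ℝ (fderiv ℝ f) y u w) := by
    intro u v w
    have h1 := ((hg₀.hasFDerivAt.clm_apply (hasFDerivAt_const v y)).clm_apply
      (hasFDerivAt_const w y)).fderiv
    have hfv := fun v ↦ hf2.hasFDerivAt.clm_apply (hasFDerivAt_const v y)
    have h2 := (((hg₁.hasFDerivAt.comp y hf1.hasFDerivAt).clm_apply (hfv v)).clm_apply
      (hfv w)).fderiv
    have h3 : (fun z ↦ g₀ z v w) =ᶠ[𝓝 y] fun z ↦ (g₁ ∘ f) z (fderiv ℝ f z v) (fderiv ℝ f z w) := by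
      filter_upwards [hpull] with z hz using hz v w
    rw [h3.fderiv_eq, h2] at h1
    have h4 := congrArg (fun L ↦ L u) h1
    simp only [add_apply, ContinuousLinearMap.comp_apply, ContinuousLinearMap.flip_apply, zero_apply,
      map_zero, zero_add, Function.comp_apply] at h4
    rw [← h4]
    ring
  have hpy := hpull.self_of_nhds
  apply hi₁.injective
  refine ContinuousLinearMap.ext fun w' ↦ ?_
  obtain ⟨w, rfl⟩ := hf' w'
  rw [← hpy, inner_christoffelMap hi₀, map_add, add_apply, inner_christoffelMap hi₁, hD, hD, hD,
    hs w u, hs w v, hs v u, hsymm (fderiv ℝ f y v), hsymm (fderiv ℝ f y u)]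
  ring

/-- The covariant derivative is compatible with changes of coordinates. -/
theorem covDeriv_change {Y₀ Y₁ : E → E} (hY₀ : DifferentiableAt ℝ Y₀ y)
    (hY₁ : DifferentiableAt ℝ Y₁ (f y)) (hY : ∀ᶠ z in 𝓝 y, fderiv ℝ f z (Y₀ z) = Y₁ (f z)) (u : E) :
    covDeriv (christoffelMap g₁) Y₁ (f y) (fderiv ℝ f y u) =
      fderiv ℝ f y (covDeriv (christoffelMap g₀) Y₀ y u) := by
  have hf1 : DifferentiableAt ℝ f y := hf.differentiableAt (by norm_num)
  have hf2 : DifferentiableAt ℝ (fderiv ℝ f) y :=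
    (hf.fderiv_right (m := 1) (by norm_num)).differentiableAt (by norm_num)
  have h1 := (hf2.hasFDerivAt.clm_apply hY₀.hasFDerivAt).fderiv
  have h2 : (fun z ↦ fderiv ℝ f z (Y₀ z)) =ᶠ[𝓝 y] Y₁ ∘ f := hY
  rw [h2.fderiv_eq, (hY₁.hasFDerivAt.comp y hf1.hasFDerivAt).fderiv] at h1
  have h3 := congrArg (fun L ↦ L u) h1
  simp only [add_apply, ContinuousLinearMap.comp_apply, ContinuousLinearMap.flip_apply] at h3
  rw [covDeriv, covDeriv, h3, ← hY.self_of_nhds, map_add,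
    ← christoffelMap_change hf hf' hg₀ hg₁ hi₀ hi₁ hsymm hpull]
  abel

end Local

end ChangeOfCoordinates

/-! ## Tensors and connections in charts -/

section Charts

variable {n : ℕ} {M : Type*} [TopologicalSpace M] [ChartedSpace (Eu n) M]

variable (n) in
/-- The derivative of the inverse of the chart around `x₀`, as a map from `ℝⁿ` to
`T_x M = ℝⁿ`. -/
def chartDeriv (x₀ : M) (z : Eu n) : Eu n →L[ℝ] Eu n :=
  mfderiv 𝓘(ℝ, Eu n) (𝓡 n) (extChartAt (𝓡 n) x₀).symm z

/-- A `2`-tensor at `x` as a bilinear form on `ℝⁿ`. -/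
def tensorAt (G : TwoTensor (𝓡 n) M) (x : M) : Eu n →L[ℝ] Eu n →L[ℝ] ℝ := G x

/-- The value of a vector field at `x` as a vector in `ℝⁿ`. -/
def vecAt (Y : ∀ x : M, TangentSpace (𝓡 n) x) (x : M) : Eu n := Y x

variable (n) in
/-- The vector field `Y` in the chart around `x₀`. -/
def chartField (Y : ∀ x : M, TangentSpace (𝓡 n) x) (x₀ : M) : Eu n → Eu n :=
  VectorField.mpullback 𝓘(ℝ, Eu n) (𝓡 n) (extChartAt (𝓡 n) x₀).symm Y

/-- The field of endomorphisms `P` in the chart around `x₀`. -/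
def chartEndo (P : ∀ x : M, TangentSpace (𝓡 n) x →L[ℝ] TangentSpace (𝓡 n) x) (x₀ : M) (z : Eu n) :
    Eu n →L[ℝ] Eu n :=
  let P' : Eu n →L[ℝ] Eu n := P ((extChartAt (𝓡 n) x₀).symm z)
  (chartDeriv n x₀ z).inverse ∘L P' ∘L chartDeriv n x₀ z

theorem chartTensor_apply (G : TwoTensor (𝓡 n) M) (x₀ : M) (z u v : Eu n) :
    chartTensor G x₀ z u v = tensorAt G ((extChartAt (𝓡 n) x₀).symm z) (chartDeriv n x₀ z u)
      (chartDeriv n x₀ z v) := rfl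

theorem chartField_apply (Y : ∀ x : M, TangentSpace (𝓡 n) x) (x₀ : M) (z : Eu n) :
    chartField n Y x₀ z =
      (chartDeriv n x₀ z).inverse (vecAt Y ((extChartAt (𝓡 n) x₀).symm z)) := rfl

variable [IsManifold (𝓡 n) ∞ M]

theorem contMDiffAt_extChartAt_symm {x₀ : M} {z : Eu n} (hz : z ∈ (extChartAt (𝓡 n) x₀).target) :
    ContMDiffAt 𝓘(ℝ, Eu n) (𝓡 n) ∞ (extChartAt (𝓡 n) x₀).symm z :=
  (contMDiffOn_extChartAt_symm x₀).contMDiffAt ((isOpen_extChartAt_target x₀).mem_nhds hz)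

theorem isInvertible_chartDeriv {x₀ : M} {z : Eu n} (hz : z ∈ (extChartAt (𝓡 n) x₀).target) :
    (chartDeriv n x₀ z).IsInvertible := by
  have := isInvertible_mfderivWithin_extChartAt_symm (I := 𝓡 n) hz
  rw [ModelWithCorners.range_eq_univ, mfderivWithin_univ] at this
  exact this

theorem chartDeriv_self (x : M) :
    chartDeriv n x (extChartAt (𝓡 n) x x) = ContinuousLinearMap.id ℝ (Eu n) := by
  have := mfderivWithin_range_extChartAt_symm (I := 𝓡 n) (x := x)
  rw [ModelWithCorners.range_eq_univ, mfderivWithin_univ] at this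
  exact this

theorem contDiffAt_transition {x₀ x₁ : M} {z : Eu n} (hz : z ∈ (extChartAt (𝓡 n) x₀).target)
    (hz' : (extChartAt (𝓡 n) x₀).symm z ∈ (extChartAt (𝓡 n) x₁).source) :
    ContDiffAt ℝ ∞ (extChartAt (𝓡 n) x₁ ∘ (extChartAt (𝓡 n) x₀).symm) z := by
  rw [← contMDiffAt_iff_contDiffAt]
  refine ContMDiffAt.comp z ?_ (contMDiffAt_extChartAt_symm hz)
  exact contMDiffAt_extChartAt' (by simpa using hz')

theorem chartDeriv_comp_transition {x₀ x₁ : M} {z : Eu n}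
    (hz : z ∈ (extChartAt (𝓡 n) x₀).target)
    (hz' : (extChartAt (𝓡 n) x₀).symm z ∈ (extChartAt (𝓡 n) x₁).source) :
    chartDeriv n x₁ (extChartAt (𝓡 n) x₁ ((extChartAt (𝓡 n) x₀).symm z)) ∘L
      fderiv ℝ (extChartAt (𝓡 n) x₁ ∘ (extChartAt (𝓡 n) x₀).symm) z = chartDeriv n x₀ z := by
  have h1 : (extChartAt (𝓡 n) x₁).symm ∘ (extChartAt (𝓡 n) x₁ ∘ (extChartAt (𝓡 n) x₀).symm)
      =ᶠ[𝓝 z] (extChartAt (𝓡 n) x₀).symm := by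
    have h2 : (extChartAt (𝓡 n) x₀).symm ⁻¹' (extChartAt (𝓡 n) x₁).source ∈ 𝓝 z :=
      (contMDiffAt_extChartAt_symm hz).continuousAt.preimage_mem_nhds
        ((isOpen_extChartAt_source x₁).mem_nhds hz')
    filter_upwards [h2] with w hw
    exact (extChartAt (𝓡 n) x₁).left_inv hw
  have h3 := h1.mfderiv_eq (I := 𝓘(ℝ, Eu n)) (I' := 𝓡 n)
  rw [mfderiv_comp z (I' := 𝓘(ℝ, Eu n)), mfderiv_eq_fderiv] at h3
  · exact h3
  · exact (contMDiffAt_extChartAt_symm ((extChartAt (𝓡 n) x₁).map_source hz')).mdifferentiableAt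
      (by simp)
  · exact ((contDiffAt_transition hz hz').differentiableAt (by simp)).mdifferentiableAt

theorem contDiffAt_chartField {Y : ∀ x : M, TangentSpace (𝓡 n) x} {x₀ : M} {z : Eu n}
    (hz : z ∈ (extChartAt (𝓡 n) x₀).target)
    (hY : ContMDiffAt (𝓡 n) (𝓡 n).tangent ∞ (fun x ↦ (Y x : TangentBundle (𝓡 n) M))
      ((extChartAt (𝓡 n) x₀).symm z)) : ContDiffAt ℝ ∞ (chartField n Y x₀) z :=
  contMDiffAt_vectorSpace_iff_contDiffAt.1 (ContMDiffAt.mpullback_vectorField_preimage hY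
    (contMDiffAt_extChartAt_symm hz) (isInvertible_chartDeriv hz) (by simp))

/-- The coordinate fields of the chart are the tangent map of the inverse chart applied to constant
fields, hence smooth. Evaluating the metric on them makes its chart expression smooth. -/
theorem contMDiffAt_chartDeriv {x₀ : M} {z : Eu n} (hz : z ∈ (extChartAt (𝓡 n) x₀).target)
    (u : Eu n) : ContMDiffAt 𝓘(ℝ, Eu n) (𝓡 n).tangent ∞ (fun w ↦ Bundle.TotalSpace.mk' (Eu n)
      (E := TangentSpace (𝓡 n)) ((extChartAt (𝓡 n) x₀).symm w) (chartDeriv n x₀ w u)) z := by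
  have hopen := isOpen_extChartAt_target (I := 𝓡 n) x₀
  have h1 := (contMDiffOn_extChartAt_symm (I := 𝓡 n) (n := ∞) x₀).contMDiffOn_tangentMapWithin
    (m := ∞) (by simp) hopen.uniqueMDiffOn
  let s : Eu n → TangentBundle 𝓘(ℝ, Eu n) (Eu n) := fun w ↦ ⟨w, u⟩
  have hs : ContMDiffAt 𝓘(ℝ, Eu n) 𝓘(ℝ, Eu n).tangent ∞ s z :=
    contMDiffAt_vectorSpace_iff_contDiffAt.2 contDiffAt_const
  have h2 := (h1.contMDiffAt (x := s z) ((hopen.preimage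
    (FiberBundle.continuous_proj (Eu n) (TangentSpace 𝓘(ℝ, Eu n)))).mem_nhds hz)).comp z hs
  refine h2.congr_of_eventuallyEq ?_
  filter_upwards [hopen.mem_nhds hz] with w hw
  simp only [Function.comp_apply, tangentMapWithin, s]
  rw [mfderivWithin_of_isOpen hopen hw]
  rfl

theorem contDiffOn_chartTensor (g : RiemMetric n M) (x₀ : M) :
    ContDiffOn ℝ ∞ (chartTensor g.inner x₀) (extChartAt (𝓡 n) x₀).target := by
  rw [contDiffOn_clm_apply]
  intro u
  rw [contDiffOn_clm_apply]
  intro v z hz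
  refine ContDiffAt.contDiffWithinAt ?_
  rw [← contMDiffAt_iff_contDiffAt]
  have hg := (g.contMDiff ((extChartAt (𝓡 n) x₀).symm z)).comp z (contMDiffAt_extChartAt_symm hz)
  have h : ContMDiffAt 𝓘(ℝ, Eu n) ((𝓡 n).prod 𝓘(ℝ)) ∞ (fun w ↦ Bundle.TotalSpace.mk' ℝ
      (E := Bundle.Trivial M ℝ) ((extChartAt (𝓡 n) x₀).symm w)
      (g.inner ((extChartAt (𝓡 n) x₀).symm w) (chartDeriv n x₀ w u) (chartDeriv n x₀ w v))) z := by
    apply ContMDiffAt.clm_bundle_apply₂ (F₁ := Eu n) (F₂ := Eu n)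
    · exact hg
    · exact contMDiffAt_chartDeriv hz u
    · exact contMDiffAt_chartDeriv hz v
  rw [Bundle.contMDiffAt_totalSpace] at h
  exact h.2

theorem isLeviCivitaOn_chart (g : RiemMetric n M) (x₀ : M) :
    IsLeviCivitaOn (chartTensor g.inner x₀) (christoffelMap (chartTensor g.inner x₀))
      (extChartAt (𝓡 n) x₀).target := by
  refine isLeviCivitaOn_christoffelMap (isOpen_extChartAt_target x₀)
    ((contDiffOn_chartTensor g x₀).of_le (by norm_cast))
    (fun z _ u v ↦ g.symm _ _ _) fun z hz u hu ↦ g.pos _ _ fun h ↦ hu ?_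
  exact (isInvertible_chartDeriv hz).injective (h.trans (map_zero (chartDeriv n x₀ z)).symm)

/-- The Levi-Civita connection at `x` in the chart around `x₀`. -/
theorem leviCivita_chart (g : RiemMetric n M) {Y : ∀ x : M, TangentSpace (𝓡 n) x} {x₀ : M} {z : Eu n}
    (hz : z ∈ (extChartAt (𝓡 n) x₀).target)
    (hY : ContMDiffAt (𝓡 n) (𝓡 n).tangent ∞ (fun x ↦ (Y x : TangentBundle (𝓡 n) M))
      ((extChartAt (𝓡 n) x₀).symm z)) (u : Eu n) :
    leviCivita g.inner Y ((extChartAt (𝓡 n) x₀).symm z) (chartDeriv n x₀ z u) =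
      chartDeriv n x₀ z (covDeriv (christoffelMap (chartTensor g.inner x₀)) (chartField n Y x₀) z u) := by
  set x₁ := (extChartAt (𝓡 n) x₀).symm z with hx₁
  set f := extChartAt (𝓡 n) x₁ ∘ (extChartAt (𝓡 n) x₀).symm with hf
  have hz' : (extChartAt (𝓡 n) x₀).symm z ∈ (extChartAt (𝓡 n) x₁).source :=
    mem_extChartAt_source x₁
  have hev : ∀ᶠ w in 𝓝 z, w ∈ (extChartAt (𝓡 n) x₀).target ∧
      (extChartAt (𝓡 n) x₀).symm w ∈ (extChartAt (𝓡 n) x₁).source :=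
    Filter.Eventually.and ((isOpen_extChartAt_target x₀).mem_nhds hz)
      ((contMDiffAt_extChartAt_symm hz).continuousAt.preimage_mem_nhds
        ((isOpen_extChartAt_source x₁).mem_nhds hz'))
  have hfz : f z = extChartAt (𝓡 n) x₁ x₁ := rfl
  have hft : f z ∈ (extChartAt (𝓡 n) x₁).target := mem_extChartAt_target x₁
  have hfs : (extChartAt (𝓡 n) x₁).symm (f z) = x₁ := extChartAt_to_inv x₁
  -- At the centre of its own chart `chartDeriv` is the identity, so the derivative of the
  -- transition map into the chart at `x₁` is `chartDeriv n x₀ z` itself.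
  have hcomp : fderiv ℝ f z = chartDeriv n x₀ z := by
    have := chartDeriv_comp_transition hz hz'
    rw [chartDeriv_self] at this
    exact this
  have h0 := isLeviCivitaOn_chart g x₀
  have h1 := isLeviCivitaOn_chart g x₁
  -- By definition `leviCivita` at `x₁` is computed in the preferred chart of `x₁`;
  -- `covDeriv_change` carries it to the chart around `x₀`.
  change covDeriv (christoffelMap (chartTensor g.inner x₁)) (chartField n Y x₁)
    (extChartAt (𝓡 n) x₁ x₁) (chartDeriv n x₀ z u) = _
  rw [← hcomp, ← hfz]
  refine covDeriv_change ((contDiffAt_transition hz hz').of_le (by norm_cast)) ?_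
    (h0.differentiableAt_metric z hz) (h1.differentiableAt_metric _ hft)
    (isInvertible_of_pos (h0.metric_pos z hz)) (isInvertible_of_pos (h1.metric_pos _ hft))
    (h1.metric_symm _ hft) ?_ ((contDiffAt_chartField hz hY).differentiableAt (by simp))
    ((contDiffAt_chartField hft (by rw [hfs]; exact hY)).differentiableAt (by simp)) ?_ u
  · rw [hcomp]
    exact (isInvertible_chartDeriv hz).surjective
  · filter_upwards [hev] with w hw v v'
    rw [chartTensor_apply, chartTensor_apply, ← chartDeriv_comp_transition hw.1 hw.2]
    have : (extChartAt (𝓡 n) x₁).symm (f w) = (extChartAt (𝓡 n) x₀).symm w :=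
      (extChartAt (𝓡 n) x₁).left_inv hw.2
    rw [this]
    rfl
  · filter_upwards [hev] with w hw
    have h2 : (extChartAt (𝓡 n) x₁).symm (f w) = (extChartAt (𝓡 n) x₀).symm w :=
      (extChartAt (𝓡 n) x₁).left_inv hw.2
    have h3 := (isInvertible_chartDeriv ((extChartAt (𝓡 n) x₁).map_source hw.2)).injective
    apply h3
    have h4 : ∀ v, chartDeriv n x₁ (extChartAt (𝓡 n) x₁ ((extChartAt (𝓡 n) x₀).symm w))
        (fderiv ℝ f w v) = chartDeriv n x₀ w v := fun v ↦ by
      rw [← chartDeriv_comp_transition hw.1 hw.2]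
      rfl
    rw [h4, chartField_apply, chartField_apply, (isInvertible_chartDeriv hw.1).self_apply_inverse, h2]
    exact ((isInvertible_chartDeriv ((extChartAt (𝓡 n) x₁).map_source hw.2)).self_apply_inverse _).symm

end Charts

/-! ## Orthogonal projections -/

section OrthogonalProjection

variable {E : Type*} [NormedAddCommGroup E] [NormedSpace ℝ E]

/-- `P` is the orthogonal projection along `W` for the inner product `b`. -/
structure IsProjAlong (b : E →L[ℝ] E →L[ℝ] ℝ) (W : Submodule ℝ E) (P : E →L[ℝ] E) : Prop where
  idem : ∀ v, P (P v) = P v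
  symm : ∀ v w, b (P v) w = b v (P w)
  ker : ∀ v, P v = 0 ↔ v ∈ W

variable {b : E →L[ℝ] E →L[ℝ] ℝ} {W : Submodule ℝ E} {P : E →L[ℝ] E}

theorem IsProjAlong.sub_mem (h : IsProjAlong b W P) (v : E) : v - P v ∈ W := by
  rw [← h.ker, map_sub, h.idem, sub_self]

theorem IsProjAlong.apply_apply_eq_zero (h : IsProjAlong b W P) (v : E) {w : E} (hw : w ∈ W) :
    b (P v) w = 0 := by
  rw [h.symm, (h.ker w).2 hw, map_zero]

/-- The double orthogonal complement of W for a definite form is W. -/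
theorem mem_of_forall_orthogonal [FiniteDimensional ℝ E] (hsymm : ∀ u v, b u v = b v u)
    (hpos : ∀ u, u ≠ 0 → 0 < b u u) {u : E}
    (hu : ∀ w, (∀ w' ∈ W, b w w' = 0) → b u w = 0) : u ∈ W := by
  let B : LinearMap.BilinForm ℝ E := LinearMap.mk₂ ℝ (fun u v ↦ b u v) (by simp) (by simp) (by simp)
    (by simp)
  have hB : ∀ u v, B u v = b u v := fun _ _ ↦ rfl
  have hrefl : B.IsRefl := fun u v h ↦ by rwa [hB, hsymm, ← hB]
  have hnd : B.Nondegenerate := by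
    refine (LinearMap.IsRefl.nondegenerate_iff_separatingLeft hrefl).2 fun u h ↦ ?_
    by_contra hne
    exact (hpos u hne).ne' (h u)
  rw [← LinearMap.BilinForm.orthogonal_orthogonal hnd hrefl W]
  intro w hw
  change B w u = 0
  rw [hB, hsymm]
  refine hu w fun w' hw' ↦ ?_
  rw [hsymm]
  exact hw w' hw'

/-- `h2` says that `v - P v` is orthogonal to W^⊥, so it lies in W. Definiteness then gives
idempotence and the kernel, while symmetry follows from the two orthogonality relations. -/
theorem IsProjAlong.of_orthCompl [FiniteDimensional ℝ E] (hsymm : ∀ u v, b u v = b v u)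
    (hpos : ∀ u, u ≠ 0 → 0 < b u u) (h1 : ∀ v, ∀ w ∈ W, b (P v) w = 0)
    (h2 : ∀ v w, (∀ w' ∈ W, b w w' = 0) → b (v - P v) w = 0) : IsProjAlong b W P := by
  have h0 : ∀ u, b u u = 0 → u = 0 := fun u hu ↦ by
    by_contra hne
    exact (hpos u hne).ne' hu
  have hmem : ∀ v, v - P v ∈ W := fun v ↦ mem_of_forall_orthogonal hsymm hpos (h2 v)
  refine ⟨fun v ↦ ?_, fun v w ↦ ?_, fun v ↦ ⟨fun h ↦ ?_, fun h ↦ ?_⟩⟩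
  · refine (sub_eq_zero.1 (h0 _ (h2 (P v) (P v - P (P v)) fun w hw ↦ ?_))).symm
    rw [map_sub, sub_apply, h1 _ w hw, h1 _ w hw, sub_zero]
  · have e1 := h2 w (P v) (h1 v)
    have e2 := h2 v (P w) (h1 w)
    rw [map_sub, sub_apply] at e1 e2
    rw [hsymm (P v) w, sub_eq_zero.1 e1, sub_eq_zero.1 e2, hsymm]
  · simpa [h] using hmem v
  · refine h0 _ (h1 v _ ?_)
    simpa using W.sub_mem h (hmem v)

end OrthogonalProjection

/-! ## Clifford multiplication and the spinorial connection in charts -/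

section CliffordMultiplication

variable {n : ℕ} {S : Type*} [NormedAddCommGroup S] [InnerProductSpace ℂ S] [FiniteDimensional ℂ S]

/-- Clifford multiplication by the members of the standard basis. -/
def cliffGen (ρ : Cl n →ₐ[ℝ] Module.End ℂ S) (i : Fin n) : S →L[ℝ] S :=
  haveI : FiniteDimensional ℝ S := FiniteDimensional.complexToReal S
  LinearMap.toContinuousLinearMap
    ((ρ (CliffordAlgebra.ι (negSq n) (EuclideanSpace.single i 1))).restrictScalars ℝ)

theorem cliffGen_apply (ρ : Cl n →ₐ[ℝ] Module.End ℂ S) (i : Fin n) (s : S) :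
    cliffGen ρ i s = cliffMul ρ (EuclideanSpace.single i 1) s := rfl

theorem isCliffordFamily_cliffGen (ρ : Cl n →ₐ[ℝ] Module.End ℂ S) :
    IsCliffordFamily (cliffGen ρ) := by
  intro i j
  ext s
  have h := CliffordAlgebra.ι_mul_ι_add_swap (Q := negSq n) (EuclideanSpace.single i (1 : ℝ))
    (EuclideanSpace.single j 1)
  have h2 := congrArg (fun a ↦ ρ a s) h
  have h3 : QuadraticMap.polar (negSq n) (EuclideanSpace.single i (1 : ℝ))
      (EuclideanSpace.single j 1) = if i = j then -2 else 0 := by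
    rw [QuadraticMap.polar]
    simp only [negSq, neg_apply, LinearMap.BilinMap.toQuadraticMap_apply, innerₗ_apply_apply,
      inner_add_left, inner_add_right]
    by_cases hij : i = j
    · subst hij
      simp
      norm_num
    · simp [EuclideanSpace.inner_single_left, hij, Ne.symm hij]
  rw [h3] at h2
  simp only [map_add, map_mul, AlgHom.commutes] at h2
  simp only [add_apply, mul_apply_eq_comp, cliffGen_apply, cliffMul]
  refine Eq.trans h2 ?_
  split_ifs <;> simp [Algebra.algebraMap_eq_smul_one]

theorem inner_cliffGen {ρ : Cl n →ₐ[ℝ] Module.End ℂ S} (hρ : IsSpinorRep ρ) (i : Fin n) (s t : S) :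
    letI := InnerProductSpace.complexToReal (G := S)
    inner ℝ (cliffGen ρ i s) t = -inner ℝ s (cliffGen ρ i t) := by
  have h := hρ.skew (EuclideanSpace.single i 1) s t
  have h2 := congrArg Complex.re h
  rw [Complex.neg_re] at h2
  exact h2

theorem cliffMul_eq_linElem (ρ : Cl n →ₐ[ℝ] Module.End ℂ S) (v : Eu n) (s : S) :
    cliffMul ρ v s = linElem (cliffGen ρ) (fun i ↦ v i) s := by
  have hv : v = ∑ i, v i • EuclideanSpace.single i (1 : ℝ) := by
    ext j
    simp [Pi.single_apply]
  conv_lhs => rw [hv]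
  simp [cliffMul, linElem, sum_apply, cliffGen_apply, map_sum, LinearMap.sum_apply]

end CliffordMultiplication

/-! ### Spinor fields and the Killing equation in a fixed chart and frame. -/

section SpinorCharts

variable {n : ℕ} {M : Type*} [TopologicalSpace M] [ChartedSpace (Eu n) M] [IsManifold (𝓡 n) ∞ M]
  {g : RiemMetric n M} {ι : Type*} {σ : SpinStructure ι g}
  {S : Type*} [NormedAddCommGroup S] [InnerProductSpace ℂ S]
  {ρ : Cl n →ₐ[ℝ] Module.End ℂ S}

theorem vanishesAt_iff (ψ : SpinorField σ ρ) {a : ι} {x : M} (hx : x ∈ σ.U a) :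
    ψ.VanishesAt x ↔ ψ.toFun a x = 0 := by
  rw [SpinorField.VanishesAt]
  constructor
  · intro h
    rw [ψ.compat a _ x ⟨hx, σ.mem_U x⟩, h, map_zero]
  · intro h
    rw [ψ.compat _ a x ⟨σ.mem_U x, hx⟩, h, map_zero]

/-- The part of the chart domain around `x₀` that lies over `U`. -/
def chartSet (n : ℕ) {M : Type*} [TopologicalSpace M] [ChartedSpace (Eu n) M] (x₀ : M) (U : Set M) :
    Set (Eu n) :=
  (extChartAt (𝓡 n) x₀).target ∩ (extChartAt (𝓡 n) x₀).symm ⁻¹' U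

omit [IsManifold (𝓡 n) ∞ M] in
theorem isOpen_chartSet (x₀ : M) {U : Set M} (hU : IsOpen U) : IsOpen (chartSet n x₀ U) :=
  (continuousOn_extChartAt_symm x₀).isOpen_inter_preimage (isOpen_extChartAt_target x₀) hU

omit [IsManifold (𝓡 n) ∞ M] in
theorem mem_chartSet {x₀ : M} {U : Set M} (hx₀ : x₀ ∈ U) : extChartAt (𝓡 n) x₀ x₀ ∈ chartSet n x₀ U :=
  ⟨mem_extChartAt_target x₀, by rwa [mem_preimage, extChartAt_to_inv]⟩

theorem IsLeviCivitaOn.mono {E : Type*} [NormedAddCommGroup E] [NormedSpace ℝ E]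
    {g : E → E →L[ℝ] E →L[ℝ] ℝ} {Γ : E → E →L[ℝ] E →L[ℝ] E} {V W : Set E}
    (h : IsLeviCivitaOn g Γ V) (hWV : W ⊆ V) (hW : IsOpen W) : IsLeviCivitaOn g Γ W :=
  ⟨hW, fun z hz ↦ h.metric_symm z (hWV hz), fun z hz ↦ h.metric_pos z (hWV hz),
    fun z hz ↦ h.differentiableAt_metric z (hWV hz), fun z hz ↦ h.differentiableAt z (hWV hz),
    fun z hz ↦ h.symm z (hWV hz), fun z hz ↦ h.compat z (hWV hz)⟩

/-- The members of the frame `a` in the chart around `x₀`. -/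
def chartFrame (σ : SpinStructure ι g) (a : ι) (x₀ : M) (i : Fin n) : Eu n → Eu n :=
  chartField n (σ.frame a i) x₀

/-- A spinor field in the frame `a` and the chart around `x₀`. -/
def chartSpinor (ψ : SpinorField σ ρ) (a : ι) (x₀ : M) (z : Eu n) : S :=
  ψ.toFun a ((extChartAt (𝓡 n) x₀).symm z)

theorem chartDeriv_chartField (Y : ∀ x : M, TangentSpace (𝓡 n) x) {x₀ : M} {z : Eu n}
    (hz : z ∈ (extChartAt (𝓡 n) x₀).target) :
    chartDeriv n x₀ z (chartField n Y x₀ z) = vecAt Y ((extChartAt (𝓡 n) x₀).symm z) := by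
  rw [chartField_apply, (isInvertible_chartDeriv hz).self_apply_inverse]

theorem isOrthonormalFrameOn_chartFrame (σ : SpinStructure ι g) (a : ι) (x₀ : M) :
    IsOrthonormalFrameOn (chartTensor g.inner x₀) (chartFrame σ a x₀) (chartSet n x₀ (σ.U a)) where
  contDiffAt i z hz := (contDiffAt_chartField hz.1 ((σ.smooth_frame a i).contMDiffAt
    ((σ.isOpen_U a).mem_nhds hz.2))).of_le (by norm_cast)
  orthonormal z hz i j := by
    rw [chartTensor_apply, chartFrame, chartFrame, chartDeriv_chartField _ hz.1,
      chartDeriv_chartField _ hz.1]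
    exact σ.orthonormal_frame a _ hz.2 i j
  card_eq := by simp

theorem contDiffAt_chartSpinor (ψ : SpinorField σ ρ) {a : ι} {x₀ : M} {z : Eu n}
    (hz : z ∈ chartSet n x₀ (σ.U a)) : ContDiffAt ℝ ∞ (chartSpinor ψ a x₀) z := by
  rw [← contMDiffAt_iff_contDiffAt]
  exact ((ψ.smooth a).contMDiffAt ((σ.isOpen_U a).mem_nhds hz.2)).comp z
    (contMDiffAt_extChartAt_symm hz.1)

theorem fderiv_chartSpinor (ψ : SpinorField σ ρ) {a : ι} {x₀ : M} {z : Eu n}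
    (hz : z ∈ chartSet n x₀ (σ.U a)) (u : Eu n) : fderiv ℝ (chartSpinor ψ a x₀) z u =
      mfderiv (𝓡 n) 𝓘(ℝ, S) (ψ.toFun a) ((extChartAt (𝓡 n) x₀).symm z) (chartDeriv n x₀ z u) := by
  have h1 : MDifferentiableAt (𝓡 n) 𝓘(ℝ, S) (ψ.toFun a) ((extChartAt (𝓡 n) x₀).symm z) :=
    ((ψ.smooth a).contMDiffAt ((σ.isOpen_U a).mem_nhds hz.2)).mdifferentiableAt (by simp)
  have h2 := mfderiv_comp z h1 ((contMDiffAt_extChartAt_symm hz.1).mdifferentiableAt (by simp))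
  rw [mfderiv_eq_fderiv] at h2
  exact congrArg (fun L ↦ L u) h2

variable [FiniteDimensional ℂ S]

theorem clifford_chart (σ : SpinStructure ι g) (ρ : Cl n →ₐ[ℝ] Module.End ℂ S) (a : ι) {x₀ : M}
    {z : Eu n} (hz : z ∈ (extChartAt (𝓡 n) x₀).target) (X : Eu n) (s : S) :
    SpinorField.clifford σ ρ a ((extChartAt (𝓡 n) x₀).symm z) (chartDeriv n x₀ z X) s =
      linElem (cliffGen ρ) (frameCoeff (chartTensor g.inner x₀) (chartFrame σ a x₀) z X) s := by
  refine (cliffMul_eq_linElem ρ _ s).trans ?_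
  congr 2
  funext i
  rw [frameCoeff, chartTensor_apply, chartFrame, chartDeriv_chartField _ hz]
  rfl

theorem clifford_frame (σ : SpinStructure ι g) (ρ : Cl n →ₐ[ℝ] Module.End ℂ S) {a : ι} {x : M}
    (hx : x ∈ σ.U a) (i : Fin n) (s : S) :
    SpinorField.clifford σ ρ a x (σ.frame a i x) s = cliffGen ρ i s := by
  rw [SpinorField.clifford, cliffGen_apply]
  congr 1
  ext j
  simp [frameCoords, σ.orthonormal_frame a x hx, eq_comm]

/-- The spinorial Levi-Civita connection in the chart around `x₀`. -/
theorem nabla_chart (ψ : SpinorField σ ρ) {a : ι} {x₀ : M} {z : Eu n}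
    (hz : z ∈ chartSet n x₀ (σ.U a)) (u : Eu n) :
    ψ.nabla a ((extChartAt (𝓡 n) x₀).symm z) (chartDeriv n x₀ z u) =
      fderiv ℝ (chartSpinor ψ a x₀) z u + (1 / 4 : ℝ) •
        quadElem (cliffGen ρ) (connForm (chartTensor g.inner x₀)
          (christoffelMap (chartTensor g.inner x₀)) (chartFrame σ a x₀) z u) (chartSpinor ψ a x₀ z) := by
  rw [fderiv_chartSpinor ψ hz]
  refine congrArg₂ (· + ·) rfl (congrArg ((1 / 4 : ℝ) • ·) ?_)
  simp only [quadElem, sum_apply, smul_apply, mul_apply_eq_comp]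
  refine Finset.sum_congr rfl fun i _ ↦ Finset.sum_congr rfl fun j _ ↦ ?_
  rw [clifford_frame σ ρ hz.2, clifford_frame σ ρ hz.2]
  congr 1
  rw [leviCivita_chart g hz.1 ((σ.smooth_frame a i).contMDiffAt ((σ.isOpen_U a).mem_nhds hz.2)),
    connForm, chartTensor_apply]
  rw [chartFrame, chartFrame, chartDeriv_chartField _ hz.1]
  rfl

theorem chartDeriv_chartEndo (P : ∀ x : M, TangentSpace (𝓡 n) x →L[ℝ] TangentSpace (𝓡 n) x)
    {x₀ : M} {z : Eu n} (hz : z ∈ (extChartAt (𝓡 n) x₀).target) (u : Eu n) :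
    chartDeriv n x₀ z (chartEndo P x₀ z u) =
      (P ((extChartAt (𝓡 n) x₀).symm z) (chartDeriv n x₀ z u) : Eu n) :=
  (isInvertible_chartDeriv hz).self_apply_inverse _

/-- The equation of a `T`-Killing spinor in the chart around `x₀`. -/
theorem fderiv_chartSpinor_of_isTKilling {ψ : SpinorField σ ρ} (hψ : ψ.IsTKilling) {a : ι} {x₀ : M}
    {z : Eu n} (hz : z ∈ chartSet n x₀ (σ.U a)) (hne : chartSpinor ψ a x₀ z ≠ 0) (u : Eu n) :
    fderiv ℝ (chartSpinor ψ a x₀) z u =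
      -killingForm (cliffGen ρ) (chartTensor g.inner x₀) (christoffelMap (chartTensor g.inner x₀))
        (chartFrame σ a x₀) (chartEndo (fun x ↦ (2 : ℝ) • ψ.emEndo x) x₀) u z
        (chartSpinor ψ a x₀ z) := by
  set x := (extChartAt (𝓡 n) x₀).symm z with hx
  have h1 := hψ.1 a x hz.2 (fun h ↦ hne ((vanishesAt_iff ψ hz.2).1 h)) (chartDeriv n x₀ z u)
  have h2 : SpinorField.clifford σ ρ a x (ψ.emEndo x (chartDeriv n x₀ z u)) (ψ.toFun a x) =
      (1 / 2 : ℝ) • linElem (cliffGen ρ) (frameCoeff (chartTensor g.inner x₀) (chartFrame σ a x₀) z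
        (chartEndo (fun x ↦ (2 : ℝ) • ψ.emEndo x) x₀ z u)) (chartSpinor ψ a x₀ z) := by
    have h3 := clifford_chart σ ρ a hz.1 (chartEndo (fun x ↦ (2 : ℝ) • ψ.emEndo x) x₀ z u)
      (chartSpinor ψ a x₀ z)
    rw [chartDeriv_chartEndo _ hz.1] at h3
    rw [← h3]
    have h4 := SpinorField.clifford_smul_left (σ := σ) (ρ := ρ) a x (2 : ℝ)
      (ψ.emEndo x (chartDeriv n x₀ z u)) (ψ.toFun a x)
    refine Eq.trans ?_ (congrArg ((1 / 2 : ℝ) • ·) h4.symm)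
    simp only [smul_smul]
    norm_num
  rw [h2, nabla_chart ψ hz] at h1
  rw [eq_sub_of_add_eq h1, killingForm]
  simp only [add_apply, smul_apply]
  abel

/-- Locally, the length of a `T`-Killing spinor is constant. -/
theorem eventually_vanishesAt_iff (hρ : IsSpinorRep ρ) {ψ : SpinorField σ ρ} (hψ : ψ.IsTKilling)
    (x₀ : M) : ∀ᶠ x in 𝓝 x₀, (ψ.VanishesAt x ↔ ψ.VanishesAt x₀) := by
  let := InnerProductSpace.complexToReal (G := S)
  set a := σ.indexAt x₀ with ha
  set V := chartSet n x₀ (σ.U a) with hV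
  have hVo : IsOpen V := isOpen_chartSet x₀ (σ.isOpen_U a)
  have hg := (isLeviCivitaOn_chart g x₀).mono (W := V) (fun z hz ↦ hz.1) hVo
  have he := isOrthonormalFrameOn_chartFrame σ a x₀
  set f := chartSpinor ψ a x₀ with hf
  have hzero : ∀ z ∈ V, fderiv ℝ (fun z ↦ ‖f z‖ ^ 2) z = 0 := by
    intro z hz
    have hd : DifferentiableAt ℝ f z := (contDiffAt_chartSpinor ψ hz).differentiableAt (by simp)
    rw [hd.hasFDerivAt.norm_sq.fderiv]
    ext u
    simp only [smul_apply, ContinuousLinearMap.comp_apply, innerSL_apply_apply, zero_apply]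
    -- At a zero the Killing equation is not available, but there the derivative 2⟨f, df⟩ of |f|²
    -- vanishes anyway.
    by_cases hne : f z = 0
    · rw [hne, inner_zero_left, smul_zero]
    · rw [hf, fderiv_chartSpinor_of_isTKilling hψ hz hne, killingForm]
      simp only [add_apply, smul_apply, inner_neg_right, inner_add_right, inner_smul_right]
      rw [inner_linElem_self (inner_cliffGen hρ),
        inner_quadElem_self (inner_cliffGen hρ) (connForm_skew hg he hz u)]
      simp
  obtain ⟨r, hr, hball⟩ := Metric.isOpen_iff.1 hVo _ (mem_chartSet (σ.mem_U x₀))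
  have hconst : ∀ z ∈ Metric.ball (extChartAt (𝓡 n) x₀ x₀) r,
      ‖f z‖ ^ 2 = ‖f (extChartAt (𝓡 n) x₀ x₀)‖ ^ 2 := by
    intro z hz
    refine Metric.isOpen_ball.is_const_of_fderiv_eq_zero (𝕜 := ℝ) (f := fun z ↦ ‖f z‖ ^ 2)
      (convex_ball _ _).isPreconnected ?_ (fun z hz ↦ hzero z (hball hz)) hz (Metric.mem_ball_self hr)
    intro z hz
    exact ((contDiffAt_chartSpinor ψ (hball hz)).differentiableAt
      (by simp)).hasFDerivAt.norm_sq.differentiableAt.differentiableWithinAt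
  have hc : ∀ᶠ x in 𝓝 x₀, extChartAt (𝓡 n) x₀ x ∈ Metric.ball (extChartAt (𝓡 n) x₀ x₀) r :=
    (continuousAt_extChartAt x₀).preimage_mem_nhds (Metric.ball_mem_nhds _ hr)
  filter_upwards [hc, extChartAt_source_mem_nhds (I := 𝓡 n) x₀,
    (σ.isOpen_U a).mem_nhds (σ.mem_U x₀)] with x hx hxs hxU
  have h1 := hconst _ hx
  simp only [hf, chartSpinor] at h1
  rw [(extChartAt (𝓡 n) x₀).left_inv hxs, extChartAt_to_inv] at h1
  rw [vanishesAt_iff ψ hxU, vanishesAt_iff ψ (σ.mem_U x₀), ← norm_eq_zero, ← sq_eq_zero_iff (a := ‖_‖), h1]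
  simp [ha]

/-- Since |ψ| is locally constant, vanishing is a locally constant property, and connectedness
spreads nonvanishing from one point to all of M. -/
theorem not_vanishesAt [ConnectedSpace M] (hρ : IsSpinorRep ρ) {ψ : SpinorField σ ρ}
    (hψ : ψ.IsTKilling) (hne : ∃ x, ¬ ψ.VanishesAt x) (x : M) : ¬ ψ.VanishesAt x := by
  obtain ⟨y, hy⟩ := hne
  have h : IsLocallyConstant fun x ↦ ψ.VanishesAt x :=
    (IsLocallyConstant.iff_eventually_eq _).2 fun x₀ ↦ by
      filter_upwards [eventually_vanishesAt_iff hρ hψ x₀] with x hx using propext hx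
  have := h.apply_eq_of_isPreconnected isPreconnected_univ (mem_univ x) (mem_univ y)
  simpa only [this]

end SpinorCharts

/-! ## The parallel projection in charts -/

section ProjectionCharts

variable {n : ℕ} {M : Type*} [TopologicalSpace M] [ChartedSpace (Eu n) M]

/-- A subspace of the tangent space at `x` as a subspace of `ℝⁿ`. -/
def subspaceAt (K : ∀ x : M, Submodule ℝ (TangentSpace (𝓡 n) x)) (x : M) : Submodule ℝ (Eu n) := K x

/-- An endomorphism of the tangent space at `x` as an endomorphism of `ℝⁿ`. -/
def endoAt (P : ∀ x : M, TangentSpace (𝓡 n) x →L[ℝ] TangentSpace (𝓡 n) x) (x : M) :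
    Eu n →L[ℝ] Eu n := P x

variable [IsManifold (𝓡 n) ∞ M]

theorem isProjAlong_of_isOrthProjOnto (g : RiemMetric n M)
    {K : ∀ x : M, Submodule ℝ (TangentSpace (𝓡 n) x)}
    {P : ∀ x : M, TangentSpace (𝓡 n) x →L[ℝ] TangentSpace (𝓡 n) x} {x : M}
    (h : IsOrthProjOnto g.inner x (orthCompl g.inner x (K x)) (P x)) :
    IsProjAlong (tensorAt g.inner x) (subspaceAt K x) (endoAt P x) :=
  .of_orthCompl (fun u v ↦ g.symm x u v) (fun u hu ↦ g.pos x u hu) (fun v w hw ↦ (h v).1 w hw)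
    (fun v w hw ↦ (h v).2 w hw)

section Pullback

variable (g : RiemMetric n M) {P : ∀ x : M, TangentSpace (𝓡 n) x →L[ℝ] TangentSpace (𝓡 n) x}
  {K : ∀ x : M, Submodule ℝ (TangentSpace (𝓡 n) x)} {x₀ : M} {z : Eu n}
  (hz : z ∈ (extChartAt (𝓡 n) x₀).target)
include hz

theorem chartDeriv_chartEndo' (v : Eu n) : chartDeriv n x₀ z (chartEndo P x₀ z v) =
    endoAt P ((extChartAt (𝓡 n) x₀).symm z) (chartDeriv n x₀ z v) :=
  chartDeriv_chartEndo P hz v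

/-- Being an orthogonal projection carries over to the chart. -/
theorem isProjAlong_chartEndo {κ : Type*} {Y : κ → ∀ x : M, TangentSpace (𝓡 n) x}
    (hP : IsProjAlong (tensorAt g.inner ((extChartAt (𝓡 n) x₀).symm z))
      (subspaceAt K ((extChartAt (𝓡 n) x₀).symm z)) (endoAt P ((extChartAt (𝓡 n) x₀).symm z)))
    (hspan : Submodule.span ℝ (range fun i ↦ vecAt (Y i) ((extChartAt (𝓡 n) x₀).symm z)) =
      subspaceAt K ((extChartAt (𝓡 n) x₀).symm z)) :
    IsProjAlong (chartTensor g.inner x₀ z)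
      (Submodule.span ℝ (range fun i ↦ chartField n (Y i) x₀ z)) (chartEndo P x₀ z) := by
  have hinj := (isInvertible_chartDeriv hz).injective
  refine ⟨fun v ↦ hinj ?_, fun v w ↦ ?_, fun v ↦ ?_⟩
  · rw [chartDeriv_chartEndo' hz, chartDeriv_chartEndo' hz, hP.idem]
  · rw [chartTensor_apply, chartTensor_apply, chartDeriv_chartEndo' hz, chartDeriv_chartEndo' hz,
      hP.symm]
  · have h1 : chartEndo P x₀ z v = 0 ↔
        endoAt P ((extChartAt (𝓡 n) x₀).symm z) (chartDeriv n x₀ z v) = 0 := by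
      rw [← chartDeriv_chartEndo' hz]
      exact (map_eq_zero_iff (chartDeriv n x₀ z) hinj).symm
    have h2 : subspaceAt K ((extChartAt (𝓡 n) x₀).symm z) =
        (Submodule.span ℝ (range fun i ↦ chartField n (Y i) x₀ z)).map
          (chartDeriv n x₀ z).toLinearMap := by
      rw [Submodule.map_span, ← range_comp, ← hspan]
      congr 2
      funext i
      exact (chartDeriv_chartField (Y i) hz).symm
    rw [h1, hP.ker, h2]
    exact Function.Injective.mem_set_image hinj

end Pullback

/-- The projection along a parallel distribution is differentiable and parallel in charts. -/
theorem chartEndo_parallel (g : RiemMetric n M)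
    {P : ∀ x : M, TangentSpace (𝓡 n) x →L[ℝ] TangentSpace (𝓡 n) x}
    {K : ∀ x : M, Submodule ℝ (TangentSpace (𝓡 n) x)} {k : ℕ} (hK : IsSmoothDistribution K k)
    (hK_parallel : IsParallelDistribution g.inner K)
    (hP : ∀ x, IsProjAlong (tensorAt g.inner x) (subspaceAt K x) (endoAt P x)) (x₀ : M) :
    ∃ U : Set M, IsOpen U ∧ x₀ ∈ U ∧ ∀ z ∈ chartSet n x₀ U,
      DifferentiableAt ℝ (chartEndo P x₀) z ∧ ∀ u v, fderiv ℝ (chartEndo P x₀) z u v =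
        chartEndo P x₀ z (christoffelMap (chartTensor g.inner x₀) z u v) -
          christoffelMap (chartTensor g.inner x₀) z u (chartEndo P x₀ z v) := by
  obtain ⟨U, hU, hxU, Y, hY, hYK⟩ := hK x₀
  refine ⟨U, hU, hxU, ?_⟩
  set V := chartSet n x₀ U with hV
  have hVo : IsOpen V := isOpen_chartSet x₀ hU
  have hg := (isLeviCivitaOn_chart g x₀).mono (W := V) (fun z hz ↦ hz.1) hVo
  have hYat : ∀ z ∈ V, ∀ i, ContMDiffAt (𝓡 n) (𝓡 n).tangent ∞
      (fun x ↦ (Y i x : TangentBundle (𝓡 n) M)) ((extChartAt (𝓡 n) x₀).symm z) :=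
    fun z hz i ↦ (hY i).contMDiffAt (hU.mem_nhds hz.2)
  have hYd : ∀ z ∈ V, ∀ i, DifferentiableAt ℝ (chartField n (Y i) x₀) z := fun z hz i ↦
    (contDiffAt_chartField hz.1 (hYat z hz i)).differentiableAt (by simp)
  have hproj : ∀ z ∈ V, IsProjAlong (chartTensor g.inner x₀ z)
      (Submodule.span ℝ (range fun i ↦ chartField n (Y i) x₀ z)) (chartEndo P x₀ z) :=
    fun z hz ↦ isProjAlong_chartEndo g hz.1 (hP _) (hYK _ hz.2).2
  have hmem : ∀ z i, chartField n (Y i) x₀ z ∈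
      Submodule.span ℝ (range fun i ↦ chartField n (Y i) x₀ z) := fun z i ↦
    Submodule.subset_span (mem_range_self i)
  have hind : ∀ z ∈ V, LinearIndependent ℝ fun i ↦ chartField n (Y i) x₀ z := by
    intro z hz
    refine LinearIndependent.of_comp (chartDeriv n x₀ z).toLinearMap ?_
    have h1 : LinearIndependent ℝ fun i ↦ vecAt (Y i) ((extChartAt (𝓡 n) x₀).symm z) :=
      (hYK _ hz.2).1
    convert h1 using 1
    funext i
    exact chartDeriv_chartField (Y i) hz.1
  have hd : ∀ z ∈ V, DifferentiableAt ℝ (chartEndo P x₀) z := fun z hz ↦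
    differentiableAt_of_ker_frame (hVo.mem_nhds hz) (hg.differentiableAt_metric z hz) hg.metric_pos
      (hYd z hz) hind (fun z hz v ↦ (hproj z hz).sub_mem v)
      (fun z hz v i ↦ (hproj z hz).apply_apply_eq_zero v (hmem z i))
  refine fun z hz ↦ ⟨hd z hz, fderiv_of_parallel_ker hg hz (hYd z hz) (hd z hz)
    (fun z hz ↦ (hproj z hz).idem) (fun z hz ↦ (hproj z hz).symm)
    (fun z hz i ↦ ((hproj z hz).ker _).2 (hmem z i)) (fun i u ↦ ?_) fun v ↦ ((hproj z hz).ker v).1⟩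
  -- Parallelism is a condition on M, stated in the preferred chart of each point. In the chart
  -- around `x₀` it says that the projection kills ∇_u Y_i.
  have h1 := hK_parallel U (Y i) hU (hY i) (fun x hx ↦ (hYK x hx).2 ▸
    Submodule.subset_span (mem_range_self i)) _ hz.2 (chartDeriv n x₀ z u)
  rw [leviCivita_chart g hz.1 (hYat z hz i)] at h1
  apply (isInvertible_chartDeriv hz.1).injective
  rw [chartDeriv_chartEndo' hz.1, map_zero]
  exact ((hP _).ker _).2 h1

end ProjectionCharts

/-! ## The generalized cone in charts -/

section ConeCharts

variable {n : ℕ} {M : Type*} [TopologicalSpace M] [ChartedSpace (Eu n) M] [IsManifold (𝓡 n) ∞ M]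

/-- The component along `ℝ` of a tangent vector of `M × ℝ`. -/
def sndDeriv (r : M × ℝ) (a : TangentSpace ((𝓡 n).prod 𝓘(ℝ, ℝ)) r) : ℝ :=
  mfderiv ((𝓡 n).prod 𝓘(ℝ, ℝ)) 𝓘(ℝ, ℝ) Prod.snd r a

omit [IsManifold (𝓡 n) ∞ M] in
theorem coneMetric_apply (g h : TwoTensor (𝓡 n) M) (r : M × ℝ)
    (a b : TangentSpace ((𝓡 n).prod 𝓘(ℝ, ℝ)) r) : coneMetric g h r a b =
      tensorAt g r.1 (mfderiv ((𝓡 n).prod 𝓘(ℝ, ℝ)) (𝓡 n) Prod.fst r a)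
        (mfderiv ((𝓡 n).prod 𝓘(ℝ, ℝ)) (𝓡 n) Prod.fst r b) +
      (r.2 ^ 2 - 1) * tensorAt h r.1 (mfderiv ((𝓡 n).prod 𝓘(ℝ, ℝ)) (𝓡 n) Prod.fst r a)
        (mfderiv ((𝓡 n).prod 𝓘(ℝ, ℝ)) (𝓡 n) Prod.fst r b) +
      sndDeriv r a * sndDeriv r b := rfl

/-- The chart of M × ℝ at `q` is a chart of M times the identity of ℝ, so with h = g(P·,·) the cone
metric becomes the coordinate model `coneForm`. -/
theorem chartTensor_coneMetric {g h : TwoTensor (𝓡 n) M}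
    {P : ∀ x : M, TangentSpace (𝓡 n) x →L[ℝ] TangentSpace (𝓡 n) x}
    (hP : ∀ x u v, tensorAt h x u v = tensorAt g x (endoAt P x u) v) (q : M × ℝ) {p : Eu n × ℝ}
    (hp : p.1 ∈ (extChartAt (𝓡 n) q.1).target) :
    chartTensor (coneMetric g h) q p = coneForm (chartTensor g q.1) (chartEndo P q.1) p := by
  have hsymm : ((extChartAt ((𝓡 n).prod 𝓘(ℝ, ℝ)) q).symm : Eu n × ℝ → M × ℝ) =
      fun p ↦ ((extChartAt (𝓡 n) q.1).symm p.1, p.2) := by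
    rw [extChartAt_prod]
    rfl
  have hpt : p ∈ (extChartAt ((𝓡 n).prod 𝓘(ℝ, ℝ)) q).target := by
    rw [extChartAt_prod]
    exact ⟨hp, by rw [extChartAt_model_space_eq_id]; exact mem_univ _⟩
  have hA := (contMDiffAt_extChartAt_symm hp).mdifferentiableAt (by simp)
  have hmd : MDifferentiableAt 𝓘(ℝ, Eu n × ℝ) ((𝓡 n).prod 𝓘(ℝ, ℝ))
      (extChartAt ((𝓡 n).prod 𝓘(ℝ, ℝ)) q).symm p :=
    ((contMDiffOn_extChartAt_symm (n := ∞) q).contMDiffAt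
      ((isOpen_extChartAt_target q).mem_nhds hpt)).mdifferentiableAt (by simp)
  have hfst : ∀ u : Eu n × ℝ, (mfderiv ((𝓡 n).prod 𝓘(ℝ, ℝ)) (𝓡 n) Prod.fst
      ((extChartAt ((𝓡 n).prod 𝓘(ℝ, ℝ)) q).symm p)
      (mfderiv 𝓘(ℝ, Eu n × ℝ) ((𝓡 n).prod 𝓘(ℝ, ℝ)) (extChartAt ((𝓡 n).prod 𝓘(ℝ, ℝ)) q).symm p u) :
      Eu n) = chartDeriv n q.1 p.1 u.1 := by
    intro u
    have h1 := mfderiv_comp p (I'' := 𝓡 n) (mdifferentiableAt_fst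
      (x := (extChartAt ((𝓡 n).prod 𝓘(ℝ, ℝ)) q).symm p)) hmd
    have h2 : Prod.fst ∘ (extChartAt ((𝓡 n).prod 𝓘(ℝ, ℝ)) q).symm =
        (extChartAt (𝓡 n) q.1).symm ∘ (Prod.fst : Eu n × ℝ → Eu n) := by
      rw [hsymm]
      rfl
    have hf : MDifferentiableAt 𝓘(ℝ, Eu n × ℝ) 𝓘(ℝ, Eu n) (Prod.fst : Eu n × ℝ → Eu n) p :=
      differentiableAt_fst.mdifferentiableAt
    rw [h2, mfderiv_comp p (I' := 𝓘(ℝ, Eu n)) hA hf, mfderiv_eq_fderiv, fderiv_fst] at h1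
    exact (congrArg (fun L ↦ L u) h1).symm
  have hsnd : ∀ u : Eu n × ℝ, (mfderiv ((𝓡 n).prod 𝓘(ℝ, ℝ)) 𝓘(ℝ, ℝ) Prod.snd
      ((extChartAt ((𝓡 n).prod 𝓘(ℝ, ℝ)) q).symm p)
      (mfderiv 𝓘(ℝ, Eu n × ℝ) ((𝓡 n).prod 𝓘(ℝ, ℝ)) (extChartAt ((𝓡 n).prod 𝓘(ℝ, ℝ)) q).symm p u) :
      ℝ) = u.2 := by
    intro u
    have h1 := mfderiv_comp p (I'' := 𝓘(ℝ, ℝ)) (mdifferentiableAt_snd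
      (x := (extChartAt ((𝓡 n).prod 𝓘(ℝ, ℝ)) q).symm p)) hmd
    have h2 : Prod.snd ∘ (extChartAt ((𝓡 n).prod 𝓘(ℝ, ℝ)) q).symm =
        (Prod.snd : Eu n × ℝ → ℝ) := by
      rw [hsymm]
      rfl
    rw [h2, mfderiv_eq_fderiv, fderiv_snd] at h1
    exact (congrArg (fun L ↦ L u) h1).symm
  refine ContinuousLinearMap.ext fun u ↦ ContinuousLinearMap.ext fun v ↦ ?_
  refine (coneMetric_apply g h ((extChartAt ((𝓡 n).prod 𝓘(ℝ, ℝ)) q).symm p) _ _).trans ?_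
  have hcongr : ∀ (G : TwoTensor (𝓡 n) M) (r r' : M) (a a' b b' : Eu n), r = r' → a = a' → b = b' →
      tensorAt G r a b = tensorAt G r' a' b' := by
    rintro G r _ a _ b _ rfl rfl rfl
    rfl
  have h1 : ((extChartAt ((𝓡 n).prod 𝓘(ℝ, ℝ)) q).symm p).1 = (extChartAt (𝓡 n) q.1).symm p.1 := by
    rw [hsymm]
  have h2 : ((extChartAt ((𝓡 n).prod 𝓘(ℝ, ℝ)) q).symm p).2 = p.2 := by
    rw [hsymm]
  rw [coneForm_apply, chartTensor_apply, chartTensor_apply, chartDeriv_chartEndo' hp, ← hP]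
  refine congrArg₂ (· + ·) (congrArg₂ (· + ·) (hcongr g _ _ _ _ _ _ h1 (hfst u) (hfst v))
    (congrArg₂ (· * ·) ?_ (hcongr h _ _ _ _ _ _ h1 (hfst u) (hfst v))))
    (congrArg₂ (· * ·) (hsnd u) (hsnd v))
  rw [h2]

/-- The curvature of the generalized cone at `q`, from the Christoffel symbols near the chart
point. -/
theorem ricci_eq_of_eventuallyEq {E : Type*} [NormedAddCommGroup E] [NormedSpace ℝ E]
    [FiniteDimensional ℝ E] {H : Type*} [TopologicalSpace H] {I : ModelWithCorners ℝ E H} {N : Type*}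
    [TopologicalSpace N] [ChartedSpace H N] (G : TwoTensor I N) (q : N) {Γ : E → E → E → E}
    (hΓ : ∀ᶠ p in 𝓝 (extChartAt I q q), ∀ a b, christoffel G q p a b = Γ p a b) (b c : E) :
    ricci G q b c = ∑ i, (Module.finBasis ℝ E).coord i
      (fderiv ℝ (fun p ↦ Γ p b c) (extChartAt I q q) (Module.finBasis ℝ E i) -
      fderiv ℝ (fun p ↦ Γ p (Module.finBasis ℝ E i) c) (extChartAt I q q) b +
      Γ (extChartAt I q q) (Module.finBasis ℝ E i) (Γ (extChartAt I q q) b c) -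
      Γ (extChartAt I q q) b (Γ (extChartAt I q q) (Module.finBasis ℝ E i) c)) := by
  have h1 : ∀ b c, fderiv ℝ (fun p ↦ christoffel G q p b c) (extChartAt I q q) =
      fderiv ℝ (fun p ↦ Γ p b c) (extChartAt I q q) := fun b c ↦ by
    apply Filter.EventuallyEq.fderiv_eq
    filter_upwards [hΓ] with p hp using hp b c
  simp only [ricci, curvature, h1, hΓ.self_of_nhds]

theorem christoffelMap_congr {E : Type*} [NormedAddCommGroup E] [NormedSpace ℝ E]
    {g g' : E → E →L[ℝ] E →L[ℝ] ℝ} {z : E} (h : g =ᶠ[𝓝 z] g') :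
    christoffelMap g z = christoffelMap g' z := by
  simp only [christoffelMap, h.fderiv_eq, h.self_of_nhds]

end ConeCharts

/-! ## Ricci-flatness of the generalized cone -/

section Cone

variable {n : ℕ} {M : Type*} [TopologicalSpace M] [ChartedSpace (Eu n) M] [IsManifold (𝓡 n) ∞ M]
  {g : RiemMetric n M} {h : TwoTensor (𝓡 n) M}
  {P : ∀ x : M, TangentSpace (𝓡 n) x →L[ℝ] TangentSpace (𝓡 n) x}
  {K : ∀ x : M, Submodule ℝ (TangentSpace (𝓡 n) x)}
  (hh : ∀ x u v, tensorAt h x u v = tensorAt g.inner x (endoAt P x u) v)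
  (hP : ∀ x, IsProjAlong (tensorAt g.inner x) (subspaceAt K x) (endoAt P x))

theorem tensorAt_pos (g : RiemMetric n M) (x : M) {v : Eu n} (hv : v ≠ 0) :
    0 < tensorAt g.inner x v v := g.pos x v hv

include hh hP

/-- The metrics `g + (t² - 1) h` split orthogonally along the projection. -/
theorem inner_add_smul_eq (t : ℝ) (x : M) (v : Eu n) :
    tensorAt g.inner x v v + (t ^ 2 - 1) * tensorAt h x v v =
      tensorAt g.inner x (v - endoAt P x v) (v - endoAt P x v) +
        t ^ 2 * tensorAt g.inner x (endoAt P x v) (endoAt P x v) := by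
  have h1 := (hP x).symm v (endoAt P x v)
  have h2 := (hP x).symm v v
  rw [(hP x).idem] at h1
  simp only [hh, map_sub, sub_apply]
  linear_combination t ^ 2 * h2 - (1 + t ^ 2) * h1

theorem isConeRadius_half : IsConeRadius g.inner h (1 / 2) := by
  refine ⟨by norm_num, fun t ht x v hv ↦ ?_⟩
  -- Only t > 0 matters here, so any ε ≤ 1 would do as well.
  have ht0 : 0 < t := by
    have := ht.1
    linarith
  have key : ∀ v : Eu n, v ≠ 0 →
      0 < tensorAt g.inner x v v + (t ^ 2 - 1) * tensorAt h x v v := by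
    intro v hv
    rw [inner_add_smul_eq hh hP]
    by_cases hPv : endoAt P x v = 0
    · rw [hPv, sub_zero, map_zero, mul_zero, add_zero]
      exact tensorAt_pos g x hv
    · refine add_pos_of_nonneg_of_pos ?_ (mul_pos (by positivity) (tensorAt_pos g x hPv))
      by_cases h0 : v - endoAt P x v = 0
      · rw [h0, map_zero]
      · exact (tensorAt_pos g x h0).le
  exact key v hv

/-- On the cone interval there is a function which plays the role of `1 / t` on the image of the
projection (the interval may contain `0` only if the projection vanishes). -/
theorem exists_inverse_radius {ε : ℝ} (hε : IsConeRadius g.inner h ε) :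
    ∃ τ τ' : ℝ → ℝ, ∀ t ∈ coneInterval ε, HasDerivAt τ (τ' t) t ∧
      ∀ x v, (t * τ t) • endoAt P x v = endoAt P x v ∧ (τ' t + τ t ^ 2) • endoAt P x v = 0 := by
  by_cases h0 : (0 : ℝ) ∈ coneInterval ε
  -- At t = 0 the form g - h vanishes on the image of the projection, so positivity forces the
  -- projection to be zero at every point, and τ = 0 serves.
  · refine ⟨fun _ ↦ 0, fun _ ↦ 0, fun t _ ↦ ⟨hasDerivAt_const t 0, fun x v ↦ ?_⟩⟩
    have hzero : endoAt P x v = 0 := by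
      by_contra hne
      have h1 : 0 < tensorAt g.inner x (endoAt P x v) (endoAt P x v) +
          ((0 : ℝ) ^ 2 - 1) * tensorAt h x (endoAt P x v) (endoAt P x v) :=
        hε.2 0 h0 x (endoAt P x v) hne
      rw [hh, (hP x).idem] at h1
      simp at h1
    simp [hzero]
  · refine ⟨fun t ↦ t⁻¹, fun t ↦ -(t ^ 2)⁻¹, fun t ht ↦ ?_⟩
    have ht0 : t ≠ 0 := fun h ↦ h0 (h ▸ ht)
    refine ⟨hasDerivAt_inv ht0, fun x v ↦ ⟨?_, ?_⟩⟩
    · rw [mul_inv_cancel₀ ht0, one_smul]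
    · rw [inv_pow, neg_add_cancel, zero_smul]

omit hh in
theorem chartEndo_idem_symm {x₀ : M} {z : Eu n} (hz : z ∈ (extChartAt (𝓡 n) x₀).target) :
    (∀ v, chartEndo P x₀ z (chartEndo P x₀ z v) = chartEndo P x₀ z v) ∧
      ∀ v w, chartTensor g.inner x₀ z (chartEndo P x₀ z v) w =
        chartTensor g.inner x₀ z v (chartEndo P x₀ z w) := by
  refine ⟨fun v ↦ (isInvertible_chartDeriv hz).injective ?_, fun v w ↦ ?_⟩
  · rw [chartDeriv_chartEndo' hz, chartDeriv_chartEndo' hz, (hP _).idem]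
  · rw [chartTensor_apply, chartTensor_apply, chartDeriv_chartEndo' hz, chartDeriv_chartEndo' hz,
      (hP _).symm]

-- Positivity makes the cone metric invertible on its whole domain, as `christoffelMap_coneForm`
-- requires.
omit hP in
theorem coneForm_pos {ε : ℝ} (hε : IsConeRadius g.inner h ε) {x₀ : M} {p : Eu n × ℝ}
    (hp : p.1 ∈ (extChartAt (𝓡 n) x₀).target) (ht : p.2 ∈ coneInterval ε) (a : Eu n × ℝ)
    (ha : a ≠ 0) : 0 < coneForm (chartTensor g.inner x₀) (chartEndo P x₀) p a a := by
  rw [coneForm_apply, chartTensor_apply, chartTensor_apply, chartDeriv_chartEndo' hp, ← hh]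
  by_cases h1 : a.1 = 0
  · have h2 : a.2 ≠ 0 := fun h2 ↦ ha (Prod.ext h1 h2)
    rw [h1, map_zero, map_zero, map_zero, mul_zero, add_zero, zero_add]
    exact mul_self_pos.2 h2
  · have h2 : chartDeriv n x₀ p.1 a.1 ≠ 0 := fun h2 ↦
      h1 ((isInvertible_chartDeriv hp).injective (h2.trans (map_zero _).symm))
    exact add_pos_of_pos_of_nonneg (hε.2 p.2 ht _ _ h2) (mul_self_nonneg a.2)

/-- The generalized cone is Ricci-flat if the Ricci tensor of `g` is `(tr H - 1) h`. -/
theorem ricci_coneMetric {k : ℕ} (hK : IsSmoothDistribution K k)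
    (hK_parallel : IsParallelDistribution g.inner K) {ε : ℝ} (hε : IsConeRadius g.inner h ε)
    {q : M × ℝ} (hq : q ∈ coneDomain M ε) {f : Fin n → Eu n}
    (hf : ∀ i j, chartTensor g.inner q.1 (extChartAt (𝓡 n) q.1 q.1) (f i) (f j) =
      if i = j then 1 else 0)
    (hRic : ∀ v w, ∑ i, chartTensor g.inner q.1 (extChartAt (𝓡 n) q.1 q.1)
        (curvatureOf (christoffelMap (chartTensor g.inner q.1)) (extChartAt (𝓡 n) q.1 q.1) (f i) v w)
        (f i) =
      (LinearMap.trace ℝ (Eu n) (chartEndo P q.1 (extChartAt (𝓡 n) q.1 q.1)).toLinearMap - 1) *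
        chartTensor g.inner q.1 (extChartAt (𝓡 n) q.1 q.1)
          (chartEndo P q.1 (extChartAt (𝓡 n) q.1 q.1) v) w)
    (b c : Eu n × ℝ) : ricci (coneMetric g.inner h) q b c = 0 := by
  obtain ⟨τ, τ', hτ⟩ := exists_inverse_radius hh hP hε
  obtain ⟨U, hU, hxU, hpar⟩ := chartEndo_parallel g hK hK_parallel hP q.1
  have hg := (isLeviCivitaOn_chart g q.1).mono (W := chartSet n q.1 U) (fun z hz ↦ hz.1)
    (isOpen_chartSet q.1 hU)
  have hτ_smul : ∀ p : Eu n × ℝ, p.1 ∈ chartSet n q.1 U → p.2 ∈ coneInterval ε →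
      (p.2 * τ p.2) • chartEndo P q.1 p.1 = chartEndo P q.1 p.1 ∧
        (τ' p.2 + τ p.2 ^ 2) • chartEndo P q.1 p.1 = 0 := by
    intro p hp ht
    constructor <;>
    · refine ContinuousLinearMap.ext fun v ↦ (isInvertible_chartDeriv hp.1).injective ?_
      simp only [smul_apply, zero_apply, map_smul, map_zero, chartDeriv_chartEndo' hp.1,
        ((hτ _ ht).2 _ _).1, ((hτ _ ht).2 _ _).2]
  have hy : extChartAt ((𝓡 n).prod 𝓘(ℝ, ℝ)) q q = (extChartAt (𝓡 n) q.1 q.1, q.2) := by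
    rw [extChartAt_prod]
    rfl
  have hyU := mem_chartSet (n := n) hxU
  have hopen : IsOpen (chartSet n q.1 U ×ˢ coneInterval ε) :=
    (isOpen_chartSet q.1 hU).prod isOpen_Ioo
  -- The formula is needed on a neighbourhood of the chart point, because the curvature
  -- differentiates the Christoffel symbols.
  have hΓ : ∀ p ∈ chartSet n q.1 U ×ˢ coneInterval ε, ∀ a b,
      christoffel (coneMetric g.inner h) q p a b = coneChristoffel (chartTensor g.inner q.1)
        (christoffelMap (chartTensor g.inner q.1)) (chartEndo P q.1) τ p a b := by
    intro p hp a b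
    have h1 : chartTensor (coneMetric g.inner h) q =ᶠ[𝓝 p]
        coneForm (chartTensor g.inner q.1) (chartEndo P q.1) := by
      filter_upwards [hopen.mem_nhds hp] with r hr using chartTensor_coneMetric hh q hr.1.1
    have h2 : christoffel (coneMetric g.inner h) q p a b =
      christoffelMap (chartTensor (coneMetric g.inner h) q) p a b := rfl
    rw [h2, christoffelMap_congr h1]
    have hHs := chartEndo_idem_symm hP hp.1.1
    exact christoffelMap_coneForm hg hp.1 (hpar _ hp.1).1 (hpar _ hp.1).2 hHs.1 hHs.2
      (hτ_smul p hp.1 hp.2).1 (coneForm_pos hh hε hp.1.1 hp.2) a b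
  have hyS : extChartAt ((𝓡 n).prod 𝓘(ℝ, ℝ)) q q ∈ chartSet n q.1 U ×ˢ coneInterval ε := by
    rw [hy]
    exact ⟨hyU, hq⟩
  rw [ricci_eq_of_eventuallyEq (coneMetric g.inner h) q (by
    filter_upwards [hopen.mem_nhds hyS] with p hp using hΓ p hp), hy]
  have hHs := chartEndo_idem_symm hP hyU.1
  have hs := hτ_smul (extChartAt (𝓡 n) q.1 q.1, q.2) hyU hq
  exact trace_curvature_coneChristoffel (p := (extChartAt (𝓡 n) q.1 q.1, q.2)) hg hyU
    (hpar _ hyU).1 (hpar _ hyU).2 hHs.1 hHs.2 hs.1 (hτ _ hq).1 hs.2 hf (by simp) b c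
    (hRic _ _) _

end Cone

/-! ## The Ricci tensor of a manifold with a `T`-Killing spinor -/

section TKilling

variable {n : ℕ} {M : Type*} [TopologicalSpace M] [ChartedSpace (Eu n) M] [IsManifold (𝓡 n) ∞ M]
  {g : RiemMetric n M} {ι : Type*} {σ : SpinStructure ι g}
  {S : Type*} [NormedAddCommGroup S] [InnerProductSpace ℂ S]
  {ρ : Cl n →ₐ[ℝ] Module.End ℂ S}

theorem IsOrthonormalFrameOn.mono {E : Type*} [NormedAddCommGroup E] [NormedSpace ℝ E]
    {κ : Type*} [Fintype κ] [DecidableEq κ] {g : E → E →L[ℝ] E →L[ℝ] ℝ} {e : κ → E → E}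
    {V W : Set E} (h : IsOrthonormalFrameOn g e V) (hWV : W ⊆ V) : IsOrthonormalFrameOn g e W :=
  ⟨fun i z hz ↦ h.contDiffAt i z (hWV hz), fun z hz ↦ h.orthonormal z (hWV hz), h.card_eq⟩

/-- `emEndo` raises an index of `emTensor` with the inverse of `g`. Lowering it again gives h =
g(H·,·), the form in which the cone lemmas take h. -/
theorem tensorAt_emTensor (ψ : SpinorField σ ρ) (x : M) (u v : Eu n) :
    tensorAt (fun x ↦ (2 : ℝ) • ψ.emTensor x) x u v =
      tensorAt g.inner x (endoAt (fun x ↦ (2 : ℝ) • ψ.emEndo x) x u) v := by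
  have h1 : tensorAt g.inner x (endoAt ψ.emEndo x u) = tensorAt ψ.emTensor x u :=
    (isInvertible_of_pos fun v hv ↦ tensorAt_pos g x hv).self_apply_inverse _
  have h2 : endoAt (fun x ↦ (2 : ℝ) • ψ.emEndo x) x u = (2 : ℝ) • endoAt ψ.emEndo x u := rfl
  rw [h2, map_smul, h1]
  rfl

/-- If `2 T^ψ` is the projection along a parallel distribution, then the Ricci tensor is
`(tr H - 1) h` with `H = 2 T^ψ`. -/
theorem ricci_of_isTKilling [FiniteDimensional ℂ S] {k : ℕ}
    {K : ∀ x : M, Submodule ℝ (TangentSpace (𝓡 n) x)}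
    (hK : IsSmoothDistribution K k) (hK_parallel : IsParallelDistribution g.inner K)
    {ψ : SpinorField σ ρ} (hψ : ψ.IsTKilling) (hψ_ne : ∀ x, ¬ ψ.VanishesAt x)
    (hP : ∀ x, IsProjAlong (tensorAt g.inner x) (subspaceAt K x)
      (endoAt (fun x ↦ (2 : ℝ) • ψ.emEndo x) x)) (x : M) (v w : Eu n) :
    ∑ i, chartTensor g.inner x (extChartAt (𝓡 n) x x)
        (curvatureOf (christoffelMap (chartTensor g.inner x)) (extChartAt (𝓡 n) x x)
          (chartFrame σ (σ.indexAt x) x i (extChartAt (𝓡 n) x x)) v w)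
        (chartFrame σ (σ.indexAt x) x i (extChartAt (𝓡 n) x x)) =
      (LinearMap.trace ℝ (Eu n) (chartEndo (fun x ↦ (2 : ℝ) • ψ.emEndo x) x
        (extChartAt (𝓡 n) x x)).toLinearMap - 1) *
        chartTensor g.inner x (extChartAt (𝓡 n) x x)
          (chartEndo (fun x ↦ (2 : ℝ) • ψ.emEndo x) x (extChartAt (𝓡 n) x x) v) w := by
  let : InnerProductSpace ℝ S := InnerProductSpace.complexToReal
  obtain ⟨U, hU, hxU, hpar⟩ := chartEndo_parallel g hK hK_parallel hP x
  -- The projection is known to be parallel over `U`, and the orthonormal frame and the spinor are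
  -- smooth over `σ.U`; the integrability argument needs both on one open set.
  set V := chartSet n x (U ∩ σ.U (σ.indexAt x)) with hV
  have hVU : V ⊆ chartSet n x U := fun z hz ↦ ⟨hz.1, hz.2.1⟩
  have hVσ : V ⊆ chartSet n x (σ.U (σ.indexAt x)) := fun z hz ↦ ⟨hz.1, hz.2.2⟩
  have hy : extChartAt (𝓡 n) x x ∈ V := mem_chartSet ⟨hxU, σ.mem_U x⟩
  have hne : ∀ z ∈ V, chartSpinor ψ (σ.indexAt x) x z ≠ 0 := fun z hz h ↦
    hψ_ne _ ((vanishesAt_iff ψ hz.2.2).2 h)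
  have hHs := chartEndo_idem_symm hP hy.1
  exact ricci_of_generalizedKilling
    ((isLeviCivitaOn_chart g x).mono (fun z hz ↦ hz.1)
      (isOpen_chartSet x (hU.inter (σ.isOpen_U _))))
    ((isOrthonormalFrameOn_chartFrame σ (σ.indexAt x) x).mono hVσ)
    (isCliffordFamily_cliffGen ρ) hy (hpar _ (hVU hy)).1 (hpar _ (hVU hy)).2
    ((contDiffAt_chartSpinor ψ (hVσ hy)).of_le (by norm_cast))
    (fun z hz u ↦ fderiv_chartSpinor_of_isTKilling hψ (hVσ hz) (hne z hz) u)
    (hne _ hy) hHs.1 hHs.2 v w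

end TKilling

end SpinGeom

end

theorem theorem5p1 {n : ℕ} {M : Type*} [TopologicalSpace M] [ChartedSpace (SpinGeom.Eu n) M]
    [IsManifold (𝓡 n) ∞ M] [T2Space M] [CompactSpace M] [ConnectedSpace M]
    (g : SpinGeom.RiemMetric n M)
    {ι : Type*} (σ : SpinGeom.SpinStructure ι g)
    {S : Type*} [NormedAddCommGroup S] [InnerProductSpace ℂ S] [FiniteDimensional ℂ S]
    (ρ : SpinGeom.Cl n →ₐ[ℝ] Module.End ℂ S) (hρ : SpinGeom.IsSpinorRep ρ)
    (k : ℕ) (K : ∀ x : M, Submodule ℝ (TangentSpace (𝓡 n) x))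
    (hK : SpinGeom.IsSmoothDistribution K k)
    (hK_parallel : SpinGeom.IsParallelDistribution g.inner K)
    (ψ : SpinGeom.SpinorField σ ρ) (hψ : ψ.IsTKilling) (hψ_nontrivial : ∃ x, ¬ ψ.VanishesAt x)
    (hT : ∀ x, ¬ ψ.VanishesAt x → SpinGeom.IsOrthProjOnto g.inner x
      (SpinGeom.orthCompl g.inner x (K x)) ((2 : ℝ) • ψ.emEndo x)) :
    (∃ ε, SpinGeom.IsConeRadius g.inner (fun x ↦ (2 : ℝ) • ψ.emTensor x) ε) ∧
      ∀ ε, SpinGeom.IsConeRadius g.inner (fun x ↦ (2 : ℝ) • ψ.emTensor x) ε →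
        SpinGeom.RicciFlatOn (SpinGeom.coneMetric g.inner fun x ↦ (2 : ℝ) • ψ.emTensor x)
          (SpinGeom.coneDomain M ε) := by
  -- As ψ has no zeros, T^ψ is defined everywhere and the projection hypothesis holds at every
  -- point.
  have hne := SpinGeom.not_vanishesAt hρ hψ hψ_nontrivial
  have hh := SpinGeom.tensorAt_emTensor ψ
  have hP := fun x ↦ SpinGeom.isProjAlong_of_isOrthProjOnto g
    (P := fun x ↦ (2 : ℝ) • ψ.emEndo x) (hT x (hne x))
  refine ⟨⟨1 / 2, SpinGeom.isConeRadius_half hh hP⟩, fun ε hε q hq b c ↦ ?_⟩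
  -- The spin structure's frame around `q.1`, read in the chart, is the orthonormal basis that
  -- computes the Ricci trace of `g`.
  exact SpinGeom.ricci_coneMetric hh hP hK hK_parallel hε hq
    ((SpinGeom.isOrthonormalFrameOn_chartFrame σ (σ.indexAt q.1) q.1).orthonormal _
      (SpinGeom.mem_chartSet (σ.mem_U q.1)))
    (SpinGeom.ricci_of_isTKilling hK hK_parallel hψ hne hP q.1) b c
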